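/- **Theorem 4.** *Four-colour theorem (4CT).* A finite spherical polyhedron is a finite connected cell decomposition of the sphere in which every vertex has degree at least 3, the boundary of every face is a simple polygon, every edge separates two distinct faces, and two faces have at most one common edge. 4CT is the assertion that the faces of every finite spherical polyhedron can be coloured with four colours so that any two faces with a common edge have distinct colours. *Data.* Let $V=\mathfrak{sl}_2(\mathbb C)$ be the adjoint representation, with a basis $e_1,e_2,e_3$ (indices mod 3) such that $[e_a,e_b]=i\,\varepsilon_{abc}\,e_c$. Let $F:V\to V\otimes V$, $F(e_a)=i\,(e_{a-1}\otimes e_{a+1}-e_{a+1}\otimes e_{a-1})$, and let $\widetilde F:V\otimes V\to V$ be the bracket; both are intertwiners. Let $T$ be a finite simplicial triangulation of the sphere. An edge-path of $T$ is a sequence of vertices $(x_0,\dots,x_\ell)$ in which consecutive vertices form edges. A 2-edge is a pair of edge-paths which differ by the replacement of two consecutive vertices $x,z$ by $x,y,z$, or conversely, where $\{x,y,z\}$ is a triangle of $T$ (the triangle swept by the 2-edge). A section $\zeta$ over $(x_0,\dots,x_\ell)$ consists of finite-dimensional representations $\zeta_{x_0},\dots,\zeta_{x_\ell}$ of $\mathfrak{sl}_2$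 (one for each position) and, for each $k$, of intertwiners $\zeta_{x_kx_{k-1}}:\zeta_{x_{k-1}}\to V\otimes\zeta_{x_k}$ and $\zeta_{x_{k-1}x_k}:V\otimes\zeta_{x_k}\to\zeta_{x_{k-1}}$. For each 2-edge $(\gamma,\gamma')$, the map $\Phi_{\gamma\gamma'}$ from sections over $\gamma'$ to sections over $\gamma$ changes only the entries on the swept triangle, as follows (canonical associativity isomorphisms are omitted): * if $\gamma\supset(x,z)$ is replaced by $\gamma'\supset(x,y,z)$, then $\zeta\mapsto\xi$ with $\xi_x=\zeta_x$, $\xi_z=\zeta_z$, $\xi_{zx}=(\widetilde F\otimes I)\circ(I\otimes\zeta_{zy})\circ\zeta_{yx}$ and $\xi_{xz}=\zeta_{xy}\circ(I\otimes\zeta_{yz})\circ(F\otimes I)$; * if $\gamma\supset(x,y,z)$ is replaced by $\gamma'\supset(x,z)$, then $\xi\mapsto\zeta$ with $\zeta_x=\xi_x$, $\zeta_z=\xi_z$, $\zeta_y=V\otimes\xi_z$, $\zeta_{yx}=(F\otimes I)\circ\xi_{zx}$, $\zeta_{xy}=\xi_{xz}\circ(\widetilde F\otimes I)$ and $\zeta_{yz}=\zeta_{zy}=I$.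 A sweeping 2-loop of $T$ is a sequence of edge-paths $\Gamma=(\gamma_0,\dots,\gamma_n)$ with $\gamma_0=\gamma_n=(a,b)$ for some edge $\{a,b\}$ of $T$, such that each $(\gamma_p,\gamma_{p+1})$ is a 2-edge and each triangle of $T$ is swept exactly once. Let $\zeta^n$ be the section over $(a,b)$ given by $\zeta^n_a=\zeta^n_b=V$, $\zeta^n_{ba}=F$, $\zeta^n_{ab}=\widetilde F$, and put $\zeta^p=\Phi_{\gamma_p\gamma_{p+1}}(\zeta^{p+1})$ for $p=n-1,\dots,0$. The arrows of the sections $\zeta^p$ on the edges of the paths $\gamma_p$ are the arrows $\zeta_{xy}$ of the global section $\zeta$ associated with $\Gamma$ (the base edge carries two values, one from $\zeta^n$ and one from $\zeta^0$). We say that $\zeta$ is non-vanishing on every edge if none of these arrows, in either direction, is zero. *Claim.* The following are equivalent: 1. 4CT holds; 2. for every finite spherical triangulation $T$ and every sweeping 2-loop $\Gamma$ of $T$, the global section $\zeta$ associated with $\Gamma$ is non-vanishing on every edge; 3. every finite spherical triangulation $T$ has a sweeping 2-loop $\Gamma$ whose global section $\zeta$ is non-vanishing on every edge. In particular, whichever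 sweeping 2-loop is chosen for each $T$, 4CT holds if and only if all the resulting global sections are non-vanishing on every edge. -/

import Mathlib

open scoped TensorProduct

noncomputable section

namespace FourColour

/-! ### Spherical polyhedra and the four-colour theorem -/

/-- A finite spherical polyhedron, presented by its set `D` of darts (oriented edges).
`opp` reverses a dart; `next` sends a dart to the following dart on the boundary of the face
lying on its left. Faces, edges and vertices are the cycles of `next`, of `opp` and of
`next * opp` (the rotation of the darts around their common origin). -/
structure SphericalPolyhedron (D : Type) [Fintype D] where
  opp : Equiv.Perm D
  next : Equiv.Perm D
  opp_opp : ∀ d, opp (opp d) = d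
  opp_ne : ∀ d, opp d ≠ d
  /-- the surface is connected -/
  connected : ∀ d d' : D, ∃ g ∈ Subgroup.closure {opp, next}, g d = d'
  /-- the surface is a sphere: `V + F = E + 2` -/
  euler : Nat.card (Quotient (Equiv.Perm.SameCycle.setoid (next * opp))) +
      Nat.card (Quotient (Equiv.Perm.SameCycle.setoid next)) =
    Nat.card (Quotient (Equiv.Perm.SameCycle.setoid opp)) + 2
  /-- every vertex has degree at least three -/
  degree : ∀ d, (next * opp) ((next * opp) d) ≠ d
  /-- the boundary of every face is a simple polygon: it passes at most once through a vertex -/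
  simple_face : ∀ d d', next.SameCycle d d' → (next * opp).SameCycle d d' → d = d'
  /-- two faces have at most one common edge, and no edge has the same face on both sides -/
  simple_adj : ∀ d d', next.SameCycle d d' → next.SameCycle (opp d) (opp d') → d = d'

namespace SphericalPolyhedron

variable {D : Type} [Fintype D]

/-- The faces of `P`. -/
def Face (P : SphericalPolyhedron D) : Type :=
  Quotient (Equiv.Perm.SameCycle.setoid P.next)

/-- The face on the left of a dart. -/
def face (P : SphericalPolyhedron D) (d : D) : P.Face :=
  Quotient.mk (Equiv.Perm.SameCycle.setoid P.next) d

/-- A good colouring: the two faces along each edge carry distinct colours. -/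
def IsGoodColouring (P : SphericalPolyhedron D) (c : P.Face → Fin 4) : Prop :=
  ∀ d, c (P.face d) ≠ c (P.face (P.opp d))

end SphericalPolyhedron

/-- The assertion of the four-colour theorem: every finite spherical polyhedron has a good
colouring of its faces with four colours. -/
def FourColourTheorem : Prop :=
  ∀ (D : Type) [Fintype D] (P : SphericalPolyhedron D), ∃ c, P.IsGoodColouring c

/-! ### Spherical triangulations -/

/-- The edges of a family of triangles: the two-element subsets of its members. -/
def edgesOf {X : Type} [DecidableEq X] (triangles : Finset (Finset X)) : Finset (Finset X) :=
  triangles.biUnion fun t => t.powersetCard 2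

/-- The 1-skeleton of a family of triangles. -/
def skeletonOf {X : Type} (triangles : Finset (Finset X)) : SimpleGraph X where
  Adj x y := x ≠ y ∧ ∃ t ∈ triangles, x ∈ t ∧ y ∈ t
  symm := ⟨fun _ _ h => ⟨h.1.symm, h.2.imp fun _ ht => ⟨ht.1, ht.2.2, ht.2.1⟩⟩⟩
  loopless := ⟨fun _ h => h.1 rfl⟩

/-- A finite simplicial triangulation of the sphere with vertex set `X`: a connected closed
combinatorial surface of Euler characteristic `2`. -/
structure SphericalTriangulation (X : Type) [Fintype X] [DecidableEq X] where
  triangles : Finset (Finset X)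
  card_triangle : ∀ t ∈ triangles, t.card = 3
  /-- every edge lies in exactly two triangles -/
  closed : ∀ e ∈ edgesOf triangles, (triangles.filter (e ⊆ ·)).card = 2
  /-- the triangles around a vertex form a single cycle -/
  link_connected : ∀ x, ∀ s ∈ triangles, ∀ t ∈ triangles, x ∈ s → x ∈ t →
    Relation.ReflTransGen
      (fun s t => s ∈ triangles ∧ t ∈ triangles ∧ x ∈ s ∩ t ∧ (s ∩ t).card = 2) s t
  connected : (skeletonOf triangles).Connected
  /-- `V + F = E + 2` -/
  euler : Fintype.card X + triangles.card = (edgesOf triangles).card + 2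

namespace SphericalTriangulation

variable {X : Type} [Fintype X] [DecidableEq X]

/-- The graph formed by the vertices and the edges of `T`; the edge-paths of `T` are its walks. -/
def graph (T : SphericalTriangulation X) : SimpleGraph X := skeletonOf T.triangles

end SphericalTriangulation

/-! ### Representations of `sl₂` -/

/-- The complex Lie algebra `sl₂`. -/
abbrev SlTwo : Type := LieAlgebra.SpecialLinear.sl (Fin 2) ℂ

/-- A finite-dimensional complex representation of `sl₂`. -/
structure Rep : Type 1 where
  carrier : Type
  [addCommGroup : AddCommGroup carrier]
  [module : Module ℂ carrier]
  [lieRingModule : LieRingModule SlTwo carrier]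
  [lieModule : LieModule ℂ SlTwo carrier]
  [finite : Module.Finite ℂ carrier]

instance : CoeSort Rep Type := ⟨Rep.carrier⟩

attribute [instance] Rep.addCommGroup Rep.module Rep.lieRingModule Rep.lieModule Rep.finite

/-- Morphisms of representations (intertwiners). -/
abbrev Hom (M N : Rep) : Type := M →ₗ⁅ℂ, SlTwo⁆ N

/-- The adjoint representation `V`. -/
abbrev V : Rep where
  carrier := SlTwo

/-- The tensor product of two representations. -/
abbrev tensor (M N : Rep) : Rep where
  carrier := M ⊗[ℂ] N

infixr:70 " ⊠ " => tensor

/-- The tensor product of two intertwiners. -/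
def tensorHom {M M' N N' : Rep} (f : Hom M M') (g : Hom N N') : Hom (M ⊠ N) (M' ⊠ N') :=
  TensorProduct.LieModule.map f g

/-- The identity intertwiner. -/
def idHom (M : Rep) : Hom M M := LieModuleHom.id

theorem assoc_lie {M N P : Type} [AddCommGroup M] [Module ℂ M] [LieRingModule SlTwo M]
    [LieModule ℂ SlTwo M] [AddCommGroup N] [Module ℂ N] [LieRingModule SlTwo N]
    [LieModule ℂ SlTwo N] [AddCommGroup P] [Module ℂ P] [LieRingModule SlTwo P]
    [LieModule ℂ SlTwo P] (x : SlTwo) (t : (M ⊗[ℂ] N) ⊗[ℂ] P) :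
    TensorProduct.assoc ℂ M N P ⁅x, t⁆ = ⁅x, TensorProduct.assoc ℂ M N P t⁆ := by
  induction t using TensorProduct.induction_on with
  | zero => simp
  | add t₁ t₂ h₁ h₂ => simp only [lie_add, map_add, h₁, h₂]
  | tmul t p =>
    induction t using TensorProduct.induction_on with
    | zero => simp
    | add t₁ t₂ h₁ h₂ => simp only [TensorProduct.add_tmul, lie_add, map_add, h₁, h₂]
    | tmul m n =>
      simp only [TensorProduct.LieModule.lie_tmul_right, TensorProduct.assoc_tmul,
        TensorProduct.add_tmul, TensorProduct.tmul_add, map_add, add_assoc]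

/-- The canonical identification of `(M ⊠ N) ⊠ P` with `M ⊠ (N ⊠ P)`. -/
def assoc (M N P : Rep) : Hom ((M ⊠ N) ⊠ P) (M ⊠ N ⊠ P) :=
  { (TensorProduct.assoc ℂ M N P).toLinearMap with
    map_lie' := by
      intro x t
      exact assoc_lie x t }

/-- The canonical identification of `M ⊠ (N ⊠ P)` with `(M ⊠ N) ⊠ P`. -/
def assocInv (M N P : Rep) : Hom (M ⊠ N ⊠ P) ((M ⊠ N) ⊠ P) :=
  { (TensorProduct.assoc ℂ M N P).symm.toLinearMap with
    map_lie' := by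
      intro x t
      refine (TensorProduct.assoc ℂ M N P).injective ?_
      refine ((TensorProduct.assoc ℂ M N P).apply_symm_apply _).trans ?_
      refine Eq.trans ?_ (assoc_lie x _).symm
      exact congrArg (fun u => ⁅x, u⁆) ((TensorProduct.assoc ℂ M N P).apply_symm_apply t).symm }

/-- The basis `e₁, e₂, e₃` of `sl₂` (halves of the Pauli matrices, indexed cyclically by `Fin 3`),
for which `⁅e_a, e_b⁆ = i ε_{abc} e_c`. -/
def e : Fin 3 → SlTwo :=
  ![⟨!![0, 1/2; 1/2, 0], by
      simp [LieAlgebra.SpecialLinear.sl, Matrix.trace, Fin.sum_univ_two]⟩,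
    ⟨!![0, -Complex.I/2; Complex.I/2, 0], by
      simp [LieAlgebra.SpecialLinear.sl, Matrix.trace, Fin.sum_univ_two]⟩,
    ⟨!![1/2, 0; 0, -1/2], by
      simp [LieAlgebra.SpecialLinear.sl, Matrix.trace, Fin.sum_univ_two]; ring⟩]

/-- The coordinates of an element of `sl₂` in the basis `e`. -/
def coord : Fin 3 → SlTwo →ₗ[ℂ] ℂ :=
  ![{ toFun := fun v => v.1 0 1 + v.1 1 0
      map_add' := by intro v w; simp; ring
      map_smul' := by intro c v; simp; ring },
    { toFun := fun v => Complex.I * (v.1 0 1 - v.1 1 0)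
      map_add' := by intro v w; simp; ring
      map_smul' := by intro c v; simp; ring },
    { toFun := fun v => v.1 0 0 - v.1 1 1
      map_add' := by intro v w; simp; ring
      map_smul' := by intro c v; simp; ring }]

theorem sum_coord_smul_e (v : SlTwo) : ∑ a, coord a v • e a = v := by
  have htr : v.1 0 0 + v.1 1 1 = 0 := by
    have := v.2
    simpa [LieAlgebra.SpecialLinear.sl, Matrix.trace, Fin.sum_univ_two] using this
  have h11 : v.1 1 1 = - v.1 0 0 := by linear_combination htr
  apply Subtype.ext
  ext i j
  fin_cases i <;> fin_cases j <;> simp [Fin.sum_univ_three, coord, e, h11] <;>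
    ring_nf <;> (try simp only [Complex.I_sq]) <;> ring

theorem lie_e (a : Fin 3) :
    ⁅e a, e a⁆ = 0 ∧ ⁅e a, e (a + 1)⁆ = Complex.I • e (a + 2) ∧
      ⁅e a, e (a + 2)⁆ = -(Complex.I • e (a + 1)) := by
  refine ⟨lie_self _, ?_, ?_⟩ <;> apply Subtype.ext <;> ext i j <;>
    fin_cases a <;> fin_cases i <;> fin_cases j <;>
    simp [e, LieRing.of_associative_ring_bracket, Matrix.mul_apply, Fin.sum_univ_two] <;>
    ring_nf <;> (try simp only [Complex.I_sq]) <;> (try ring)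

theorem coord_e (a b : Fin 3) : coord a (e b) = if a = b then 1 else 0 := by
  fin_cases a <;> fin_cases b <;> simp [coord, e] <;> ring_nf <;>
    (try simp only [Complex.I_sq]) <;> (try ring)

/-- The linear map underlying `F`: `e_a ↦ i (e_{a-1} ⊗ e_{a+1} - e_{a+1} ⊗ e_{a-1})`. -/
def linF : SlTwo →ₗ[ℂ] SlTwo ⊗[ℂ] SlTwo :=
  ∑ a, (coord a).smulRight
    (Complex.I • (e (a - 1) ⊗ₜ[ℂ] e (a + 1) - e (a + 1) ⊗ₜ[ℂ] e (a - 1)))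

theorem linF_e (a : Fin 3) :
    linF (e a) = Complex.I • (e (a - 1) ⊗ₜ[ℂ] e (a + 1) - e (a + 1) ⊗ₜ[ℂ] e (a - 1)) := by
  simp [linF, coord_e]

theorem linF_lie_e (a b : Fin 3) : linF ⁅e a, e b⁆ = ⁅e a, linF (e b)⁆ := by
  have h01 := (lie_e 0).2.1
  have h02 := (lie_e 0).2.2
  have h12 := (lie_e 1).2.1
  have h10 := (lie_e 1).2.2
  have h20 := (lie_e 2).2.1
  have h21 := (lie_e 2).2.2
  have k0 := linF_e 0
  have k1 := linF_e 1
  have k2 := linF_e 2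
  simp only [show (0 : Fin 3) + 1 = 1 from rfl, show (0 : Fin 3) + 2 = 2 from rfl,
    show (1 : Fin 3) + 1 = 2 from rfl, show (1 : Fin 3) + 2 = 0 from rfl,
    show (2 : Fin 3) + 1 = 0 from rfl, show (2 : Fin 3) + 2 = 1 from rfl,
    show (0 : Fin 3) - 1 = 2 from rfl, show (1 : Fin 3) - 1 = 0 from rfl,
    show (2 : Fin 3) - 1 = 1 from rfl] at *
  fin_cases a <;> fin_cases b <;>
    simp [h01, h02, h12, h10, h20, h21, k0, k1, k2, TensorProduct.LieModule.lie_tmul_right,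
      lie_sub, ← TensorProduct.smul_tmul', TensorProduct.tmul_smul, TensorProduct.neg_tmul,
      TensorProduct.tmul_neg] <;>
    (try module)

/-- The intertwiner `F : V ⟶ V ⊗ V`, `e_a ↦ i e_{a-1} ∧ e_{a+1}`. -/
def F : Hom V (V ⊠ V) :=
  { linF with
    map_lie' := by
      intro x v
      change linF ⁅(x : SlTwo), (v : SlTwo)⁆ = ⁅x, linF v⁆
      rw [← sum_coord_smul_e x, ← sum_coord_smul_e v]
      simp only [sum_lie, lie_sum, smul_lie, lie_smul, map_sum, map_smul, linF_lie_e] }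

/-- The intertwiner `F' : V ⊗ V ⟶ V` given by the Lie bracket. -/
def F' : Hom (V ⊠ V) V := LieModule.toModuleHom ℂ SlTwo SlTwo

/-! ### Sections over edge-paths -/

/-- The values of a section on an edge `(xy)`: the modules `ζ_x = M` and `ζ_y = N` and the two
arrows `ζ_yx : ζ_x ⟶ V ζ_y` and `ζ_xy : V ζ_y ⟶ ζ_x`. -/
structure Arrows (M N : Rep) : Type where
  fwd : Hom M (V ⊠ N)
  bwd : Hom (V ⊠ N) M

variable {X : Type} {G : SimpleGraph X}

/-- Sections over the path `γ = (x₀, …, x_ℓ)` whose module at the source `x₀` is `M`: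
modules at `x₁, …, x_ℓ` together with the two arrows on each edge of `γ`. -/
inductive SectionFrom : {x y : X} → G.Walk x y → Rep → Type 1
  | nil {x : X} (M : Rep) : SectionFrom (.nil : G.Walk x x) M
  | cons {x y z : X} (h : G.Adj x y) {γ : G.Walk y z} {M N : Rep} (A : Arrows M N)
      (s : SectionFrom γ N) : SectionFrom (.cons h γ) M

/-- The objects of `Φ_γ`: sections over `γ`. -/
def Section {x y : X} (γ : G.Walk x y) : Type 1 := Σ M : Rep, SectionFrom γ M

/-- An edge `(xy)` equipped with a pair of modules and a pair of arrows. -/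
structure EdgeValue (X : Type) : Type 1 where
  src : X
  tgt : X
  modSrc : Rep
  modTgt : Rep
  arrows : Arrows modSrc modTgt

/-- The list of the values of a section on the successive edges of `γ`. -/
def SectionFrom.values : {x y : X} → {γ : G.Walk x y} → {M : Rep} → SectionFrom γ M →
    List (EdgeValue X)
  | _, _, _, _, .nil _ => []
  | _, _, _, _, .cons (x := x) (y := y) (M := M) (N := N) _ A s => ⟨x, y, M, N, A⟩ :: s.values

/-! ### 2-paths and transport of sections -/

variable [Fintype X] [DecidableEq X]

namespace SphericalTriangulation

/-- `T.TwoEdge γ γ'`: the oriented 2-edges `(γ, γ')` of `T`, that is, the paths `γ` and `γ'`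
have the same ends and differ by the replacement of `(x, z)` by `(x, y, z)` or conversely,
where `{x, y, z}` is a triangle of `T`. -/
inductive TwoEdge (T : SphericalTriangulation X) :
    {x z : X} → T.graph.Walk x z → T.graph.Walk x z → Type
  | insert {x y z w : X} (ht : {x, y, z} ∈ T.triangles) (hxy : T.graph.Adj x y)
      (hyz : T.graph.Adj y z) (hxz : T.graph.Adj x z) (γ : T.graph.Walk z w) :
      TwoEdge T (.cons hxz γ) (.cons hxy (.cons hyz γ))
  | delete {x y z w : X} (ht : {x, y, z} ∈ T.triangles) (hxy : T.graph.Adj x y)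
      (hyz : T.graph.Adj y z) (hxz : T.graph.Adj x z) (γ : T.graph.Walk z w) :
      TwoEdge T (.cons hxy (.cons hyz γ)) (.cons hxz γ)
  | cons {x y w : X} (h : T.graph.Adj x y) {γ γ' : T.graph.Walk y w} (m : TwoEdge T γ γ') :
      TwoEdge T (.cons h γ) (.cons h γ')

variable {T : SphericalTriangulation X}

/-- The triangle swept by a 2-edge. -/
def TwoEdge.triangle : {x z : X} → {γ γ' : T.graph.Walk x z} → T.TwoEdge γ γ' → Finset X
  | _, _, _, _, .insert (x := x) (y := y) (z := z) _ _ _ _ _ => {x, y, z}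
  | _, _, _, _, .delete (x := x) (y := y) (z := z) _ _ _ _ _ => {x, y, z}
  | _, _, _, _, .cons _ m => m.triangle

/-- The action of `Φ_{γγ'} : Φ_γ' ⟶ Φ_γ` on sections with a given module at the source of the
paths. In the case `γ = (xz)`, `γ' = (xyz)`, the section `ζ` is sent to `ξ` with
`ξ_zx = (F' ⊗ I) ∘ (I ⊗ ζ_zy) ∘ ζ_yx` and `ξ_xz = ζ_xy ∘ (I ⊗ ζ_yz) ∘ (F ⊗ I)`.
In the case `γ = (xyz)`, `γ' = (xz)`, the section `ξ` is sent to `ζ` with `ζ_y = V ξ_z`,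
`ζ_yx = (F ⊗ I) ∘ ξ_zx`, `ζ_xy = ξ_xz ∘ (F' ⊗ I)` and `ζ_yz = ζ_zy = I`. -/
def TwoEdge.pullFrom : {x z : X} → {γ γ' : T.graph.Walk x z} → T.TwoEdge γ γ' →
    {M : Rep} → SectionFrom γ' M → SectionFrom γ M
  | _, _, _, _, .insert _ _ _ hxz _, _, .cons _ A (.cons (N := P) _ B s) =>
      .cons hxz
        ⟨(tensorHom F' (idHom P)).comp
          ((assocInv V V P).comp ((tensorHom (idHom V) B.fwd).comp A.fwd)),
         A.bwd.comp
          ((tensorHom (idHom V) B.bwd).comp ((assoc V V P).comp (tensorHom F (idHom P))))⟩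
        s
  | _, _, _, _, .delete _ hxy hyz _ _, _, .cons (N := P) _ A s =>
      .cons hxy
        ⟨(assoc V V P).comp ((tensorHom F (idHom P)).comp A.fwd),
         A.bwd.comp ((tensorHom F' (idHom P)).comp (assocInv V V P))⟩
        (.cons hyz ⟨idHom (V ⊠ P), idHom (V ⊠ P)⟩ s)
  | _, _, _, _, .cons h m, _, .cons _ A s => .cons h A (m.pullFrom s)

/-- The functor `Φ_{γγ'} : Φ_γ' ⟶ Φ_γ` on objects. -/
def TwoEdge.pull {x z : X} {γ γ' : T.graph.Walk x z} (m : T.TwoEdge γ γ') (ζ : Section γ') :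
    Section γ :=
  ⟨ζ.1, m.pullFrom ζ.2⟩

/-- The 2-paths `Γ = (γ₀, …, γ_n)` of `T` with given `γ₀` and `γ_n`. -/
inductive TwoPath (T : SphericalTriangulation X) {a b : X} :
    T.graph.Walk a b → T.graph.Walk a b → Type
  | nil (γ : T.graph.Walk a b) : TwoPath T γ γ
  | cons {γ γ' γ'' : T.graph.Walk a b} (m : T.TwoEdge γ γ') (Γ : TwoPath T γ' γ'') :
      TwoPath T γ γ''

variable {a b : X}

/-- The list of the triangles swept by a 2-path. -/
def TwoPath.swept : {γ γ' : T.graph.Walk a b} → T.TwoPath γ γ' → List (Finset X)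
  | _, _, .nil _ => []
  | _, _, .cons m Γ => m.triangle :: Γ.swept

/-- The functor `Φ_Γ : Φ_{γ_n} ⟶ Φ_{γ₀}` on objects. -/
def TwoPath.pull : {γ γ' : T.graph.Walk a b} → T.TwoPath γ γ' → Section γ' → Section γ
  | _, _, .nil _, ζ => ζ
  | _, _, .cons m Γ, ζ => m.pull (Γ.pull ζ)

/-- The values on edges of all the sections `ζ^p = Φ_{Γ_p}(ζ^n)` over `γ_p`, where
`Γ_p = (γ_p, …, γ_n)`, for `p = 0, …, n`. -/
def TwoPath.values : {γ γ' : T.graph.Walk a b} → T.TwoPath γ γ' → Section γ' →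
    List (EdgeValue X)
  | _, _, .nil _, ζ => ζ.2.values
  | _, _, .cons m Γ, ζ => (m.pull (Γ.pull ζ)).2.values ++ Γ.values ζ

/-- The section `ζ^n` over the path `(ab)`: `ζ_a = ζ_b = V`, `ζ_ba = F`, `ζ_ab = F'`. -/
def baseSection (h : T.graph.Adj a b) : Section h.toWalk :=
  ⟨V, .cons h ⟨F, F'⟩ (.nil V)⟩

/-- The 2-loops based at the path `(ab)`, where `{a, b}` is an edge of `T`, which sweep each
triangle of `T` once only. -/
structure SweepingLoop (T : SphericalTriangulation X) where
  a : X
  b : X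
  adj : T.graph.Adj a b
  loop : T.TwoPath adj.toWalk adj.toWalk
  once : ∀ t ∈ T.triangles, loop.swept.count t = 1

/-- `Γ.IsValue v`: the global section `ζ` of the chromatic stack built by the sweeping process
along `Γ` takes the value `v` on the edge `(v.src, v.tgt)`. Each edge of `T` except `{a, b}` is
used, from the triangle of `Γ` which produces it to the triangle which consumes it, with
constant modules and arrows, so that `ζ` has one value on it; on the base edge, `ζ` has the two
values `ζ^n` and `ζ^0`, one for each of the two boundary arcs of the disk obtained by cutting the
sphere along `(ab)`. -/
def SweepingLoop.IsValue (Γ : T.SweepingLoop) (v : EdgeValue X) : Prop :=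
  v ∈ Γ.loop.values (baseSection Γ.adj)

/-- The global section `ζ` vanishes on no edge: `ζ_xy ≠ 0` for every oriented edge `(xy)`. -/
def SweepingLoop.NonVanishing (Γ : T.SweepingLoop) : Prop :=
  ∀ v, Γ.IsValue v → v.arrows.fwd ≠ 0 ∧ v.arrows.bwd ≠ 0

end SphericalTriangulation

end FourColour

end

open scoped TensorProduct

noncomputable section

namespace FourColour

/-! ### Linear algebra over a field -/

theorem exists_mulVec_eq_of_rank {K l m n : Type} [Field K] [Fintype l] [Fintype m] [Fintype n]
    (A : Matrix l m K) (B : Matrix m n K) (hAB : A * B = 0)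
    (h : Fintype.card m ≤ A.rank + B.rank) (w : m → K) (hw : A.mulVec w = 0) :
    ∃ g, B.mulVec g = w := by
  have hle : LinearMap.range B.mulVecLin ≤ LinearMap.ker A.mulVecLin := by
    rintro _ ⟨g, rfl⟩
    simp [Matrix.mulVec_mulVec, hAB]
  have hrn := LinearMap.finrank_range_add_finrank_ker A.mulVecLin
  rw [Module.finrank_fintype_fun_eq_card] at hrn
  have heq := Submodule.eq_of_le_of_finrank_le hle (by
    simp only [Matrix.rank] at h
    omega)
  have : w ∈ LinearMap.range B.mulVecLin := by
    rw [heq]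
    simpa using hw
  simpa using this

/-- The kernel lies in the line of constant functions. This turns connectivity into a rank bound,
once for vertices and once for triangles. -/
theorem card_le_rank_add_one {K m n : Type} [Field K] [Fintype m] [Fintype n]
    (A : Matrix m n K) (h : ∀ f, A.mulVec f = 0 → ∀ i j, f i = f j) :
    Fintype.card n ≤ A.rank + 1 := by
  have hrn := LinearMap.finrank_range_add_finrank_ker A.mulVecLin
  rw [Module.finrank_fintype_fun_eq_card] at hrn
  have hker : Module.finrank K (LinearMap.ker A.mulVecLin) ≤ 1 := by
    refine le_trans (Submodule.finrank_mono (t := Submodule.span K {fun _ => 1}) ?_)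
      ((finrank_span_le_card _).trans (by simp))
    intro f hf
    rw [Submodule.mem_span_singleton]
    have hf' := h f (by simpa using hf)
    rcases isEmpty_or_nonempty n with hn | ⟨⟨i⟩⟩
    · exact ⟨0, funext fun i => (hn.false i).elim⟩
    · exact ⟨f i, funext fun j => by simp [hf' i j]⟩
  simp only [Matrix.rank]
  omega

namespace SphericalTriangulation

variable {X : Type} [Fintype X] [DecidableEq X] (T : SphericalTriangulation X)

/-! ### Edges and triangles -/

theorem adj_iff {x y : X} : T.graph.Adj x y ↔ x ≠ y ∧ ∃ t ∈ T.triangles, x ∈ t ∧ y ∈ t := Iff.rfl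

theorem adj_of_mem {t : Finset X} (ht : t ∈ T.triangles) {x y : X} (hx : x ∈ t) (hy : y ∈ t)
    (hxy : x ≠ y) : T.graph.Adj x y := ⟨hxy, t, ht, hx, hy⟩

theorem mem_edgesOf_iff {e : Finset X} :
    e ∈ edgesOf T.triangles ↔ ∃ x y, T.graph.Adj x y ∧ e = {x, y} := by
  simp only [edgesOf, Finset.mem_biUnion, Finset.mem_powersetCard, adj_iff]
  constructor
  · rintro ⟨t, ht, het, he⟩
    obtain ⟨x, y, hxy, rfl⟩ := Finset.card_eq_two.1 he
    exact ⟨x, y, ⟨hxy, t, ht, het (by simp), het (by simp)⟩, rfl⟩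
  · rintro ⟨x, y, ⟨hxy, t, ht, hx, hy⟩, rfl⟩
    exact ⟨t, ht, by simp [Finset.insert_subset_iff, hx, hy], Finset.card_pair hxy⟩

theorem mem_edgesOf {x y : X} (h : T.graph.Adj x y) : {x, y} ∈ edgesOf T.triangles :=
  T.mem_edgesOf_iff.2 ⟨x, y, h, rfl⟩

theorem exists_eq_insert {t : Finset X} (ht : t ∈ T.triangles) {x y : X} (hx : x ∈ t) (hy : y ∈ t)
    (hxy : x ≠ y) : ∃ z, z ∉ ({x, y} : Finset X) ∧ t = insert z {x, y} := by
  have hsub : ({x, y} : Finset X) ⊆ t := by simp [Finset.insert_subset_iff, hx, hy]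
  have hc : (t \ {x, y}).card = 1 := by
    rw [Finset.card_sdiff_of_subset hsub, T.card_triangle t ht, Finset.card_pair hxy]
  obtain ⟨z, hz⟩ := Finset.card_eq_one.1 hc
  have hz' : z ∈ t \ {x, y} := by simp [hz]
  refine ⟨z, (Finset.mem_sdiff.1 hz').2, ?_⟩
  rw [← Finset.sdiff_union_of_subset hsub, hz]
  rfl

/-- The vertices opposite to the edge `e` in the triangles containing `e`. -/
def apex (e : Finset X) : Finset X :=
  Finset.univ.filter fun u => u ∉ e ∧ insert u e ∈ T.triangles

theorem mem_apex {e : Finset X} {u : X} : u ∈ T.apex e ↔ u ∉ e ∧ insert u e ∈ T.triangles := by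
  simp [apex]

theorem filter_subset_eq_image {x y : X} (h : x ≠ y) :
    T.triangles.filter ({x, y} ⊆ ·) = (T.apex {x, y}).image (insert · {x, y}) := by
  ext t
  simp only [Finset.mem_filter, Finset.mem_image, mem_apex]
  constructor
  · rintro ⟨ht, hs⟩
    obtain ⟨z, hz, rfl⟩ := T.exists_eq_insert ht (hs (by simp)) (hs (by simp)) h
    exact ⟨z, ⟨hz, ht⟩, rfl⟩
  · rintro ⟨z, ⟨_, hz⟩, rfl⟩
    exact ⟨hz, Finset.subset_insert _ _⟩

theorem insert_injOn (e : Finset X) : Set.InjOn (insert · e) (T.apex e : Set X) := by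
  intro u hu v hv huv
  have hu' := (T.mem_apex.1 hu).1
  have : u ∈ insert v e := by
    rw [← show insert u e = insert v e from huv]
    simp
  exact (Finset.mem_insert.1 this).resolve_right hu'

theorem card_apex {x y : X} (h : T.graph.Adj x y) : (T.apex {x, y}).card = 2 := by
  rw [← Finset.card_image_of_injOn (T.insert_injOn _), ← T.filter_subset_eq_image h.1]
  exact T.closed _ (T.mem_edgesOf h)

theorem adj_of_apex {x y z : X} (h : x ≠ y) (hz : z ∈ T.apex {x, y}) :
    T.graph.Adj x y ∧ T.graph.Adj y z ∧ T.graph.Adj z x := by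
  obtain ⟨h1, h2⟩ := T.mem_apex.1 hz
  simp only [Finset.mem_insert, Finset.mem_singleton, not_or] at h1
  exact ⟨T.adj_of_mem h2 (by simp) (by simp) h, T.adj_of_mem h2 (by simp) (by simp) (Ne.symm h1.2),
    T.adj_of_mem h2 (by simp) (by simp) h1.1⟩

theorem apex_comm (x y : X) : T.apex {x, y} = T.apex {y, x} := by rw [Finset.pair_comm]

theorem apex_rotate {x y z : X} (h : x ≠ y) (hz : z ∈ T.apex {x, y}) : x ∈ T.apex {y, z} := by
  rw [mem_apex] at hz ⊢
  obtain ⟨h1, h2⟩ := hz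
  simp only [Finset.mem_insert, Finset.mem_singleton, not_or] at h1 ⊢
  refine ⟨⟨h, Ne.symm h1.1⟩, ?_⟩
  convert h2 using 1
  ext; simp; tauto

/-! ### Connectivity -/

theorem exists_adj (x : X) : ∃ y, T.graph.Adj x y := by
  have hX : Nontrivial X := by
    rw [← Fintype.one_lt_card_iff_nontrivial]
    have := T.euler
    -- With at most one vertex there is no room for a triangle, and then Euler's formula would ask
    -- for two vertices.
    by_contra hc
    rcases T.triangles.eq_empty_or_nonempty with h0 | ⟨t, ht⟩
    · rw [h0] at this
      simp [edgesOf] at this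
      omega
    · have h3 := T.card_triangle t ht
      have := Finset.card_le_univ t
      omega
  exact T.connected.preconnected.exists_adj_of_nontrivial x

/-- A property of neighbours of `x` which passes along the edges of the link of `x`. -/
theorem link_induction {x : X} {Q : X → Prop}
    (hQ : ∀ y z, x ≠ y → z ∈ T.apex {x, y} → Q y → Q z) {y z : X} (hy : T.graph.Adj x y)
    (hz : T.graph.Adj x z) (h : Q y) : Q z := by
  have key : ∀ t, t ∈ T.triangles → x ∈ t → ∀ u v, u ∈ t → v ∈ t → u ≠ x → v ≠ x → Q u → Q v := by
    intro t ht hx u v hu hv hux hvx hq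
    by_cases huv : u = v
    · exact huv ▸ hq
    obtain ⟨w, hw, rfl⟩ := T.exists_eq_insert ht hx hu hux.symm
    have : v = w := by
      simp only [Finset.mem_insert, Finset.mem_singleton] at hv
      tauto
    subst this
    exact hQ u v hux.symm (T.mem_apex.2 ⟨hw, ht⟩) hq
  obtain ⟨hxy, s, hs, hxs, hys⟩ := hy
  obtain ⟨hxz, t, ht, hxt, hzt⟩ := hz
  have hst := T.link_connected x s hs t ht hxs hxt
  have main : ∀ t, Relation.ReflTransGen
      (fun s t => s ∈ T.triangles ∧ t ∈ T.triangles ∧ x ∈ s ∩ t ∧ (s ∩ t).card = 2) s t →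
      ∀ u ∈ t, u ≠ x → Q u := by
    intro t hst
    induction hst with
    | refl => exact fun u hu hux => key s hs hxs y u hys hu hxy.symm hux h
    | tail _ hab ih =>
      rename_i p q _
      obtain ⟨hp, hq, hx, hc⟩ := hab
      intro u hu hux
      obtain ⟨v, hv, hvx⟩ := Finset.exists_mem_ne (by omega : 1 < (p ∩ q).card) x
      rw [Finset.mem_inter] at hv hx
      exact key q hq hx.2 v u hv.2 hu hvx hux (ih v hv.1 hvx)
  exact main t hst z hzt hxz.symm

/-- Strong connectivity: the triangles at one vertex are chained through common edges by
`link_connected`, and a walk in the 1-skeleton passes from one star to the next. -/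
theorem triangle_induction {Q : Finset X → Prop}
    (hQ : ∀ x y u v, T.graph.Adj x y → u ∈ T.apex {x, y} → v ∈ T.apex {x, y} →
      Q (insert u {x, y}) → Q (insert v {x, y})) {s t : Finset X} (hs : s ∈ T.triangles)
    (ht : t ∈ T.triangles) (h : Q s) : Q t := by
  have step : ∀ s t, s ∈ T.triangles → t ∈ T.triangles → ∀ x y, x ≠ y → x ∈ s → y ∈ s → x ∈ t →
      y ∈ t → Q s → Q t := by
    intro s t hs ht x y hxy hxs hys hxt hyt h
    obtain ⟨u, hu, rfl⟩ := T.exists_eq_insert hs hxs hys hxy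
    obtain ⟨v, hv, rfl⟩ := T.exists_eq_insert ht hxt hyt hxy
    exact hQ x y u v (T.adj_of_mem hs hxs hys hxy) (T.mem_apex.2 ⟨hu, hs⟩) (T.mem_apex.2 ⟨hv, ht⟩) h
  have star : ∀ x s t, s ∈ T.triangles → t ∈ T.triangles → x ∈ s → x ∈ t → Q s → Q t := by
    intro x s t hs ht hxs hxt h
    have := T.link_connected x s hs t ht hxs hxt
    induction this with
    | refl => exact h
    | tail _ hab ih =>
      rename_i p q _
      obtain ⟨hp, hq, hx, hc⟩ := hab
      obtain ⟨v, hv, hvx⟩ := Finset.exists_mem_ne (by omega : 1 < (p ∩ q).card) x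
      rw [Finset.mem_inter] at hv hx
      exact step p q hp hq x v hvx.symm hx.1 hv.1 hx.2 hv.2 (ih hp hx.1)
  obtain ⟨x, hx⟩ : s.Nonempty := Finset.card_pos.1 (by rw [T.card_triangle s hs]; simp)
  obtain ⟨y, hy⟩ : t.Nonempty := Finset.card_pos.1 (by rw [T.card_triangle t ht]; simp)
  obtain ⟨w⟩ := T.connected.preconnected x y
  induction w generalizing s with
  | nil => exact star _ s t hs ht hx hy h
  | cons hadj _ ih =>
    obtain ⟨_, p, hp, h1, h2⟩ := hadj
    exact ih hp (star _ s p hs hp hx h1 h) h2 hy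

/-! ### Counting -/

theorem three_mul_card_triangles :
    3 * T.triangles.card = 2 * (edgesOf T.triangles).card := by
  have h := Finset.sum_card_bipartiteAbove_eq_sum_card_bipartiteBelow
    (s := edgesOf T.triangles) (t := T.triangles) (· ⊆ ·)
  have h2 : ∑ e ∈ edgesOf T.triangles, (T.triangles.bipartiteAbove (· ⊆ ·) e).card =
      ∑ e ∈ edgesOf T.triangles, 2 := Finset.sum_congr rfl fun e he => by
    simpa [Finset.bipartiteAbove] using T.closed e he
  have h3 : ∑ t ∈ T.triangles, ((edgesOf T.triangles).bipartiteBelow (· ⊆ ·) t).card =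
      ∑ t ∈ T.triangles, 3 := Finset.sum_congr rfl fun t ht => by
    have : (edgesOf T.triangles).bipartiteBelow (· ⊆ ·) t = t.powersetCard 2 := by
      ext e
      simp only [Finset.bipartiteBelow, Finset.mem_filter, Finset.mem_powersetCard,
        edgesOf, Finset.mem_biUnion]
      constructor
      · rintro ⟨⟨_, _, _, h⟩, h'⟩
        exact ⟨h', h⟩
      · rintro ⟨h, h'⟩
        exact ⟨⟨t, ht, h, h'⟩, h⟩
    rw [this, Finset.card_powersetCard, T.card_triangle t ht]
    rfl
  rw [h2, h3] at h
  simp at h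
  omega

/-- The oriented edges of `T`. -/
def darts : Finset (X × X) := by
  classical exact Finset.univ.filter fun d => T.graph.Adj d.1 d.2

theorem mem_darts {d : X × X} : d ∈ T.darts ↔ T.graph.Adj d.1 d.2 := by simp [darts]

theorem card_darts : T.darts.card = 2 * (edgesOf T.triangles).card := by
  rw [Finset.card_eq_sum_card_fiberwise (f := fun d => ({d.1, d.2} : Finset X))
    (t := edgesOf T.triangles) (fun d hd => T.mem_edgesOf (T.mem_darts.1 hd)),
    Finset.sum_congr rfl (fun e he => show _ = 2 from ?_)]
  · simp [mul_comm]
  · obtain ⟨x, y, hxy, rfl⟩ := T.mem_edgesOf_iff.1 he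
    have : T.darts.filter (fun d => ({d.1, d.2} : Finset X) = {x, y}) = {(x, y), (y, x)} := by
      ext ⟨u, v⟩
      simp only [Finset.mem_filter, mem_darts, Finset.mem_insert, Finset.mem_singleton,
        Prod.mk.injEq]
      constructor
      · rintro ⟨huv, h⟩
        have hu : u ∈ ({x, y} : Finset X) := h ▸ by simp
        have hv : v ∈ ({x, y} : Finset X) := h ▸ by simp
        simp only [Finset.mem_insert, Finset.mem_singleton] at hu hv
        have := huv.1
        grind
      · rintro (⟨rfl, rfl⟩ | ⟨rfl, rfl⟩)
        · exact ⟨hxy, rfl⟩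
        · exact ⟨hxy.symm, Finset.pair_comm _ _⟩
    rw [this, Finset.card_pair]
    simpa using fun h => (hxy.1 h).elim

theorem card_triangles_add_four : T.triangles.card + 4 = 2 * Fintype.card X := by
  have h1 := T.three_mul_card_triangles
  have h2 := T.euler
  omega

/-! ### Homology modulo two -/

/-- The incidence matrix of vertices and edges. -/
def incVE : Matrix X (edgesOf T.triangles) (ZMod 2) := fun x e => if x ∈ e.1 then 1 else 0

/-- The incidence matrix of edges and triangles. -/
def incET : Matrix (edgesOf T.triangles) T.triangles (ZMod 2) := fun e t =>
  if e.1 ⊆ t.1 then 1 else 0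

/-- The boundary of a boundary is zero: a vertex of a triangle lies on exactly two of its edges. -/
theorem incVE_mul_incET : T.incVE * T.incET = 0 := by
  ext x t
  obtain ⟨t, ht⟩ := t
  simp only [Matrix.mul_apply, incVE, incET, Matrix.zero_apply]
  rw [Finset.sum_coe_sort (edgesOf T.triangles)
    (fun e => (if x ∈ e then (1 : ZMod 2) else 0) * if e ⊆ t then 1 else 0)]
  simp only [mul_ite, mul_one, mul_zero, ← ite_and]
  rw [Finset.sum_boole]
  by_cases hx : x ∈ t
  · have : (edgesOf T.triangles).filter (fun e => e ⊆ t ∧ x ∈ e) =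
        (t.erase x).image (fun y => {x, y}) := by
      ext e
      simp only [Finset.mem_filter, Finset.mem_image, Finset.mem_erase]
      constructor
      · rintro ⟨he, hs, hxe⟩
        obtain ⟨u, v, huv, rfl⟩ := T.mem_edgesOf_iff.1 he
        have hu := hs (show u ∈ _ by simp)
        have hv := hs (show v ∈ _ by simp)
        simp only [Finset.mem_insert, Finset.mem_singleton] at hxe
        rcases hxe with rfl | rfl
        · exact ⟨v, ⟨huv.1.symm, hv⟩, rfl⟩
        · exact ⟨u, ⟨huv.1, hu⟩, Finset.pair_comm _ _⟩
      · rintro ⟨y, ⟨hyx, hy⟩, rfl⟩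
        exact ⟨T.mem_edgesOf (T.adj_of_mem ht hx hy hyx.symm),
          by simp [Finset.insert_subset_iff, hx, hy], by simp⟩
    rw [this, Finset.card_image_of_injOn, Finset.card_erase_of_mem hx, T.card_triangle t ht]
    · rfl
    · intro y hy z hz hyz
      have h1 : y ∈ ({x, z} : Finset X) := by
        rw [← show ({x, y} : Finset X) = {x, z} from hyz]
        simp
      simp only [Finset.mem_insert, Finset.mem_singleton] at h1
      exact h1.resolve_left (Finset.mem_erase.1 hy).1
  · rw [Finset.filter_false_of_mem]
    · simp
    · rintro e _ ⟨h1, h2⟩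
      exact hx (h1 h2)

theorem incVE_transpose_mulVec (f : X → ZMod 2) {x y : X} (h : T.graph.Adj x y) :
    T.incVE.transpose.mulVec f ⟨{x, y}, T.mem_edgesOf h⟩ = f x + f y := by
  simp only [Matrix.mulVec, dotProduct, Matrix.transpose_apply, incVE, ite_mul, one_mul, zero_mul]
  rw [← Finset.sum_filter, ← Finset.sum_pair h.1]
  congr 1
  ext; simp

theorem incET_mulVec (g : Finset X → ZMod 2) (e : edgesOf T.triangles) :
    T.incET.mulVec (fun t => g t.1) e = ∑ t ∈ T.triangles with e.1 ⊆ t, g t := by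
  simp only [Matrix.mulVec, dotProduct, incET, ite_mul, one_mul, zero_mul]
  rw [Finset.sum_coe_sort T.triangles (fun t => if e.1 ⊆ t then g t else 0), Finset.sum_filter]

theorem sum_triangles_eq {x y : X} (h : T.graph.Adj x y) (g : Finset X → ZMod 2) :
    ∑ t ∈ T.triangles with {x, y} ⊆ t, g t = ∑ u ∈ T.apex {x, y}, g (insert u {x, y}) := by
  rw [T.filter_subset_eq_image h.1, Finset.sum_image (T.insert_injOn _)]

theorem zmod_two_eq_of_add {a b : ZMod 2} (h : a + b = 0) : a = b := by
  revert a b; decide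

theorem rank_incVE : Fintype.card X ≤ T.incVE.transpose.rank + 1 := by
  refine card_le_rank_add_one _ fun f hf x y => ?_
  obtain ⟨w⟩ := T.connected.preconnected x y
  induction w with
  | nil => rfl
  | cons h _ ih =>
    refine (zmod_two_eq_of_add ?_).trans ih
    rw [← T.incVE_transpose_mulVec f h, hf]
    rfl

/-- A 2-cycle modulo two takes equal values on the two triangles at each edge, so by strong
connectivity it is constant. -/
theorem rank_incET : T.triangles.card ≤ T.incET.rank + 1 := by
  rw [← Fintype.card_coe]
  refine card_le_rank_add_one _ fun f hf s t => ?_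
  let g : Finset X → ZMod 2 := fun t => if h : t ∈ T.triangles then f ⟨t, h⟩ else 0
  have hg : (fun t : T.triangles => g t.1) = f := by
    funext t
    simp [g]
  have key : g s.1 = g t.1 := by
    refine T.triangle_induction (Q := fun t => g s.1 = g t) (fun x y u v h hu hv hs => ?_)
      s.2 t.2 rfl
    by_cases huv : u = v
    · exact huv ▸ hs
    refine hs.trans (zmod_two_eq_of_add ?_)
    have h1 := T.incET_mulVec g ⟨{x, y}, T.mem_edgesOf h⟩
    rw [hg, hf, T.sum_triangles_eq h] at h1
    have h2 : T.apex {x, y} = {u, v} := by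
      symm
      apply Finset.eq_of_subset_of_card_le
      · simp [Finset.insert_subset_iff, hu, hv]
      · rw [T.card_apex h, Finset.card_pair huv]
    rw [h2, Finset.sum_pair huv] at h1
    exact h1.symm
  have := congrFun hg s
  have := congrFun hg t
  simp_all

/-- Euler's formula reads `E = (V - 1) + (F - 1)`, and the two terms are lower bounds for the ranks.
Equality of dimensions makes the chain complex and its dual exact at the edges. -/
theorem card_edges_le_rank :
    Fintype.card (edgesOf T.triangles) ≤ T.incVE.rank + T.incET.rank := by
  have h1 := T.rank_incVE
  have h2 := T.rank_incET
  have h3 := T.euler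
  rw [Matrix.rank_transpose] at h1
  rw [Fintype.card_coe]
  omega

/-- Every cycle modulo two is a boundary. -/
theorem exists_chain_of_cycle (w : Finset X → ZMod 2)
    (hw : ∀ x, ∑ e ∈ edgesOf T.triangles with x ∈ e, w e = 0) :
    ∃ g : Finset X → ZMod 2, ∀ x y, T.graph.Adj x y →
      ∑ u ∈ T.apex {x, y}, g (insert u {x, y}) = w {x, y} := by
  obtain ⟨f, hf⟩ := exists_mulVec_eq_of_rank T.incVE T.incET T.incVE_mul_incET
    T.card_edges_le_rank (fun e => w e.1) (by
      funext x
      simp only [Matrix.mulVec, dotProduct, incVE, ite_mul, one_mul, zero_mul]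
      rw [Finset.sum_coe_sort (edgesOf T.triangles) (fun e => if x ∈ e then w e else 0),
        ← Finset.sum_filter]
      exact hw x)
  let g : Finset X → ZMod 2 := fun t => if h : t ∈ T.triangles then f ⟨t, h⟩ else 0
  have hg : (fun t : T.triangles => g t.1) = f := by
    funext t
    simp [g]
  refine ⟨g, fun x y h => ?_⟩
  rw [← T.sum_triangles_eq h, ← T.incET_mulVec g ⟨{x, y}, T.mem_edgesOf h⟩, hg, hf]

/-- Every cocycle modulo two is a coboundary. -/
theorem exists_potential_of_cocycle (c : Sym2 X → ZMod 2)
    (hc : ∀ x y z, x ≠ y → z ∈ T.apex {x, y} → c s(x, y) + c s(y, z) + c s(z, x) = 0) :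
    ∃ p : X → ZMod 2, ∀ x y, T.graph.Adj x y → p x + p y = c s(x, y) := by
  classical
  -- The chains are indexed by finite sets; the element `s` with a given `toFinset` is unique, so
  -- the choice is harmless.
  let w : Finset X → ZMod 2 := fun e => if h : ∃ s : Sym2 X, s.toFinset = e then c h.choose else 0
  have hw : ∀ x y, w {x, y} = c s(x, y) := by
    intro x y
    have h : ∃ s : Sym2 X, s.toFinset = {x, y} := ⟨s(x, y), Sym2.toFinset_mk_eq⟩
    simp only [w, dif_pos h]
    congr 1
    have h' := h.choose_spec
    generalize h.choose = q at h'
    ext z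
    rw [← Sym2.mem_toFinset, h']
    simp
  obtain ⟨p, hp⟩ := exists_mulVec_eq_of_rank T.incET.transpose T.incVE.transpose
    (by rw [← Matrix.transpose_mul, T.incVE_mul_incET, Matrix.transpose_zero])
    (by rw [Matrix.rank_transpose, Matrix.rank_transpose, add_comm]; exact T.card_edges_le_rank)
    (fun e => w e.1) (by
      funext t
      obtain ⟨t, ht⟩ := t
      simp only [Matrix.mulVec, dotProduct, Matrix.transpose_apply, incET, ite_mul, one_mul,
        zero_mul, Pi.zero_apply]
      rw [Finset.sum_coe_sort (edgesOf T.triangles) (fun e => if e ⊆ t then w e else 0),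
        ← Finset.sum_filter]
      obtain ⟨x, y, z, hxy, hxz, hyz, rfl⟩ := Finset.card_eq_three.1 (T.card_triangle t ht)
      have hz : z ∈ T.apex {x, y} := T.mem_apex.2 ⟨by simp [hxz.symm, hyz.symm], by
        convert ht using 1; ext; simp; tauto⟩
      have : (edgesOf T.triangles).filter (· ⊆ {x, y, z}) = {{x, y}, {y, z}, {z, x}} := by
        ext e
        simp only [Finset.mem_filter, Finset.mem_insert, Finset.mem_singleton]
        constructor
        · rintro ⟨he, hs⟩
          obtain ⟨u, v, huv, rfl⟩ := T.mem_edgesOf_iff.1 he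
          have hu := hs (show u ∈ _ by simp)
          have hv := hs (show v ∈ _ by simp)
          simp only [Finset.mem_insert, Finset.mem_singleton] at hu hv
          have := huv.1
          rcases hu with rfl | rfl | rfl <;> rcases hv with rfl | rfl | rfl <;>
            simp [Finset.pair_comm] at this ⊢
        · have h := T.adj_of_apex hxy hz
          rintro (rfl | rfl | rfl)
          · exact ⟨T.mem_edgesOf h.1, by simp [Finset.insert_subset_iff]⟩
          · exact ⟨T.mem_edgesOf h.2.1, by simp⟩
          · exact ⟨T.mem_edgesOf h.2.2, by simp [Finset.insert_subset_iff]⟩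
      have hne : ∀ a b c : X, a ≠ b → a ≠ c → ({a, b} : Finset X) ≠ {b, c} := by
        intro a b c h1 h2 h
        have : a ∈ ({b, c} : Finset X) := h ▸ by simp
        simp [h1, h2] at this
      rw [this, Finset.sum_insert, Finset.sum_pair (hne y z x hyz hxy.symm), hw, hw, hw, ← add_assoc]
      · exact hc x y z hxy hz
      · simp only [Finset.mem_insert, Finset.mem_singleton, not_or]
        refine ⟨hne x y z hxy hxz, ?_⟩
        rw [Finset.pair_comm x y, Finset.pair_comm z x]
        exact hne y x z hxy.symm hyz)
  refine ⟨p, fun x y h => ?_⟩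
  rw [← T.incVE_transpose_mulVec p h, hp]
  exact hw x y

end SphericalTriangulation

/-! ### Links and orientability -/

namespace SphericalTriangulation

variable {X : Type} [Fintype X] [DecidableEq X]

/-- An orientation of `T`: `r x y` is the apex of the triangle in whose positive boundary the
oriented edge `(x, y)` occurs. -/
structure Orientation (T : SphericalTriangulation X) where
  r : X → X → X
  mem_apex : ∀ {x y}, T.graph.Adj x y → r x y ∈ T.apex {x, y}
  ne : ∀ {x y}, T.graph.Adj x y → r x y ≠ r y x
  rotate : ∀ {x y}, T.graph.Adj x y → r y (r x y) = x

variable (T : SphericalTriangulation X)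

/-- The sum of `f` over the oriented edges of the link of `x`. -/
def linkSum {R : Type} [AddCommMonoid R] (x : X) (f : X → X → R) : R :=
  ∑ y, ∑ u, if x ≠ y ∧ u ∈ T.apex {x, y} then f y u else 0

theorem linkSum_comm {R : Type} [AddCommMonoid R] (x : X) (f : X → X → R) :
    T.linkSum x f = T.linkSum x (fun y u => f u y) := by
  unfold linkSum
  rw [Finset.sum_comm]
  refine Finset.sum_congr rfl fun y _ => Finset.sum_congr rfl fun u _ => ?_
  congr 1
  have : ∀ u y, x ≠ u ∧ y ∈ T.apex {x, u} → x ≠ y ∧ u ∈ T.apex {x, y} := fun u y h => by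
    have h3 := T.adj_of_apex h.1 h.2
    refine ⟨h3.2.2.1.symm, ?_⟩
    rw [T.apex_comm]
    exact T.apex_rotate h3.2.1.1 (T.apex_rotate h.1 h.2)
  exact propext ⟨this u y, this y u⟩

theorem linkSum_add {R : Type} [AddCommMonoid R] (x : X) (f g : X → X → R) :
    T.linkSum x (fun y u => f y u + g y u) = T.linkSum x f + T.linkSum x g := by
  unfold linkSum
  simp only [← Finset.sum_add_distrib]
  refine Finset.sum_congr rfl fun y _ => Finset.sum_congr rfl fun u _ => ?_
  split_ifs <;> simp

/-- The set of the neighbours of `x`. -/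
def nbrs (x : X) : Finset X := by
  classical exact Finset.univ.filter (T.graph.Adj x)

theorem mem_nbrs {x y : X} : y ∈ T.nbrs x ↔ T.graph.Adj x y := by simp [nbrs]

theorem linkSum_eq {R : Type} [AddCommMonoid R] (x : X) (f : X → X → R) :
    T.linkSum x f = ∑ y ∈ T.nbrs x, ∑ u ∈ T.apex {x, y}, f y u := by
  unfold linkSum
  rw [← Finset.sum_subset (Finset.subset_univ (T.nbrs x))]
  · refine Finset.sum_congr rfl fun y hy => ?_
    have := ((T.mem_nbrs).1 hy).1
    simp [this, Finset.sum_ite_mem]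
  · intro y _ hy
    refine Finset.sum_eq_zero fun u _ => if_neg fun h => hy ?_
    exact T.mem_nbrs.2 (T.adj_of_apex h.1 h.2).1

theorem linkSum_const {R : Type} [AddCommMonoid R] (x : X) (f : X → R) :
    T.linkSum x (fun y _ => f y) = ∑ y ∈ T.nbrs x, 2 • f y := by
  rw [linkSum_eq]
  refine Finset.sum_congr rfl fun y hy => ?_
  rw [Finset.sum_const, T.card_apex (T.mem_nbrs.1 hy)]

theorem sum_edges_eq (x : X) (w : Finset X → ZMod 2) :
    ∑ e ∈ edgesOf T.triangles with x ∈ e, w e = ∑ y ∈ T.nbrs x, w {x, y} := by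
  have : (edgesOf T.triangles).filter (x ∈ ·) = (T.nbrs x).image (fun y => {x, y}) := by
    ext e
    simp only [Finset.mem_filter, Finset.mem_image, mem_nbrs]
    constructor
    · rintro ⟨he, hx⟩
      obtain ⟨u, v, huv, rfl⟩ := T.mem_edgesOf_iff.1 he
      simp only [Finset.mem_insert, Finset.mem_singleton] at hx
      rcases hx with rfl | rfl
      · exact ⟨v, huv, rfl⟩
      · exact ⟨u, huv.symm, Finset.pair_comm _ _⟩
    · rintro ⟨y, hy, rfl⟩
      exact ⟨T.mem_edgesOf hy, by simp⟩
  rw [this, Finset.sum_image]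
  intro y hy z hz hyz
  have h1 : y ∈ ({x, z} : Finset X) := by
    rw [← show ({x, y} : Finset X) = {x, z} from hyz]
    simp
  simp only [Finset.mem_insert, Finset.mem_singleton] at h1
  exact h1.resolve_left (T.mem_nbrs.1 hy).1.symm

/-- Inversions with respect to an enumeration of the vertices. -/
def inversion (x y : X) : ZMod 2 :=
  if Fintype.equivFin X x < Fintype.equivFin X y then 0 else 1

theorem inversion_add {x y : X} (h : x ≠ y) : inversion x y + inversion y x = 1 := by
  have h' : Fintype.equivFin X x ≠ Fintype.equivFin X y := fun e => h ((Equiv.injective _) e)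
  unfold inversion
  rcases lt_or_gt_of_ne h' with h1 | h1
  · rw [if_pos h1, if_neg h1.not_gt]; rfl
  · rw [if_neg h1.not_gt, if_pos h1]; rfl

/-- Each edge of the link is counted in both directions, and exactly one of them is an inversion.
The sum is thus the number of edges of the link, which equals its number of vertices because every
vertex of the link has degree two. -/
theorem linkSum_inversion (x : X) :
    T.linkSum x (fun y u => inversion y u) = ∑ _y ∈ T.nbrs x, 1 := by
  -- The count is made in `ℕ`, where a doubled equation can be halved.
  let f : X → X → ℕ := fun y u => if Fintype.equivFin X y < Fintype.equivFin X u then 0 else 1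
  have h1 : T.linkSum x (fun y u => inversion y u) = ((T.linkSum x f : ℕ) : ZMod 2) := by
    simp [linkSum, f, inversion]
  have h2 : T.linkSum x (fun y u => f y u + f u y) = T.linkSum x (fun _ _ => 1) := by
    rw [linkSum_eq, linkSum_eq]
    refine Finset.sum_congr rfl fun y hy => Finset.sum_congr rfl fun u hu => ?_
    have hyu := (T.adj_of_apex (T.mem_nbrs.1 hy).1 hu).2.1.1
    have h' : Fintype.equivFin X y ≠ Fintype.equivFin X u := fun e => hyu ((Equiv.injective _) e)
    simp only [f]
    rcases lt_or_gt_of_ne h' with h1 | h1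
    · rw [if_pos h1, if_neg h1.not_gt]
    · rw [if_neg h1.not_gt, if_pos h1]
  have h3 := T.linkSum_comm x f
  rw [linkSum_add, T.linkSum_const x (fun _ => 1)] at h2
  simp only [smul_eq_mul, mul_one, Finset.sum_const] at h2
  rw [h1, show T.linkSum x f = (T.nbrs x).card by omega]
  simp

/-- Orient each triangle by an enumeration of the vertices and seek corrections `g` in `ℤ/2` making
the orientations coherent. The required sum of the two corrections at an edge is a chain on edges;
`linkSum_inversion` shows that it is a cycle, hence a boundary, and `g` is a chain which it bounds.
-/
theorem exists_orientation : Nonempty T.Orientation := by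
  obtain ⟨g, hg⟩ := T.exists_chain_of_cycle
    (fun e => 1 + ∑ u ∈ T.apex e, ∑ v ∈ e, inversion v u) (fun x => by
      rw [T.sum_edges_eq, Finset.sum_add_distrib, ← T.linkSum_inversion x]
      have h : ∑ y ∈ T.nbrs x, ∑ u ∈ T.apex {x, y}, ∑ v ∈ {x, y}, inversion v u =
          T.linkSum x (fun y u => inversion x u + inversion y u) := by
        rw [linkSum_eq]
        refine Finset.sum_congr rfl fun y hy => Finset.sum_congr rfl fun u hu => ?_
        rw [Finset.sum_pair (T.mem_nbrs.1 hy).1]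
      have h1 := T.linkSum_comm x (fun _ u => inversion x u)
      rw [T.linkSum_const x] at h1
      rw [h, linkSum_add, h1]
      have h0 : ∀ a : ZMod 2, 2 • a = 0 := by decide
      simp only [h0, Finset.sum_const_zero, zero_add]
      generalize T.linkSum x (fun y u => inversion y u) = a
      revert a; decide)
  -- The parity of the ordering `(x, y, z)`, corrected by `g`. Zero means positively oriented; a
  -- transposition adds one and a rotation changes nothing. The choice of `g` makes exactly one apex
  -- of each oriented edge positive.
  let s : X → X → X → ZMod 2 := fun x y z =>
    inversion x y + inversion y z + inversion x z + g (insert z {x, y})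
  have s_swap : ∀ x y z, x ≠ y → s y x z = s x y z + 1 := by
    intro x y z h
    have h1 := inversion_add h
    simp only [s, Finset.pair_comm y x]
    rw [← h1]
    generalize inversion x y = a, inversion y x = b, inversion x z = c, inversion y z = d, g _ = k
    revert a b c d k; decide
  have s_rotate : ∀ x y z, x ≠ y → x ≠ z → s y z x = s x y z := by
    intro x y z h h'
    have h1 := inversion_add h
    have h2 := inversion_add h'
    have : insert x {y, z} = insert z ({x, y} : Finset X) := by ext; simp; tauto
    simp only [s, this]
    generalize inversion x y = a, inversion y x = b, inversion x z = c, inversion z x = d,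
      inversion y z = k, g _ = m at *
    revert a b c d k m; decide
  have hex : ∀ x y, T.graph.Adj x y → ∃ z ∈ T.apex {x, y}, s x y z = 0 ∧
      ∀ z' ∈ T.apex {x, y}, s x y z' = 0 → z' = z := by
    intro x y h
    obtain ⟨u, v, huv, hap⟩ := Finset.card_eq_two.1 (T.card_apex h)
    have h1 := hg x y h
    rw [hap, Finset.sum_pair huv, Finset.sum_pair huv, Finset.sum_pair h.1,
      Finset.sum_pair h.1] at h1
    have h2 : s x y u + s x y v = 1 := by
      simp only [s]
      generalize inversion x y = a, inversion y u = b, inversion x u = c, inversion y v = d,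
        inversion x v = k, g (insert u _) = m, g (insert v _) = n at *
      revert a b c d k m n; decide
    have h3 : (s x y u = 0 ∧ s x y v ≠ 0) ∨ (s x y v = 0 ∧ s x y u ≠ 0) := by
      generalize s x y u = a, s x y v = b at *
      revert a b; decide
    rw [hap]
    rcases h3 with ⟨h3, h4⟩ | ⟨h3, h4⟩
    · refine ⟨u, by simp, h3, fun z' hz' h' => ?_⟩
      simp only [Finset.mem_insert, Finset.mem_singleton] at hz'
      rcases hz' with rfl | rfl
      · rfl
      · exact (h4 h').elim
    · refine ⟨v, by simp, h3, fun z' hz' h' => ?_⟩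
      simp only [Finset.mem_insert, Finset.mem_singleton] at hz'
      rcases hz' with rfl | rfl
      · exact (h4 h').elim
      · rfl
  classical
  let r : X → X → X := fun x y => if h : T.graph.Adj x y then (hex x y h).choose else x
  have hr : ∀ x y, T.graph.Adj x y → r x y ∈ T.apex {x, y} ∧ s x y (r x y) = 0 ∧
      ∀ z' ∈ T.apex {x, y}, s x y z' = 0 → z' = r x y := by
    intro x y h
    simp only [r, dif_pos h]
    exact (hex x y h).choose_spec
  refine ⟨⟨r, fun h => (hr _ _ h).1, fun {x y} h e => ?_, fun {x y} h => ?_⟩⟩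
  · have h1 := (hr _ _ h).2.1
    have h2 := (hr _ _ h.symm).2.1
    rw [← e, s_swap _ _ _ h.1, h1] at h2
    simp at h2
  · have h0 := (hr _ _ h).1
    have hadj := T.adj_of_apex h.1 h0
    refine ((hr y (r x y) hadj.2.1).2.2 x (T.apex_rotate h.1 h0) ?_).symm
    rw [s_rotate _ _ _ h.1 hadj.2.2.1.symm]
    exact (hr _ _ h).2.1

namespace Orientation

variable {T} (o : T.Orientation) {x y : X}

theorem adj_right (h : T.graph.Adj x y) : T.graph.Adj y (o.r x y) :=
  (T.adj_of_apex h.1 (o.mem_apex h)).2.1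

theorem adj_left (h : T.graph.Adj x y) : T.graph.Adj (o.r x y) x :=
  (T.adj_of_apex h.1 (o.mem_apex h)).2.2

theorem rotate_left (h : T.graph.Adj x y) : o.r (o.r x y) x = y := by
  have := o.rotate (o.adj_right h)
  rwa [o.rotate h] at this

theorem apex_eq (h : T.graph.Adj x y) : T.apex {x, y} = {o.r x y, o.r y x} := by
  symm
  apply Finset.eq_of_subset_of_card_le
  · have h1 := o.mem_apex h
    have h2 := o.mem_apex h.symm
    rw [T.apex_comm] at h2
    simp [Finset.insert_subset_iff, h1, h2]
  · rw [T.card_apex h, Finset.card_pair (o.ne h)]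

/-- The triangle in whose positive boundary the oriented edge `(x, y)` occurs. -/
def tri (x y : X) : Finset X := insert (o.r x y) {x, y}

theorem tri_mem (h : T.graph.Adj x y) : o.tri x y ∈ T.triangles := (T.mem_apex.1 (o.mem_apex h)).2

theorem tri_rotate (h : T.graph.Adj x y) : o.tri y (o.r x y) = o.tri x y := by
  unfold tri
  rw [o.rotate h]
  ext; simp; tauto

/-- A triangle which contains `x` and `y` is one of the two triangles at the edge. -/
theorem eq_tri_or {t : Finset X} (ht : t ∈ T.triangles) (h : x ≠ y) (hx : x ∈ t) (hy : y ∈ t) :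
    t = o.tri x y ∨ t = o.tri y x := by
  obtain ⟨z, hz, rfl⟩ := T.exists_eq_insert ht hx hy h
  have hz' : z ∈ T.apex {x, y} := T.mem_apex.2 ⟨hz, ht⟩
  rw [o.apex_eq (T.adj_of_mem ht hx hy h), Finset.mem_insert, Finset.mem_singleton] at hz'
  rcases hz' with rfl | rfl
  · exact Or.inl rfl
  · exact Or.inr (by rw [tri, Finset.pair_comm])

/-- The positive boundary of a triangle. -/
theorem tri_eq_iff {u v : X} (h : T.graph.Adj x y) (h' : T.graph.Adj u v) :
    o.tri u v = o.tri x y ↔ (u = x ∧ v = y) ∨ (u = y ∧ v = o.r x y) ∨ (u = o.r x y ∧ v = x) := by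
  constructor
  · intro e
    have hu : u ∈ o.tri x y := e ▸ by simp [tri]
    have hv : v ∈ o.tri x y := e ▸ by simp [tri]
    have hne := h'.1
    have hw : o.r u v ∈ o.tri x y := e ▸ by simp [tri]
    have h3 := (T.mem_apex.1 (o.mem_apex h')).1
    have n1 := o.ne h
    have n2 := o.ne (o.adj_right h)
    have n3 := o.ne (o.adj_left h)
    rw [o.rotate h] at n2
    rw [o.rotate_left h] at n3
    simp only [tri, Finset.mem_insert, Finset.mem_singleton] at hu hv hw h3
    rcases hu with rfl | rfl | rfl <;> rcases hv with rfl | rfl | rfl <;> grind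
  · rintro (⟨rfl, rfl⟩ | ⟨rfl, rfl⟩ | ⟨rfl, rfl⟩)
    · rfl
    · exact o.tri_rotate h
    · have h1 := o.tri_rotate (o.adj_right h)
      rw [o.rotate h] at h1
      rw [h1, o.tri_rotate h]

theorem link_induction {Q : X → Prop} (hQ : ∀ y, T.graph.Adj x y → (Q y ↔ Q (o.r x y))) {z : X}
    (hy : T.graph.Adj x y) (hz : T.graph.Adj x z) (h : Q y) : Q z := by
  refine T.link_induction (fun u v hu hv hq => ?_) hy hz h
  have hadj := (T.adj_of_apex hu hv).1
  rw [o.apex_eq hadj, Finset.mem_insert, Finset.mem_singleton] at hv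
  rcases hv with rfl | rfl
  · exact (hQ u hadj).1 hq
  · refine (hQ _ (o.adj_right hadj.symm)).2 ?_
    rwa [o.rotate hadj.symm]

end Orientation

end SphericalTriangulation

namespace SphericalTriangulation

variable {X : Type} [Fintype X] [DecidableEq X]

/-! ### Bipolar orderings of the vertices -/

/-- A bipolar ordering of the vertices with lowest vertex `a` and highest vertex `b`. -/
structure Height (T : SphericalTriangulation X) (a b : X) where
  h : X → ℚ
  inj : Function.Injective h
  lower : ∀ x, x ≠ a → ∃ y, T.graph.Adj x y ∧ h y < h x
  upper : ∀ x, x ≠ b → ∃ y, T.graph.Adj x y ∧ h x < h y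

variable {T : SphericalTriangulation X} {a b : X}

theorem exists_between_avoiding (A : Finset X) (h : X → ℚ) {p q : ℚ} (hpq : p ≠ q) :
    ∃ c, (p < c ∧ c < q ∨ q < c ∧ c < p) ∧ ∀ x ∈ A, h x ≠ c := by
  rcases lt_or_gt_of_ne hpq with hlt | hlt
  · obtain ⟨c, hc, hc'⟩ := (Set.Ioo_infinite hlt).exists_notMem_finset (A.image h)
    exact ⟨c, Or.inl hc, fun x hx e => hc' (Finset.mem_image.2 ⟨x, hx, e⟩)⟩
  · obtain ⟨c, hc, hc'⟩ := (Set.Ioo_infinite hlt).exists_notMem_finset (A.image h)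
    exact ⟨c, Or.inr hc, fun x hx e => hc' (Finset.mem_image.2 ⟨x, hx, e⟩)⟩

/-- Take an edge from `u` in `A` to a vertex outside. The link of `u` meets both `A` and its
complement, so being connected it has an edge between them. -/
theorem exists_triangle_leaving {A : Finset X} (ha : a ∈ A)
    (hA : ∀ x ∈ A, ∃ y ∈ A, T.graph.Adj x y) {w : X} (hw : w ∉ A) :
    ∃ u ∈ A, ∃ v ∈ A, T.graph.Adj u v ∧ ∃ z ∉ A, T.graph.Adj z u ∧ T.graph.Adj z v := by
  obtain ⟨p⟩ := T.connected.preconnected a w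
  obtain ⟨d, _, hu, hz⟩ := p.exists_boundary_dart (A : Set X) ha hw
  obtain ⟨y, hy, huy⟩ := hA _ hu
  by_contra hc
  push Not at hc
  refine hz (T.link_induction (x := d.fst) (Q := (· ∈ A)) ?_ huy d.adj hy)
  intro v z hv hz' hvA
  by_contra hzA
  have h3 := T.adj_of_apex hv hz'
  exact hc _ hu _ hvA h3.1 _ hzA h3.2.2 h3.2.1.symm

/-- Grow the ordered set `A` one vertex at a time. A new vertex forming a triangle with `u` and `v`
in `A` receives a height strictly between theirs, so that these two are its lower and upper
neighbours; the witnesses for the old vertices persist. -/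
theorem exists_height_aux (hab : T.graph.Adj a b) (n : ℕ) : ∀ (A : Finset X) (h : X → ℚ),
    (Finset.univ \ A).card = n → a ∈ A → b ∈ A → Set.InjOn h A →
    (∀ x ∈ A, x ≠ a → ∃ y ∈ A, T.graph.Adj x y ∧ h y < h x) →
    (∀ x ∈ A, x ≠ b → ∃ y ∈ A, T.graph.Adj x y ∧ h x < h y) → Nonempty (T.Height a b) := by
  induction n with
  | zero =>
    intro A h hn ha hb hinj hl hu
    have hA : ∀ x, x ∈ A := by
      intro x
      rw [Finset.card_eq_zero, Finset.sdiff_eq_empty_iff_subset] at hn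
      exact hn (Finset.mem_univ x)
    refine ⟨⟨h, fun x y e => hinj (hA x) (hA y) e, fun x hx => ?_, fun x hx => ?_⟩⟩
    · obtain ⟨y, _, hy⟩ := hl x (hA x) hx
      exact ⟨y, hy⟩
    · obtain ⟨y, _, hy⟩ := hu x (hA x) hx
      exact ⟨y, hy⟩
  | succ n ih =>
    intro A h hn ha hb hinj hl hu
    obtain ⟨w, hw⟩ := Finset.card_pos.1 (by omega : 0 < (Finset.univ \ A).card)
    obtain ⟨u, huA, v, hvA, huv, z, hz, hzu, hzv⟩ := exists_triangle_leaving ha (fun x hx => by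
      by_cases hxa : x = a
      · obtain ⟨y, hy, h'⟩ := hu x hx (hxa ▸ hab.1)
        exact ⟨y, hy, h'.1⟩
      · obtain ⟨y, hy, h'⟩ := hl x hx hxa
        exact ⟨y, hy, h'.1⟩) (Finset.mem_sdiff.1 hw).2
    obtain ⟨c, hc, hcA⟩ := exists_between_avoiding A h (fun e => huv.1 (hinj huA hvA e))
    have hne : ∀ x ∈ A, Function.update h z c x = h x := fun x hx =>
      Function.update_of_ne (by rintro rfl; exact hz hx) _ _
    refine ih (insert z A) (Function.update h z c) ?_ (Finset.mem_insert_of_mem ha)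
      (Finset.mem_insert_of_mem hb) ?_ ?_ ?_
    · rw [← Finset.compl_eq_univ_sdiff, Finset.card_compl] at hn ⊢
      rw [Finset.card_insert_of_notMem hz]
      omega
    · intro x hx y hy e
      simp only [Finset.coe_insert, Set.mem_insert_iff, Finset.mem_coe] at hx hy
      rcases hx with rfl | hx <;> rcases hy with rfl | hy
      · rfl
      · rw [hne y hy, Function.update_self] at e
        exact (hcA y hy e.symm).elim
      · rw [hne x hx, Function.update_self] at e
        exact (hcA x hx e).elim
      · rw [hne x hx, hne y hy] at e
        exact hinj hx hy e
    · intro x hx hxa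
      rcases Finset.mem_insert.1 hx with rfl | hx
      · rw [Function.update_self]
        rcases hc with hc | hc
        · exact ⟨u, Finset.mem_insert_of_mem huA, hzu, by rw [hne u huA]; exact hc.1⟩
        · exact ⟨v, Finset.mem_insert_of_mem hvA, hzv, by rw [hne v hvA]; exact hc.1⟩
      · obtain ⟨y, hy, h1, h2⟩ := hl x hx hxa
        exact ⟨y, Finset.mem_insert_of_mem hy, h1, by rwa [hne x hx, hne y hy]⟩
    · intro x hx hxb
      rcases Finset.mem_insert.1 hx with rfl | hx
      · rw [Function.update_self]
        rcases hc with hc | hc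
        · exact ⟨v, Finset.mem_insert_of_mem hvA, hzv, by rw [hne v hvA]; exact hc.2⟩
        · exact ⟨u, Finset.mem_insert_of_mem huA, hzu, by rw [hne u huA]; exact hc.2⟩
      · obtain ⟨y, hy, h1, h2⟩ := hu x hx hxb
        exact ⟨y, Finset.mem_insert_of_mem hy, h1, by rwa [hne x hx, hne y hy]⟩

theorem exists_height (hab : T.graph.Adj a b) : Nonempty (T.Height a b) := by
  have hne := hab.1
  refine exists_height_aux hab _ {a, b} (fun x => if x = a then 0 else 1) rfl (by simp) (by simp)
    ?_ ?_ ?_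
  · intro x hx y hy e
    simp only [Finset.coe_insert, Finset.coe_singleton, Set.mem_insert_iff,
      Set.mem_singleton_iff] at hx hy
    rcases hx with rfl | rfl <;> rcases hy with rfl | rfl <;> simp_all
  · intro x hx hxa
    refine ⟨a, by simp, ?_, by simp [hxa]⟩
    have : x = b := by simpa [hxa] using hx
    exact this ▸ hab.symm
  · intro x hx hxb
    have : x = a := by simpa [hxb] using hx
    subst this
    exact ⟨b, by simp, hab, by simp [hxb.symm]⟩

/-! ### Changes of direction around a vertex -/

namespace Height

variable (H : T.Height a b) (o : T.Orientation)

theorem min {x : X} (hx : x ≠ a) : H.h a < H.h x := by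
  obtain ⟨m, _, hm⟩ := Finset.exists_min_image Finset.univ H.h ⟨a, Finset.mem_univ a⟩
  have : m = a := by
    by_contra hc
    obtain ⟨y, _, hy⟩ := H.lower m hc
    exact absurd (hm y (Finset.mem_univ y)) (not_le.2 hy)
  subst this
  exact lt_of_le_of_ne (hm x (Finset.mem_univ x)) fun e => hx (H.inj e).symm

theorem max {x : X} (hx : x ≠ b) : H.h x < H.h b := by
  obtain ⟨m, _, hm⟩ := Finset.exists_max_image Finset.univ H.h ⟨b, Finset.mem_univ b⟩
  have : m = b := by
    by_contra hc
    obtain ⟨y, _, hy⟩ := H.upper m hc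
    exact absurd (hm y (Finset.mem_univ y)) (not_le.2 hy)
  subst this
  exact lt_of_le_of_ne (hm x (Finset.mem_univ x)) fun e => hx (H.inj e)

/-- The upper neighbours of `x` which are followed by a lower neighbour in the link of `x`. -/
def descents (x : X) : Finset X :=
  (T.nbrs x).filter fun y => H.h x < H.h y ∧ H.h (o.r x y) < H.h x

/-- The lower neighbours of `x` which are followed by an upper neighbour in the link of `x`. -/
def ascents (x : X) : Finset X :=
  (T.nbrs x).filter fun y => H.h y < H.h x ∧ H.h x < H.h (o.r x y)

theorem h_lt_or_gt {x y : X} (h : x ≠ y) : H.h x < H.h y ∨ H.h y < H.h x :=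
  lt_or_gt_of_ne fun e => h (H.inj e)

/-- In a cyclic sequence of signs there are as many changes from plus to minus as from minus to
plus. Rotation in the link is a bijection between `B` and `A`, so `A \ B` and `B \ A` have the same
size. -/
theorem card_descents_eq (x : X) : (H.descents o x).card = (H.ascents o x).card := by
  let A := (T.nbrs x).filter fun y => H.h x < H.h y
  let B := (T.nbrs x).filter fun y => H.h x < H.h (o.r x y)
  have hAB : B.card = A.card := by
    refine Finset.card_bij' (fun y _ => o.r x y) (fun y _ => o.r y x) ?_ ?_ ?_ ?_
    · intro y hy
      simp only [A, B, Finset.mem_filter, T.mem_nbrs] at hy ⊢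
      exact ⟨(o.adj_left hy.1).symm, hy.2⟩
    · intro y hy
      simp only [A, B, Finset.mem_filter, T.mem_nbrs] at hy ⊢
      rw [o.rotate hy.1.symm]
      exact ⟨o.adj_right hy.1.symm, hy.2⟩
    · intro y hy
      exact o.rotate_left (T.mem_nbrs.1 (Finset.mem_filter.1 hy).1)
    · intro y hy
      exact o.rotate (T.mem_nbrs.1 (Finset.mem_filter.1 hy).1).symm
  have h1 : H.descents o x = A \ B := by
    ext y
    simp only [descents, A, B, Finset.mem_filter, Finset.mem_sdiff, T.mem_nbrs]
    constructor
    · rintro ⟨h1, h2, h3⟩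
      exact ⟨⟨h1, h2⟩, fun h => absurd h.2 h3.not_gt⟩
    · rintro ⟨⟨h1, h2⟩, h3⟩
      refine ⟨h1, h2, ?_⟩
      have := H.h_lt_or_gt (o.adj_left h1).1
      tauto
  have h2 : H.ascents o x = B \ A := by
    ext y
    simp only [ascents, A, B, Finset.mem_filter, Finset.mem_sdiff, T.mem_nbrs]
    constructor
    · rintro ⟨h1, h2, h3⟩
      exact ⟨⟨h1, h3⟩, fun h => absurd h.2 h2.not_gt⟩
    · rintro ⟨⟨h1, h2⟩, h3⟩
      refine ⟨h1, ?_, h2⟩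
      have := H.h_lt_or_gt h1.1
      tauto
  rw [h1, h2, Finset.card_sdiff_comm hAB.symm]

/-- Such a vertex has both an upper and a lower neighbour. Without descents there would be no
ascents either, and being above `x` would be constant around the link. -/
theorem descents_nonempty {x : X} (hxa : x ≠ a) (hxb : x ≠ b) : (H.descents o x).Nonempty := by
  by_contra hc
  rw [Finset.not_nonempty_iff_eq_empty] at hc
  have h1 := H.card_descents_eq o x
  rw [hc, Finset.card_empty] at h1
  have h2 := Finset.card_eq_zero.1 h1.symm
  obtain ⟨y, hy, hxy⟩ := H.upper x hxb
  obtain ⟨z, hz, hzx⟩ := H.lower x hxa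
  refine absurd (o.link_induction (Q := fun y => H.h x < H.h y) (fun u hu => ?_) hy hz hxy)
    hzx.not_gt
  have h3 := Finset.eq_empty_iff_forall_notMem.1 hc u
  have h4 := Finset.eq_empty_iff_forall_notMem.1 h2 u
  simp only [descents, ascents, Finset.mem_filter, T.mem_nbrs, hu, true_and] at h3 h4
  have h5 := H.h_lt_or_gt hu.1
  have h6 := H.h_lt_or_gt (o.adj_left hu).1
  constructor
  · intro h
    by_contra h'
    tauto
  · intro h
    by_contra h'
    tauto

/-- A triangle changes direction only at its vertex of middle height, where it counts once, as a
descent or as an ascent. Its corners correspond to oriented edges: `(x, y)` stands for the corner at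
`x` of the triangle `o.tri x y`. -/
theorem sum_card_eq : ∑ x, ((H.descents o x).card + (H.ascents o x).card) = T.triangles.card := by
  let f : X × X → ℕ := fun d =>
    if (H.h d.1 < H.h d.2 ∧ H.h (o.r d.1 d.2) < H.h d.1) ∨
      (H.h d.2 < H.h d.1 ∧ H.h d.1 < H.h (o.r d.1 d.2)) then 1 else 0
  let rot : X × X → X × X := fun d => (d.2, o.r d.1 d.2)
  have hrot : ∀ d ∈ T.darts, rot d ∈ T.darts := fun d hd =>
    T.mem_darts.2 (o.adj_right (T.mem_darts.1 hd))
  have hrot3 : ∀ d ∈ T.darts, rot (rot (rot d)) = d := by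
    rintro ⟨x, y⟩ hd
    have hd := T.mem_darts.1 hd
    simp only [rot]
    rw [o.rotate hd, o.rotate_left hd]
  have hsum : ∀ g : X × X → ℕ, ∑ d ∈ T.darts, g (rot d) = ∑ d ∈ T.darts, g d := by
    intro g
    refine Finset.sum_bij' (fun d _ => rot d) (fun d _ => rot (rot d)) ?_ ?_ ?_ ?_ ?_
    · exact hrot
    · exact fun d hd => hrot _ (hrot d hd)
    · exact hrot3
    · exact hrot3
    · exact fun _ _ => rfl
  -- Each oriented edge is summed together with its two rotations around the triangle, so each
  -- triangle is counted three times on either side.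
  have h1 : ∑ d ∈ T.darts, (f d + f (rot d) + f (rot (rot d))) = 3 * T.triangles.card := by
    rw [T.three_mul_card_triangles, ← T.card_darts, Finset.card_eq_sum_ones]
    refine Finset.sum_congr rfl ?_
    rintro ⟨x, y⟩ hd
    have hd := T.mem_darts.1 hd
    simp only [f, rot]
    rw [o.rotate hd, o.rotate_left hd]
    have h1 := H.h_lt_or_gt hd.1
    have h2 := H.h_lt_or_gt (o.adj_right hd).1
    have h3 := H.h_lt_or_gt (o.adj_left hd).1
    generalize H.h x = p, H.h y = q, H.h (o.r x y) = r at *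
    split_ifs <;> first | rfl | (exfalso; grind)
  have h2 : ∑ d ∈ T.darts, f d = ∑ x, ((H.descents o x).card + (H.ascents o x).card) := by
    have : T.darts = (Finset.univ.sigma T.nbrs).map (Equiv.sigmaEquivProd X X).toEmbedding := by
      ext ⟨x, y⟩
      simp [T.mem_darts, T.mem_nbrs]
    rw [this, Finset.sum_map, Finset.sum_sigma]
    refine Finset.sum_congr rfl fun x _ => ?_
    rw [descents, ascents, ← Finset.card_union_of_disjoint, ← Finset.filter_or,
      Finset.card_filter]
    · rfl
    · rw [Finset.disjoint_filter]
      intro y _ h h'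
      exact absurd h.1 h'.1.not_gt
  rw [Finset.sum_add_distrib, Finset.sum_add_distrib, hsum (fun d => f (rot d)), hsum f, h2] at h1
  omega

/-- Twice the number of descents is `F = 2 (V - 2)`. The `V - 2` vertices other than the poles have
at least one descent each, so each has exactly one. -/
theorem card_descents (hab : a ≠ b) {x : X} (hxa : x ≠ a) (hxb : x ≠ b) :
    (H.descents o x).card = 1 := by
  have h1 := H.sum_card_eq o
  simp only [← H.card_descents_eq o, ← two_mul] at h1
  rw [← Finset.mul_sum] at h1
  have h2 := T.card_triangles_add_four
  let S : Finset X := Finset.univ \ {a, b}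
  have hS : S.card + 2 = Fintype.card X := by
    have := Finset.card_sdiff_add_card_eq_card (Finset.subset_univ ({a, b} : Finset X))
    rwa [Finset.card_pair hab] at this
  have h3 : ∑ x ∈ S, (H.descents o x).card ≤ ∑ x, (H.descents o x).card :=
    Finset.sum_le_sum_of_subset (Finset.subset_univ _)
  have h4 : ∀ x ∈ S, 1 ≤ (H.descents o x).card := by
    intro x hx
    simp only [S, Finset.mem_sdiff, Finset.mem_insert, Finset.mem_singleton, not_or] at hx
    exact Finset.card_pos.2 (H.descents_nonempty o hx.2.1 hx.2.2)
  have h5 : ∑ x ∈ S, 1 = ∑ x ∈ S, (H.descents o x).card := by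
    have := Finset.sum_le_sum h4
    rw [← Finset.card_eq_sum_ones] at this ⊢
    omega
  exact ((Finset.sum_eq_sum_iff_of_le h4).1 h5 x (by simp [S, hxa, hxb])).symm

/-- The upper and the lower neighbours of a vertex form two arcs of its link. -/
theorem descent_unique (hab : a ≠ b) {x y z : X} (hxa : x ≠ a) (hxb : x ≠ b)
    (hy : T.graph.Adj x y) (hz : T.graph.Adj x z) (hy1 : H.h x < H.h y)
    (hy2 : H.h (o.r x y) < H.h x) (hz1 : H.h x < H.h z) (hz2 : H.h (o.r x z) < H.h x) : y = z :=
  Finset.card_le_one.1 (H.card_descents o hab hxa hxb).le y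
    (Finset.mem_filter.2 ⟨T.mem_nbrs.2 hy, hy1, hy2⟩) z
    (Finset.mem_filter.2 ⟨T.mem_nbrs.2 hz, hz1, hz2⟩)

end Height

end SphericalTriangulation

namespace SphericalTriangulation

/-! ### Existence of sweeping loops -/

variable {X : Type}

/-- The oriented edges of a walk. -/
def steps {G : SimpleGraph X} {x y : X} (γ : G.Walk x y) : List (X × X) :=
  γ.darts.map SimpleGraph.Dart.toProd

@[simp] theorem steps_nil {G : SimpleGraph X} {x : X} : steps (.nil : G.Walk x x) = [] := rfl

@[simp] theorem steps_cons {G : SimpleGraph X} {x y z : X} (h : G.Adj x y) (γ : G.Walk y z) :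
    steps (.cons h γ) = (x, y) :: steps γ := rfl

theorem adj_of_mem_steps {G : SimpleGraph X} {x y : X} {γ : G.Walk x y} {d : X × X}
    (hd : d ∈ steps γ) : G.Adj d.1 d.2 := by
  obtain ⟨e, _, rfl⟩ := List.mem_map.1 hd
  exact e.adj

variable [Fintype X] [DecidableEq X] {T : SphericalTriangulation X} {a b : X}

/-! ### Pushing increasing walks across triangles -/

namespace Height

variable (H : T.Height a b) (o : T.Orientation)

/-- The walk `γ` is increasing. -/
def IsUp {x y : X} (γ : T.graph.Walk x y) : Prop := ∀ d ∈ steps γ, H.h d.1 < H.h d.2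

theorem isUp_cons {x y z : X} (h : T.graph.Adj x y) (γ : T.graph.Walk y z) :
    H.IsUp (.cons h γ) ↔ H.h x < H.h y ∧ H.IsUp γ := by
  simp [IsUp]

theorem IsUp.le {H : T.Height a b} {x y : X} {γ : T.graph.Walk x y} (hγ : H.IsUp γ) {d : X × X}
    (hd : d ∈ steps γ) : H.h x ≤ H.h d.1 := by
  induction γ with
  | nil => simp at hd
  | cons h γ ih =>
    rw [isUp_cons] at hγ
    rcases List.mem_cons.1 hd with rfl | hd
    · exact le_rfl
    · exact hγ.1.le.trans (ih hγ.2 hd)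

theorem IsUp.notMem_of_lt {H : T.Height a b} {x y u v : X} {γ : T.graph.Walk x y}
    (hγ : H.IsUp γ) (h : H.h u < H.h x) : (u, v) ∉ steps γ :=
  fun hd => absurd (hγ.le hd) (not_le.2 h)

/-- The increasing walk `γ'` is obtained from `γ` by a move across the triangle `t` from its left
side to its right side. -/
structure IsMove {x y : X} (γ γ' : T.graph.Walk x y) (t : Finset X) : Prop where
  isUp : H.IsUp γ'
  exists_mem : ∃ d ∈ steps γ, o.tri d.1 d.2 = t
  mem : ∀ u v, T.graph.Adj u v → H.h u < H.h v → o.tri u v = t → (u, v) ∈ steps γ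
  mem_iff : ∀ u v, T.graph.Adj u v → H.h u < H.h v →
    ((u, v) ∈ steps γ' ↔ ((u, v) ∈ steps γ ∧ o.tri u v ≠ t) ∨ o.tri v u = t)

variable {H o}

theorem IsMove.cons {x y z : X} {t : Finset X} {γ γ' : T.graph.Walk y z} (hm : H.IsMove o γ γ' t)
    (hγ : H.IsUp γ) (h : T.graph.Adj x y) (hxy : H.h x < H.h y) :
    H.IsMove o (.cons h γ) (.cons h γ') t := by
  refine ⟨(H.isUp_cons _ _).2 ⟨hxy, hm.isUp⟩, ?_, ?_, ?_⟩
  · obtain ⟨d, hd, hdt⟩ := hm.exists_mem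
    exact ⟨d, by simp [hd], hdt⟩
  · intro u v huv hlt ht
    simp [hm.mem u v huv hlt ht]
  · intro u v huv hlt
    have h1 := hm.mem_iff u v huv hlt
    have h2 := hm.mem u v huv hlt
    simp only [steps_cons, List.mem_cons, h1, Prod.mk.injEq]
    have h3 : u = x ∧ v = y → o.tri u v ≠ t := by
      rintro ⟨rfl, rfl⟩ ht
      exact hγ.notMem_of_lt hxy (h2 ht)
    tauto

theorem isMove_insert {x z w : X} (hxz : T.graph.Adj x z) (γ : T.graph.Walk z w)
    (hγ : H.IsUp (.cons hxz γ)) (h1 : H.h x < H.h (o.r x z)) (h2 : H.h (o.r x z) < H.h z) :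
    H.IsMove o (.cons hxz γ)
      (.cons (o.adj_left hxz).symm (.cons (o.adj_right hxz).symm γ)) (o.tri x z) := by
  rw [isUp_cons] at hγ
  refine ⟨?_, ⟨(x, z), by simp, rfl⟩, ?_, ?_⟩
  · rw [isUp_cons, isUp_cons]
    exact ⟨h1, h2, hγ.2⟩
  · intro u v huv hlt ht
    rw [o.tri_eq_iff hxz huv] at ht
    rcases ht with ⟨rfl, rfl⟩ | ⟨rfl, rfl⟩ | ⟨rfl, rfl⟩
    · simp
    · exact absurd hlt h2.not_gt
    · exact absurd hlt h1.not_gt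
  · intro u v huv hlt
    rw [Ne, o.tri_eq_iff hxz huv, o.tri_eq_iff hxz huv.symm]
    simp only [steps_cons, List.mem_cons, Prod.mk.injEq]
    constructor
    · rintro (⟨rfl, rfl⟩ | ⟨rfl, rfl⟩ | h)
      · simp
      · simp
      · refine Or.inl ⟨Or.inr h, ?_⟩
        have h3 := hγ.2.le h
        rintro (⟨rfl, rfl⟩ | ⟨rfl, rfl⟩ | ⟨rfl, rfl⟩)
        · exact absurd h3 (not_le.2 hγ.1)
        · exact absurd hlt h2.not_gt
        · exact absurd hlt h1.not_gt
    · rintro (⟨⟨rfl, rfl⟩ | h, h'⟩ | ⟨rfl, rfl⟩ | ⟨rfl, rfl⟩ | ⟨rfl, rfl⟩)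
      · simp at h'
      · simp [h]
      · exact absurd hlt hγ.1.not_gt
      · simp
      · simp

theorem isMove_delete {x y w : X} (hxy : T.graph.Adj x y) (hyz : T.graph.Adj y (o.r x y))
    (hxz : T.graph.Adj x (o.r x y))
    (γ : T.graph.Walk (o.r x y) w) (hγ : H.IsUp (.cons hxy (.cons hyz γ))) :
    H.IsMove o (.cons hxy (.cons hyz γ)) (.cons hxz γ) (o.tri x y) := by
  rw [isUp_cons, isUp_cons] at hγ
  obtain ⟨h1, h2, hγ⟩ := hγ
  refine ⟨?_, ⟨(x, y), by simp, rfl⟩, ?_, ?_⟩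
  · rw [isUp_cons]
    exact ⟨h1.trans h2, hγ⟩
  · intro u v huv hlt ht
    rw [o.tri_eq_iff hxy huv] at ht
    rcases ht with ⟨rfl, rfl⟩ | ⟨rfl, rfl⟩ | ⟨rfl, rfl⟩
    · simp
    · simp
    · exact absurd hlt (h1.trans h2).not_gt
  · intro u v huv hlt
    rw [Ne, o.tri_eq_iff hxy huv, o.tri_eq_iff hxy huv.symm]
    simp only [steps_cons, List.mem_cons, Prod.mk.injEq]
    constructor
    · rintro (⟨rfl, rfl⟩ | h)
      · simp
      · refine Or.inl ⟨Or.inr (Or.inr h), ?_⟩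
        have h3 := hγ.le h
        rintro (⟨rfl, rfl⟩ | ⟨rfl, rfl⟩ | ⟨rfl, rfl⟩)
        · exact absurd h3 (not_le.2 (h1.trans h2))
        · exact absurd h3 (not_le.2 h2)
        · exact absurd hlt (h1.trans h2).not_gt
    · rintro (⟨⟨rfl, rfl⟩ | ⟨rfl, rfl⟩ | h, h'⟩ | ⟨rfl, rfl⟩ | ⟨rfl, rfl⟩ | ⟨rfl, rfl⟩)
      · simp at h'
      · simp at h'
      · simp [h]
      · exact absurd hlt h1.not_gt
      · exact absurd hlt h2.not_gt
      · simp

theorem tri_eq_of_insert {x z : X} : ({x, o.r x z, z} : Finset X) = o.tri x z := by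
  ext; simp [Orientation.tri]; tauto

theorem tri_eq_of_delete {x y : X} : ({x, y, o.r x y} : Finset X) = o.tri x y := by
  ext; simp [Orientation.tri]; tauto

/-- An increasing walk ending at the top can be moved to the right, unless its first edge is the
upper edge of the triangle on its right. -/
theorem exists_move (hab : a ≠ b) {u w : X} (γ : T.graph.Walk u w) (hγ : H.IsUp γ) (hw : w = b)
    (hu : u ≠ b) :
    (∃ γ', ∃ m : T.TwoEdge γ γ', H.IsMove o γ γ' m.triangle) ∨
      ∃ v, ∃ h : T.graph.Adj u v, (∃ γ', γ = .cons h γ') ∧ H.h (o.r u v) < H.h u := by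
  have hb : ∀ x, H.h x ≤ H.h b := fun x => by
    by_cases hx : x = b
    · rw [hx]
    · exact (H.max hx).le
  induction γ with
  | nil => exact (hu hw).elim
  | @cons u v w huv γ ih =>
    have hγ0 := hγ
    rw [isUp_cons] at hγ
    rcases H.h_lt_or_gt (o.adj_left huv).1 with h1 | h1
    -- The third vertex of the triangle on the right is compared with `u` and `v`. Below `u`, the
    -- walk is blocked here; between them, the triangle is inserted; above `v`, the rest of the walk
    -- decides.
    · exact Or.inr ⟨v, huv, ⟨γ, rfl⟩, h1⟩
    left
    rcases H.h_lt_or_gt (o.adj_right huv).1 with h2 | h2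
    · have hvb : v ≠ b := by
        rintro rfl
        exact absurd (hb (o.r u v)) (not_le.2 h2)
      rcases ih hγ.2 hw hvb with ⟨γ', m, hm⟩ | ⟨z, hvz, ⟨γ', rfl⟩, hz⟩
      · exact ⟨_, .cons huv m, hm.cons hγ.2 huv hγ.1⟩
      · have hva : v ≠ a := by
          rintro rfl
          exact absurd (H.min huv.1) hγ.1.not_gt
        have hz' := ((H.isUp_cons _ _).1 hγ.2).1
        -- The rest is blocked at `v`, so `z` is a descent at `v`. So is `o.r u v`, which is
        -- followed by the lower neighbour `u` in the link. By uniqueness the walk runs along two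
        -- sides of the triangle, and `v` can be deleted.
        have : z = o.r u v := by
          refine H.descent_unique o hab hva hvb hvz (o.adj_right huv) hz' hz h2 ?_
          rw [o.rotate huv]
          exact hγ.1
        subst this
        have ht : {u, v, o.r u v} ∈ T.triangles := by
          rw [tri_eq_of_delete]
          exact o.tri_mem huv
        refine ⟨_, .delete ht huv hvz (o.adj_left huv).symm γ', ?_⟩
        have := isMove_delete huv hvz (o.adj_left huv).symm γ' hγ0
        rwa [← tri_eq_of_delete] at this
    · have ht : {u, o.r u v, v} ∈ T.triangles := by
        rw [tri_eq_of_insert]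
        exact o.tri_mem huv
      refine ⟨_, .insert ht (o.adj_left huv).symm (o.adj_right huv).symm huv γ, ?_⟩
      have := isMove_insert huv γ hγ0 h1 h2
      rwa [← tri_eq_of_insert] at this

theorem tri_ne {u v : X} (h : T.graph.Adj u v) : o.tri u v ≠ o.tri v u := by
  intro e
  rw [o.tri_eq_iff h.symm h] at e
  rcases e with ⟨e, _⟩ | ⟨_, e⟩ | ⟨e, _⟩
  · exact h.1 e
  · exact (o.adj_left h.symm).1 e.symm
  · exact (o.adj_right h.symm).1 e

/-- An increasing walk from `a` leaves `a` only at its first step and cannot continue beyond `b`. -/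
theorem eq_toWalk (hab : T.graph.Adj a b) (γ : T.graph.Walk a b) (hγ : H.IsUp γ)
    (h : (a, b) ∈ steps γ) : γ = hab.toWalk := by
  cases γ with
  | nil => exact (hab.1 rfl).elim
  | cons hv γ =>
    rw [isUp_cons] at hγ
    rcases List.mem_cons.1 h with h | h
    · simp only [Prod.mk.injEq, true_and] at h
      subst h
      cases γ with
      | nil => rfl
      | cons hv' γ =>
        have := ((H.isUp_cons _ _).1 hγ.2).1
        exact absurd this (H.max hv'.1.symm).not_gt
    · exact (hγ.2.notMem_of_lt hγ.1 h).elim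

/-- The set `S` of triangles is the left side of the increasing walk `γ`. -/
structure IsLeft (H : T.Height a b) (o : T.Orientation) (S : Finset (Finset X))
    (γ : T.graph.Walk a b) : Prop where
  isUp : H.IsUp γ
  base : o.tri a b ∈ S
  mem_iff : ∀ u v, T.graph.Adj u v → H.h u < H.h v →
    ((u, v) ∈ steps γ ↔ o.tri v u ∈ S ∧ (o.tri u v ∉ S ∨ (u, v) = (a, b)))
  closed : ∀ u v, T.graph.Adj u v → H.h u < H.h v → o.tri u v ∈ S →
    o.tri v u ∈ S ∨ (u, v) = (a, b)

/-- The walk has become the base edge again, so no edge separates `S` from its complement any more,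
and `S` spreads to all triangles by strong connectivity. -/
theorem IsLeft.eq_univ {S : Finset (Finset X)} {γ : T.graph.Walk a b} (hS : H.IsLeft o S γ)
    (hab : T.graph.Adj a b) (h : o.tri b a ∈ S) {t : Finset X} (ht : t ∈ T.triangles) : t ∈ S := by
  have hγ := eq_toWalk hab γ hS.isUp
    ((hS.mem_iff a b hab (H.min hab.1.symm)).2 ⟨h, Or.inr rfl⟩)
  subst hγ
  have key : ∀ u v, T.graph.Adj u v → H.h u < H.h v → (o.tri u v ∈ S ↔ o.tri v u ∈ S) := by
    intro u v huv hlt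
    have h1 := hS.mem_iff u v huv hlt
    have h2 := hS.closed u v huv hlt
    have h3 : steps hab.toWalk = [(a, b)] := rfl
    rw [h3, List.mem_singleton] at h1
    by_cases he : (u, v) = (a, b)
    · simp only [Prod.mk.injEq] at he
      obtain ⟨rfl, rfl⟩ := he
      exact ⟨fun _ => h, fun _ => hS.base⟩
    · tauto
  refine T.triangle_induction (Q := (· ∈ S)) (fun x y u v hxy hu hv hq => ?_) (o.tri_mem hab) ht
    hS.base
  have hiff : o.tri x y ∈ S ↔ o.tri y x ∈ S := by
    rcases H.h_lt_or_gt hxy.1 with h1 | h1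
    · exact key x y hxy h1
    · exact (key y x hxy.symm h1).symm
  have hu' := o.eq_tri_or (T.mem_apex.1 hu).2 hxy.1 (by simp) (by simp)
  have hv' := o.eq_tri_or (T.mem_apex.1 hv).2 hxy.1 (by simp) (by simp)
  rcases hu' with hu' | hu' <;> rcases hv' with hv' | hv' <;> rw [hu'] at hq <;> rw [hv'] <;> tauto

/-- As long as the walk avoids the base edge, the triangle on the right of each of its edges is
outside `S` and the one on the left inside. Moving across `t` therefore adds a new triangle and
leaves no edge of `t` wrongly placed. -/
theorem IsLeft.move {S : Finset (Finset X)} {γ γ' : T.graph.Walk a b} (hS : H.IsLeft o S γ)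
    {t : Finset X} (hm : H.IsMove o γ γ' t) (hab : (a, b) ∉ steps γ) :
    t ∉ S ∧ H.IsLeft o (insert t S) γ' := by
  have key : ∀ u v, (u, v) ∈ steps γ → o.tri v u ∈ S ∧ o.tri u v ∉ S := by
    intro u v h
    have h1 := (hS.mem_iff u v (adj_of_mem_steps h) (hS.isUp _ h)).1 h
    exact ⟨h1.1, h1.2.resolve_right fun e => hab (e ▸ h)⟩
  have ht : t ∉ S := by
    obtain ⟨d, hd, rfl⟩ := hm.exists_mem
    exact (key _ _ hd).2
  refine ⟨ht, hm.isUp, Finset.mem_insert_of_mem hS.base, ?_, ?_⟩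
  · intro u v huv hlt
    rw [hm.mem_iff u v huv hlt, hS.mem_iff u v huv hlt]
    have h1 := hm.mem u v huv hlt
    have h2 := hS.closed u v huv hlt
    have h3 := key u v
    have h4 := tri_ne (o := o) huv
    simp only [Finset.mem_insert]
    constructor
    · rintro (⟨⟨h5, h6⟩, h7⟩ | rfl)
      · exact ⟨Or.inr h5, h6.imp (fun h8 h9 => h9.elim h7 h8) id⟩
      · refine ⟨Or.inl rfl, ?_⟩
        by_cases h6 : (u, v) = (a, b)
        · exact Or.inr h6
        · left
          rintro (h7 | h7)
          · exact h4 h7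
          · exact (h2 h7).elim ht h6
    · rintro ⟨h5 | h5, h6⟩
      · exact Or.inr h5
      · left
        refine ⟨⟨h5, h6.imp (fun h8 h9 => h8 (Or.inr h9)) id⟩, ?_⟩
        intro h7
        rcases h6 with h6 | h6
        · exact h6 (Or.inl h7)
        · exact hab (h6 ▸ h1 h7)
  · intro u v huv hlt h
    rcases Finset.mem_insert.1 h with h | h
    · exact Or.inl (Finset.mem_insert_of_mem (key _ _ (hm.mem u v huv hlt h)).1)
    · exact (hS.closed u v huv hlt h).imp_left Finset.mem_insert_of_mem

/-- Induction on the number of unswept triangles. A move always exists, since a walk blocked at its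
first edge would have a vertex below `a`. -/
theorem exists_twoPath (hab : T.graph.Adj a b) (n : ℕ) : ∀ (S : Finset (Finset X))
    (γ : T.graph.Walk a b), (T.triangles \ S).card = n → H.IsLeft o S γ →
    ∃ Γ : T.TwoPath γ hab.toWalk, Γ.swept.Nodup ∧
      ∀ t ∈ T.triangles, t ∈ Γ.swept ↔ t ∉ S := by
  induction n with
  | zero =>
    intro S γ hn hS
    have hsub : ∀ t ∈ T.triangles, t ∈ S := by
      rw [Finset.card_eq_zero, Finset.sdiff_eq_empty_iff_subset] at hn
      exact hn
    obtain rfl := eq_toWalk hab γ hS.isUp ((hS.mem_iff a b hab (H.min hab.1.symm)).2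
      ⟨hsub _ (o.tri_mem hab.symm), Or.inr rfl⟩)
    exact ⟨.nil _, List.nodup_nil, fun t ht => by simp [TwoPath.swept, hsub t ht]⟩
  | succ n ih =>
    intro S γ hn hS
    have hba : o.tri b a ∉ S := by
      intro h
      have : T.triangles \ S = ∅ := by
        rw [Finset.sdiff_eq_empty_iff_subset]
        exact fun t ht => hS.eq_univ hab h ht
      rw [this] at hn
      simp at hn
    have habγ : (a, b) ∉ steps γ := fun h =>
      hba ((hS.mem_iff a b hab (H.min hab.1.symm)).1 h).1
    rcases exists_move (o := o) hab.1 γ hS.isUp rfl hab.1 with ⟨γ', m, hm⟩ | ⟨v, hv, _, hlt⟩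
    · obtain ⟨ht, hS'⟩ := hS.move hm habγ
      have htT : m.triangle ∈ T.triangles := by
        obtain ⟨d, hd, hdt⟩ := hm.exists_mem
        exact hdt ▸ o.tri_mem (adj_of_mem_steps hd)
      obtain ⟨Γ, hΓ, hΓ'⟩ := ih (insert m.triangle S) γ' (by
        rw [Finset.sdiff_insert, Finset.card_erase_of_mem (Finset.mem_sdiff.2 ⟨htT, ht⟩), hn]
        rfl) hS'
      refine ⟨.cons m Γ, ?_, fun t ht' => ?_⟩
      · refine List.nodup_cons.2 ⟨fun h => ?_, hΓ⟩
        exact (hΓ' _ htT).1 h (Finset.mem_insert_self _ _)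
      · simp only [TwoPath.swept, List.mem_cons, hΓ' t ht', Finset.mem_insert]
        by_cases h : t = m.triangle
        · simp [h, ht]
        · simp [h]
    · exact absurd hlt (H.min (o.adj_left hv).1).not_gt

end Height

variable (T) in
/-- Every spherical triangulation has a sweeping loop. -/
theorem exists_sweepingLoop : Nonempty T.SweepingLoop := by
  obtain ⟨a⟩ := T.connected.nonempty
  obtain ⟨b, hab⟩ := T.exists_adj a
  obtain ⟨H⟩ := exists_height hab
  obtain ⟨o⟩ := T.exists_orientation
  have hup : H.IsUp (.cons hab .nil) := by
    simp [Height.IsUp, H.min hab.1.symm]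
  have hm := Height.isMove_insert (o := o) hab .nil hup (H.min (o.adj_left hab).1)
    (H.max (o.adj_right hab).1.symm)
  have ht : {a, o.r a b, b} ∈ T.triangles := by
    rw [Height.tri_eq_of_insert]
    exact o.tri_mem hab
  -- The first triangle is swept by hand: the base edge is both the first and the last path, and the
  -- invariant `IsLeft` holds only after the first move.
  have hL : H.IsLeft o {o.tri a b}
      (.cons (o.adj_left hab).symm (.cons (o.adj_right hab).symm .nil)) := by
    refine ⟨hm.isUp, Finset.mem_singleton_self _, fun u v huv hlt => ?_, fun u v huv hlt h => ?_⟩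
    · rw [hm.mem_iff u v huv hlt]
      simp only [Finset.mem_singleton, steps_cons, steps_nil, List.mem_cons, List.not_mem_nil,
        or_false]
      constructor
      · rintro (⟨h1, h2⟩ | h)
        · simp only [Prod.mk.injEq] at h1
          obtain ⟨rfl, rfl⟩ := h1
          exact (h2 rfl).elim
        · exact ⟨h, Or.inl fun h' => Height.tri_ne huv (h'.trans h.symm)⟩
      · rintro ⟨h, _⟩
        exact Or.inr h
    · have := hm.mem u v huv hlt (Finset.mem_singleton.1 h)
      right
      simpa using this
  obtain ⟨Γ, hΓ, hΓ'⟩ := Height.exists_twoPath hab _ _ _ rfl hL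
  refine ⟨⟨a, b, hab, .cons
    (.insert ht (o.adj_left hab).symm (o.adj_right hab).symm hab .nil) Γ, fun t htT => ?_⟩⟩
  have h1 := hΓ' t htT
  simp only [TwoPath.swept, TwoEdge.triangle]
  rw [Height.tri_eq_of_insert, List.count_cons]
  by_cases h : t = o.tri a b
  · have : t ∉ Γ.swept := by rw [h1]; simp [h]
    rw [List.count_eq_zero_of_not_mem this]
    simp [h]
  · have : t ∈ Γ.swept := by rw [h1]; simp [h]
    rw [List.count_eq_one_of_mem hΓ this]
    simp [Ne.symm h]

end SphericalTriangulation


/-! ### Coordinates of the intertwiners -/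

/-- The third index. -/
def third (i j : Fin 3) : Fin 3 := -(i + j)

/-- The structure constants `i ε` of the bracket. -/
def lev (i j : Fin 3) : ℂ := if j = i + 1 then Complex.I else if j = i + 2 then -Complex.I else 0

theorem lev_add_one (i : Fin 3) : lev i (i + 1) = Complex.I := if_pos rfl

theorem lev_add_two (i : Fin 3) : lev i (i + 2) = -Complex.I := by
  have h : ¬ i + 2 = i + 1 := by revert i; decide
  rw [lev, if_neg h, if_pos rfl]

theorem lev_self (i : Fin 3) : lev i i = 0 := by
  have h : ¬ i = i + 1 := by revert i; decide
  have h' : ¬ i = i + 2 := by revert i; decide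
  rw [lev, if_neg h, if_neg h']

theorem third_add_one (i : Fin 3) : third i (i + 1) = i + 2 := by revert i; decide

theorem third_add_two (i : Fin 3) : third i (i + 2) = i + 1 := by revert i; decide

theorem eq_or_eq_add (i j : Fin 3) : j = i ∨ j = i + 1 ∨ j = i + 2 := by revert i j; decide

/-- Three distinct indices sum to zero modulo 3, which explains `third`. On the diagonal `third i i
= i`, but `lev i i = 0`. -/
theorem lie_e_e (i j : Fin 3) : ⁅e i, e j⁆ = lev i j • e (third i j) := by
  obtain ⟨h0, h1, h2⟩ := lie_e i
  rcases eq_or_eq_add i j with rfl | rfl | rfl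
  · rw [h0, lev_self, zero_smul]
  · rw [h1, third_add_one, lev_add_one]
  · rw [h2, third_add_two, lev_add_two, neg_smul]

theorem linF_e_eq (k : Fin 3) :
    linF (e k) = ∑ i, ∑ j, (if third i j = k then -lev i j else 0) • (e i ⊗ₜ[ℂ] e j) := by
  rw [linF_e]
  fin_cases k <;> simp [Fin.sum_univ_three, third, lev, smul_sub] <;>
    simp [Fin.ext_iff, Fin.add_def, Fin.neg_def, sub_eq_add_neg] <;> abel

theorem coord_lie (k : Fin 3) (v w : SlTwo) :
    coord k ⁅v, w⁆ =
      ∑ i, ∑ j, (if third i j = k then lev i j else 0) * (coord i v * coord j w) := by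
  conv_lhs => rw [← sum_coord_smul_e v, ← sum_coord_smul_e w]
  simp only [sum_lie, lie_sum, smul_lie, lie_smul, lie_e_e, map_sum, map_smul, coord_e,
    smul_eq_mul]
  rw [Finset.sum_comm]
  refine Finset.sum_congr rfl fun i _ => ?_
  rw [Finset.mul_sum]
  refine Finset.sum_congr rfl fun j _ => ?_
  simp only [eq_comm (a := k)]
  split_ifs <;> ring

/-! ### Amplitudes of sections -/

/-- Contraction of the first factor with the `i`-th coordinate. -/
def slice (i : Fin 3) (N : Rep) : (V ⊠ N) →ₗ[ℂ] N :=
  TensorProduct.lift ((LinearMap.lsmul ℂ N).comp (coord i))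

theorem slice_tmul (i : Fin 3) (N : Rep) (v : SlTwo) (n : N) :
    slice i N (v ⊗ₜ[ℂ] n) = coord i v • n := rfl

variable {X : Type} {G : SimpleGraph X}

/-- The coefficient on a word of basis vectors of the composition of the arrows of a section in the
direction of the path. -/
def ampl (φ : ∀ E : Rep, E →ₗ[ℂ] ℂ) : {x y : X} → {γ : G.Walk x y} → {M : Rep} →
    SectionFrom γ M → List (Fin 3) → (M →ₗ[ℂ] ℂ)
  | _, _, _, _, .nil M, [] => φ M
  | _, _, _, _, .nil _, _ :: _ => 0
  | _, _, _, _, .cons _ _ _, [] => 0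
  | _, _, _, _, .cons (N := N) _ A s, i :: w =>
      (ampl φ s w).comp ((slice i N).comp A.fwd.toLinearMap)

/-- The value on a word of basis vectors of the composition of the arrows of a section against the
direction of the path. -/
def coampl (ψ : ∀ E : Rep, E) : {x y : X} → {γ : G.Walk x y} → {M : Rep} →
    SectionFrom γ M → List (Fin 3) → M
  | _, _, _, _, .nil M, [] => ψ M
  | _, _, _, _, .nil _, _ :: _ => 0
  | _, _, _, _, .cons _ _ _, [] => 0
  | _, _, _, _, .cons _ A s, i :: w => A.bwd (e i ⊗ₜ[ℂ] coampl ψ s w)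

/-- A composition is non-zero only if each factor is; a single good word thus settles all the arrows
along a path. -/
theorem ampl_ne_zero {φ : ∀ E : Rep, E →ₗ[ℂ] ℂ} {x y : X} {γ : G.Walk x y} {M : Rep}
    (s : SectionFrom γ M) (w : List (Fin 3)) (h : ampl φ s w ≠ 0) :
    ∀ v ∈ s.values, v.arrows.fwd ≠ 0 := by
  induction s generalizing w with
  | nil => simp [SectionFrom.values]
  | cons hxy A s ih =>
    cases w with
    | nil => exact (h rfl).elim
    | cons i w =>
      rw [ampl] at h
      intro v hv
      rcases List.mem_cons.1 hv with rfl | hv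
      · intro h0
        have h0 : A.fwd = 0 := h0
        rw [h0] at h
        exact h (by ext; simp)
      · refine ih w (fun h0 => h ?_) v hv
        rw [h0, LinearMap.zero_comp]

theorem coampl_ne_zero {ψ : ∀ E : Rep, E} {x y : X} {γ : G.Walk x y} {M : Rep}
    (s : SectionFrom γ M) (w : List (Fin 3)) (h : coampl ψ s w ≠ 0) :
    ∀ v ∈ s.values, v.arrows.bwd ≠ 0 := by
  induction s generalizing w with
  | nil => simp [SectionFrom.values]
  | cons hxy A s ih =>
    cases w with
    | nil => exact (h rfl).elim
    | cons i w =>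
      rw [coampl] at h
      intro v hv
      rcases List.mem_cons.1 hv with rfl | hv
      · intro h0
        have h0 : A.bwd = 0 := h0
        rw [h0] at h
        exact h rfl
      · refine ih w (fun h0 => h ?_) v hv
        rw [h0, TensorProduct.tmul_zero]
        exact map_zero A.bwd

/-! ### Transport of amplitudes along 2-edges -/

namespace SphericalTriangulation

variable [Fintype X] [DecidableEq X] {T : SphericalTriangulation X}

/-- The transport along a 2-edge of functions on words, with coefficients `p` for the vertices which
fuse two letters and `q` for those which split a letter. -/
def TwoEdge.evolve {R W : Type} [Semiring R] [AddCommMonoid W] [Module R W]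
    (p q : Fin 3 → Fin 3 → R) : {x z : X} → {γ γ' : T.graph.Walk x z} → T.TwoEdge γ γ' →
    (List (Fin 3) → W) → List (Fin 3) → W
  | _, _, _, _, .insert _ _ _ _ _, f, k :: w =>
      ∑ i, ∑ j, (if third i j = k then p i j else 0) • f (i :: j :: w)
  | _, _, _, _, .insert _ _ _ _ _, _, [] => 0
  | _, _, _, _, .delete _ _ _ _ _, f, i :: j :: w => q i j • f (third i j :: w)
  | _, _, _, _, .delete _ _ _ _ _, _, [_] => 0
  | _, _, _, _, .delete _ _ _ _ _, _, [] => 0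
  | _, _, _, _, .cons _ m, f, i :: w => m.evolve p q (fun w => f (i :: w)) w
  | _, _, _, _, .cons _ _, _, [] => 0

/-- Transport is a linear combination of values, so it commutes with evaluation at a vector and with
the arrows on the edges preceding the triangle. -/
theorem TwoEdge.evolve_map {R W W' : Type} [Semiring R] [AddCommMonoid W] [Module R W]
    [AddCommMonoid W'] [Module R W'] (p q : Fin 3 → Fin 3 → R) (L : W →ₗ[R] W') {x z : X}
    {γ γ' : T.graph.Walk x z} (m : T.TwoEdge γ γ') (f : List (Fin 3) → W) (w : List (Fin 3)) :
    m.evolve p q (fun w => L (f w)) w = L (m.evolve p q f w) := by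
  induction m generalizing f w with
  | insert =>
    cases w with
    | nil => simp [evolve]
    | cons k w => simp only [evolve, map_sum, map_smul]
  | delete =>
    match w with
    | [] => simp [evolve]
    | [_] => simp [evolve]
    | i :: j :: w => simp only [evolve, map_smul]
  | cons h m ih =>
    cases w with
    | nil => simp [evolve]
    | cons k w => simp only [evolve, ih (fun w => f (k :: w))]

theorem slice_fuse (k : Fin 3) (P N : Rep) (B : Hom N (V ⊠ P)) (t : (V ⊠ N : Rep)) :
    slice k P ((tensorHom F' (idHom P)) ((assocInv V V P) ((tensorHom (idHom V) B) t))) =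
      ∑ i, ∑ j, (if third i j = k then lev i j else 0) • slice j P (B (slice i N t)) := by
  induction t using TensorProduct.induction_on with
  | zero => simp
  | add t₁ t₂ h₁ h₂ => simp only [map_add, h₁, h₂, smul_add, Finset.sum_add_distrib]
  | tmul v n =>
    have hB : ∀ i, B (slice i N (v ⊗ₜ[ℂ] n)) = coord i v • B n := fun i => by
      rw [slice_tmul, map_smul]
    simp only [hB, map_smul]
    change slice k P ((tensorHom F' (idHom P)) ((assocInv V V P) (v ⊗ₜ[ℂ] B n))) = _
    generalize B n = u
    induction u using TensorProduct.induction_on with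
    | zero => simp
    | add u₁ u₂ h₁ h₂ =>
      simp only [TensorProduct.tmul_add, map_add, h₁, h₂, smul_add, Finset.sum_add_distrib]
    | tmul u p =>
      change coord k ⁅v, u⁆ • p = _
      rw [coord_lie, Finset.sum_smul]
      refine Finset.sum_congr rfl fun i _ => ?_
      rw [Finset.sum_smul]
      refine Finset.sum_congr rfl fun j _ => ?_
      rw [slice_tmul, smul_smul, smul_smul, mul_assoc]

theorem slice_split (i j : Fin 3) (P : Rep) (t : (V ⊠ P : Rep)) :
    slice j P (slice i (V ⊠ P) ((assoc V V P) ((tensorHom F (idHom P)) t))) =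
      -lev i j • slice (third i j) P t := by
  induction t using TensorProduct.induction_on with
  | zero => simp
  | add t₁ t₂ h₁ h₂ => simp only [map_add, h₁, h₂, smul_add]
  | tmul v p =>
    have hF : ∀ k, slice j P (slice i (V ⊠ P) ((assoc V V P) ((tensorHom F (idHom P))
        (e k ⊗ₜ[ℂ] p)))) = -lev i j • slice (third i j) P (e k ⊗ₜ[ℂ] p) := by
      intro k
      change slice j P (slice i (V ⊠ P) ((assoc V V P) (linF (e k) ⊗ₜ[ℂ] p))) = _
      rw [linF_e_eq]
      simp only [TensorProduct.sum_tmul, map_sum, ← TensorProduct.smul_tmul', map_smul]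
      have h : ∀ i' j', slice j P (slice i (V ⊠ P) ((assoc V V P)
          ((e i' ⊗ₜ[ℂ] e j') ⊗ₜ[ℂ] p))) = (coord i (e i') * coord j (e j')) • p := by
        intro i' j'
        change slice j P (slice i (V ⊠ P) (e i' ⊗ₜ[ℂ] (e j' ⊗ₜ[ℂ] p))) = _
        rw [slice_tmul, map_smul, slice_tmul, smul_smul]
      simp only [h, coord_e]
      rw [Finset.sum_eq_single i (fun i' _ hi => by simp [hi.symm]) (by simp),
        Finset.sum_eq_single j (fun j' _ hj => by simp [hj.symm]) (by simp), slice_tmul, coord_e]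
      simp
    have hv := sum_coord_smul_e v
    rw [← hv]
    simp only [TensorProduct.sum_tmul, map_sum, ← TensorProduct.smul_tmul', map_smul, hF,
      Finset.smul_sum]
    refine Finset.sum_congr rfl fun k _ => ?_
    rw [smul_comm]

/-- Forwards, `F'` fuses two letters with coefficient `lev` and `F` splits a letter with coefficient
`-lev`. In `coampl_pullFrom` the two intertwiners exchange roles, and so do the coefficients. -/
theorem TwoEdge.ampl_pullFrom (φ : ∀ E : Rep, E →ₗ[ℂ] ℂ) {x z : X} {γ γ' : T.graph.Walk x z}
    (m : T.TwoEdge γ γ') {M : Rep} (s : SectionFrom γ' M) (w : List (Fin 3)) :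
    ampl φ (m.pullFrom s) w = m.evolve lev (fun i j => -lev i j) (ampl φ s) w := by
  induction m generalizing M w with
  | insert =>
    cases s with
    | cons h A s =>
      cases s with
      | cons h B s =>
        cases w with
        | nil => rfl
        | cons k w =>
          ext v
          simp only [pullFrom, evolve, ampl, LinearMap.coe_comp, Function.comp_apply,
            LinearMap.sum_apply, LinearMap.smul_apply]
          refine (congrArg (ampl φ s w) (slice_fuse k _ _ B.fwd (A.fwd v))).trans ?_
          simp only [map_sum, map_smul]
          rfl
  | delete =>
    cases s with
    | cons h A s =>
      match w with
      | [] => rfl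
      | [_] =>
        ext v
        simp only [pullFrom, evolve, ampl, LinearMap.coe_comp, Function.comp_apply,
          LinearMap.zero_apply]
      | i :: j :: w =>
        ext v
        simp only [pullFrom, evolve, ampl, LinearMap.coe_comp, Function.comp_apply,
          LinearMap.smul_apply]
        refine (congrArg (ampl φ s w) (slice_split i j _ (A.fwd v))).trans ?_
        simp only [map_smul]
        rfl
  | cons h m ih =>
    cases s with
    | cons h A s =>
      cases w with
      | nil => rfl
      | cons i w =>
        simp only [pullFrom, evolve, ampl, ih]
        exact (evolve_map lev (fun i j => -lev i j)
          (LinearMap.lcomp ℂ ℂ ((slice i _).comp A.fwd.toLinearMap)) m (ampl φ s) w).symm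

theorem TwoEdge.coampl_pullFrom (ψ : ∀ E : Rep, E) {x z : X} {γ γ' : T.graph.Walk x z}
    (m : T.TwoEdge γ γ') {M : Rep} (s : SectionFrom γ' M) (w : List (Fin 3)) :
    coampl ψ (m.pullFrom s) w = m.evolve (fun i j => -lev i j) lev (coampl ψ s) w := by
  induction m generalizing M w with
  | insert =>
    cases s with
    | cons h A s =>
      cases s with
      | cons h B s =>
        cases w with
        | nil => rfl
        | cons k w =>
          simp only [pullFrom, evolve, coampl]
          generalize coampl ψ s w = p
          change A.bwd ((tensorHom (idHom V) B.bwd) ((assoc V V _) (linF (e k) ⊗ₜ[ℂ] p))) = _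
          rw [linF_e_eq]
          simp only [TensorProduct.sum_tmul, map_sum, ← TensorProduct.smul_tmul', map_smul]
          rfl
  | delete =>
    cases s with
    | cons h A s =>
      match w with
      | [] => rfl
      | [_] =>
        simp only [pullFrom, evolve, coampl, TensorProduct.tmul_zero, map_zero]
      | i :: j :: w =>
        simp only [pullFrom, evolve, coampl]
        generalize coampl ψ s w = p
        change A.bwd (⁅e i, e j⁆ ⊗ₜ[ℂ] p) = _
        rw [lie_e_e, ← TensorProduct.smul_tmul', map_smul]
  | cons h m ih =>
    cases s with
    | cons h A s =>
      cases w with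
      | nil => rfl
      | cons i w =>
        simp only [pullFrom, evolve, coampl, ih]
        exact (evolve_map (fun i j => -lev i j) lev
          (A.bwd.toLinearMap.comp (TensorProduct.mk ℂ SlTwo _ (e i))) m (coampl ψ s) w).symm

end SphericalTriangulation


/-! ### Phases of the amplitudes -/

/-- The Pauli matrices. -/
def pauli : Fin 3 → Matrix (Fin 2) (Fin 2) ℂ :=
  ![!![0, 1; 1, 0], !![0, -Complex.I; Complex.I, 0], !![1, 0; 0, -1]]

theorem pauli_mul_self (i : Fin 3) : pauli i * pauli i = 1 := by
  fin_cases i <;> simp [pauli, Matrix.one_fin_two]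

theorem pauli_mul (i j : Fin 3) (h : i ≠ j) : pauli i * pauli j = lev i j • pauli (third i j) := by
  rcases eq_or_eq_add i j with rfl | rfl | rfl
  · exact (h rfl).elim
  · rw [lev_add_one, third_add_one]
    fin_cases i <;> simp [pauli]
  · rw [lev_add_two, third_add_two]
    fin_cases i <;> simp [pauli]

theorem lev_mul_self {i j : Fin 3} (h : i ≠ j) : lev i j * lev i j = -1 := by
  rcases eq_or_eq_add i j with rfl | rfl | rfl
  · exact (h rfl).elim
  · rw [lev_add_one, Complex.I_mul_I]
  · rw [lev_add_two, neg_mul_neg, Complex.I_mul_I]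

/-- Coefficients whose phases are governed by the products of the matrices `σ i`. -/
structure Phase (p q : Fin 3 → Fin 3 → ℂ) (σ : Fin 3 → Matrix (Fin 2) (Fin 2) ℂ) : Prop where
  sq : ∀ i, σ i * σ i = 1
  mul : ∀ i j, i ≠ j → σ i * σ j = p i j • σ (third i j)
  inv : ∀ i j, i ≠ j → q i j * p i j = 1
  self_left : ∀ i, p i i = 0
  self_right : ∀ i, q i i = 0

theorem phase_fwd : Phase lev (fun i j => -lev i j) pauli :=
  ⟨pauli_mul_self, pauli_mul, fun i j h => by rw [neg_mul, lev_mul_self h, neg_neg], lev_self,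
    fun i => by simp [lev_self]⟩

/-- Changing the sign of the Pauli matrices changes the sign of their structure constants, as the
backward direction requires. -/
theorem phase_bwd : Phase (fun i j => -lev i j) lev (fun i => -pauli i) :=
  ⟨fun i => by rw [neg_mul_neg, pauli_mul_self],
    fun i j h => by rw [neg_mul_neg, pauli_mul i j h, neg_smul_neg],
    fun i j h => by rw [mul_neg, lev_mul_self h, neg_neg], fun i => by simp [lev_self], lev_self⟩

/-- The coefficients counting proper colourings of the edges of a triangle. -/
def distinct (i j : Fin 3) : ℕ := if i = j then 0 else 1

/-- The amplitudes of the arrows on the base edge. -/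
def baseAmpl {R : Type} [Zero R] (q : Fin 3 → Fin 3 → R) (j k : Fin 3) : List (Fin 3) → R
  | [i] => if third i j = k then q i j else 0
  | _ => 0

theorem Phase.ne_zero {p q : Fin 3 → Fin 3 → ℂ} {σ : Fin 3 → Matrix (Fin 2) (Fin 2) ℂ}
    (h : Phase p q σ) (i : Fin 3) : σ i ≠ 0 := by
  intro h0
  have := h.sq i
  rw [h0, zero_mul] at this
  exact zero_ne_one this

/-- With the end indices `j` and `k` fixed, only the letter `third k j` can contribute, so one
matrix serves for all words. -/
theorem Phase.baseAmpl {p q : Fin 3 → Fin 3 → ℂ} {σ : Fin 3 → Matrix (Fin 2) (Fin 2) ℂ}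
    (h : Phase p q σ) (j k : Fin 3) (w : List (Fin 3)) :
    baseAmpl q j k w • (w.map σ).prod =
      ((baseAmpl distinct j k w : ℕ) : ℂ) • (q (third k j) j • σ (third k j)) := by
  match w with
  | [] => simp [FourColour.baseAmpl]
  | _ :: _ :: _ => simp [FourColour.baseAmpl]
  | [i] =>
    simp only [FourColour.baseAmpl]
    split_ifs with hk
    · have : third k j = i := by revert i j k; decide
      rw [this]
      by_cases hij : i = j
      · subst hij
        simp [h.self_right]
      · simp [distinct, hij]
    · simp

namespace SphericalTriangulation

variable {X : Type} [Fintype X] [DecidableEq X] {T : SphericalTriangulation X}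

/-- The heart of the argument. Replacing `σ i * σ j` by `p i j • σ (third i j)` absorbs precisely
the coefficient of the swept triangle, so every proper colouring contributes the same matrix `C` and
the contributions add up without cancellation. -/
theorem TwoEdge.evolve_phase {p q : Fin 3 → Fin 3 → ℂ} {σ : Fin 3 → Matrix (Fin 2) (Fin 2) ℂ}
    (hp : Phase p q σ) {x z : X} {γ γ' : T.graph.Walk x z} (m : T.TwoEdge γ γ')
    {f : List (Fin 3) → ℂ} {N : List (Fin 3) → ℕ} {C : Matrix (Fin 2) (Fin 2) ℂ}
    (h : ∀ w, f w • (w.map σ).prod = (N w : ℂ) • C) (w : List (Fin 3)) :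
    m.evolve p q f w • (w.map σ).prod = ((m.evolve distinct distinct N w : ℕ) : ℂ) • C := by
  induction m generalizing f N w C with
  | insert =>
    cases w with
    | nil => simp [evolve]
    | cons k w =>
      simp only [evolve, Finset.sum_smul, Nat.cast_sum]
      refine Finset.sum_congr rfl fun i _ => Finset.sum_congr rfl fun j _ => ?_
      split_ifs with hk
      · subst hk
        by_cases hij : i = j
        · subst hij
          simp [hp.self_left, distinct]
        · have := h (i :: j :: w)
          simp only [List.map_cons, List.prod_cons] at this ⊢
          rw [← mul_assoc, hp.mul i j hij] at this
          simp only [distinct, if_neg hij, one_smul]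
          rw [← this]
          simp only [smul_mul_assoc, smul_smul, smul_eq_mul, mul_comm]
      · simp
  | delete =>
    match w with
    | [] => simp [evolve]
    | [_] => simp [evolve]
    | i :: j :: w =>
      by_cases hij : i = j
      · subst hij
        simp [evolve, hp.self_right, distinct]
      · have := h (third i j :: w)
        simp only [evolve, List.map_cons, List.prod_cons, distinct, if_neg hij, one_smul] at this ⊢
        rw [← this, ← mul_assoc, hp.mul i j hij, smul_mul_assoc, smul_smul, smul_eq_mul]
        congr 1
        linear_combination f (third i j :: w) * hp.inv i j hij
  | cons _ m ih =>
    cases w with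
    | nil => simp [evolve]
    | cons i w =>
      -- A letter before the triangle is moved to the other side by `σ i * σ i = 1`; the induction
      -- is then applied with `σ i * C` in place of `C`.
      have hi : ∀ (c : ℂ) (A B : Matrix (Fin 2) (Fin 2) ℂ) (n : ℂ),
          c • A = n • (σ i * B) ↔ c • (σ i * A) = n • B := by
        intro c A B n
        constructor
        · intro e
          rw [← mul_smul_comm, e, mul_smul_comm, ← mul_assoc, hp.sq, one_mul]
        · intro e
          rw [← mul_smul_comm, ← e, mul_smul_comm, ← mul_assoc, hp.sq, one_mul]
      simp only [evolve, List.map_cons, List.prod_cons]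
      rw [← hi]
      refine ih (fun w => ?_) w
      rw [hi]
      simpa using h (i :: w)

variable {a b : X}

namespace TwoPath

/-- The transport along a 2-path of functions on words which counts proper colourings. -/
def evolve : {γ γ' : T.graph.Walk a b} → T.TwoPath γ γ' → (List (Fin 3) → ℕ) → List (Fin 3) → ℕ
  | _, _, .nil _, N => N
  | _, _, .cons m Γ, N => m.evolve distinct distinct (Γ.evolve N)

/-- The action of a 2-path on sections with a given module at the source of the paths. -/
def pullFrom : {γ γ' : T.graph.Walk a b} → T.TwoPath γ γ' → {M : Rep} → SectionFrom γ' M →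
    SectionFrom γ M
  | _, _, .nil _, _, s => s
  | _, _, .cons m Γ, _, s => m.pullFrom (Γ.pullFrom s)

theorem pull_eq {γ γ' : T.graph.Walk a b} (Γ : T.TwoPath γ γ') {M : Rep} (s : SectionFrom γ' M) :
    Γ.pull ⟨M, s⟩ = ⟨M, Γ.pullFrom s⟩ := by
  induction Γ with
  | nil => rfl
  | cons m Γ ih =>
    change m.pull (Γ.pull ⟨M, s⟩) = _
    rw [ih]
    rfl

theorem values_cons {γ γ' γ'' : T.graph.Walk a b} (m : T.TwoEdge γ γ') (Γ : T.TwoPath γ' γ'')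
    {M : Rep} (s : SectionFrom γ'' M) :
    (cons m Γ).values ⟨M, s⟩ = (m.pullFrom (Γ.pullFrom s)).values ++ Γ.values ⟨M, s⟩ := by
  change (m.pull (Γ.pull ⟨M, s⟩)).2.values ++ _ = _
  rw [pull_eq]
  rfl

theorem ampl_phase {γ γ' : T.graph.Walk a b} (Γ : T.TwoPath γ γ') {M : Rep} (s : SectionFrom γ' M)
    (φ : ∀ E : Rep, E →ₗ[ℂ] ℂ) (v : M) {N : List (Fin 3) → ℕ} {C : Matrix (Fin 2) (Fin 2) ℂ}
    (h : ∀ w, ampl φ s w v • (w.map pauli).prod = (N w : ℂ) • C) (w : List (Fin 3)) :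
    ampl φ (Γ.pullFrom s) w v • (w.map pauli).prod = (Γ.evolve N w : ℂ) • C := by
  induction Γ generalizing w with
  | nil => exact h w
  | cons m Γ ih =>
    rw [pullFrom, evolve, ← m.evolve_phase phase_fwd (ih s h) w, m.ampl_pullFrom]
    congr 1
    exact (m.evolve_map lev (fun i j => -lev i j) (LinearMap.applyₗ v) (ampl φ (Γ.pullFrom s))
      w).symm

theorem coampl_phase {γ γ' : T.graph.Walk a b} (Γ : T.TwoPath γ γ') {M : Rep}
    (s : SectionFrom γ' M) (ψ : ∀ E : Rep, E) (l : M →ₗ[ℂ] ℂ) {N : List (Fin 3) → ℕ}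
    {C : Matrix (Fin 2) (Fin 2) ℂ}
    (h : ∀ w, l (coampl ψ s w) • (w.map fun i => -pauli i).prod = (N w : ℂ) • C)
    (w : List (Fin 3)) :
    l (coampl ψ (Γ.pullFrom s) w) • (w.map fun i => -pauli i).prod = (Γ.evolve N w : ℂ) • C := by
  induction Γ generalizing w with
  | nil => exact h w
  | cons m Γ ih =>
    rw [pullFrom, evolve, ← m.evolve_phase phase_bwd (ih s h) w, m.coampl_pullFrom]
    congr 1
    exact (m.evolve_map (fun i j => -lev i j) lev l (coampl ψ (Γ.pullFrom s)) w).symm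

end TwoPath

/-! ### Colourable triangulations -/

/-- The colour of an edge whose ends have the colours `p` and `q`. -/
def edgeColour (p q : Fin 4) : Fin 3 := Fin.ofNat 3 (p.val ^^^ q.val)

/-- Colours add in `(ℤ/2)²` by exclusive or. The three non-zero values are read modulo 3, so that
`3` becomes `0`, and the sum of two distinct ones is the third. -/
theorem edgeColour_spec : ∀ p q r : Fin 4, p ≠ q → q ≠ r → p ≠ r →
    edgeColour p q ≠ edgeColour q r ∧
      third (edgeColour p q) (edgeColour q r) = edgeColour p r := by
  decide

/-- The colours of the edges of a path. -/
def word (c : X → Fin 4) {x y : X} (γ : T.graph.Walk x y) : List (Fin 3) :=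
  (steps γ).map fun d => edgeColour (c d.1) (c d.2)

/-- The counts are natural numbers, so the term of the given colouring cannot be cancelled by the
others. -/
theorem TwoEdge.evolve_word {c : X → Fin 4} (hc : ∀ x y, T.graph.Adj x y → c x ≠ c y) {x z : X}
    {γ γ' : T.graph.Walk x z} (m : T.TwoEdge γ γ') {N : List (Fin 3) → ℕ}
    (h : N (word c γ') ≠ 0) : m.evolve distinct distinct N (word c γ) ≠ 0 := by
  induction m generalizing N with
  | @insert x y z w ht hxy hyz hxz γ =>
    obtain ⟨h1, h2⟩ := edgeColour_spec _ _ _ (hc x y hxy) (hc y z hyz) (hc x z hxz)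
    simp only [word, steps_cons, List.map_cons, evolve] at h ⊢
    intro h0
    have h3 := Finset.sum_eq_zero_iff.1
      (Finset.sum_eq_zero_iff.1 h0 (edgeColour (c x) (c y)) (Finset.mem_univ _))
      (edgeColour (c y) (c z)) (Finset.mem_univ _)
    rw [if_pos h2, distinct, if_neg h1, one_smul] at h3
    exact h h3
  | @delete x y z w ht hxy hyz hxz γ =>
    obtain ⟨h1, h2⟩ := edgeColour_spec _ _ _ (hc x y hxy) (hc y z hyz) (hc x z hxz)
    simp only [word, steps_cons, List.map_cons, evolve] at h ⊢
    rw [distinct, if_neg h1, h2, one_smul]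
    exact h
  | cons hxy m ih => exact ih h

theorem TwoPath.evolve_word {c : X → Fin 4} (hc : ∀ x y, T.graph.Adj x y → c x ≠ c y)
    {γ γ' : T.graph.Walk a b} (Γ : T.TwoPath γ γ') {N : List (Fin 3) → ℕ}
    (h : N (word c γ') ≠ 0) : Γ.evolve N (word c γ) ≠ 0 := by
  induction Γ with
  | nil => exact h
  | cons m Γ ih => exact m.evolve_word hc (ih h)

theorem TwoPath.fwd_ne_zero {c : X → Fin 4} (hc : ∀ x y, T.graph.Adj x y → c x ≠ c y)
    {γ γ' : T.graph.Walk a b} (Γ : T.TwoPath γ γ') {M : Rep} (s : SectionFrom γ' M)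
    (φ : ∀ E : Rep, E →ₗ[ℂ] ℂ) (v : M) {N : List (Fin 3) → ℕ} {C : Matrix (Fin 2) (Fin 2) ℂ}
    (h : ∀ w, ampl φ s w v • (w.map pauli).prod = (N w : ℂ) • C) (hC : C ≠ 0)
    (hN : N (word c γ') ≠ 0) : ∀ u ∈ Γ.values ⟨M, s⟩, u.arrows.fwd ≠ 0 := by
  -- Proved for every 2-path with this end, so as to apply to all the tails `Γ_p` at once.
  have key : ∀ γ (Γ : T.TwoPath γ γ'), ampl φ (Γ.pullFrom s) (word c γ) ≠ 0 := by
    intro γ Γ h0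
    have h1 := Γ.ampl_phase s φ v h (word c γ)
    rw [h0, LinearMap.zero_apply, zero_smul] at h1
    have h2 := (smul_eq_zero.1 h1.symm).resolve_right hC
    exact Γ.evolve_word hc hN (by exact_mod_cast h2)
  induction Γ with
  | nil γ => exact ampl_ne_zero s _ (key γ (.nil γ))
  | cons m Γ ih =>
    intro u hu
    rw [values_cons, List.mem_append] at hu
    rcases hu with hu | hu
    · exact ampl_ne_zero _ _ (key _ (.cons m Γ)) u hu
    · exact ih s h hN key u hu

theorem TwoPath.bwd_ne_zero {c : X → Fin 4} (hc : ∀ x y, T.graph.Adj x y → c x ≠ c y)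
    {γ γ' : T.graph.Walk a b} (Γ : T.TwoPath γ γ') {M : Rep} (s : SectionFrom γ' M)
    (ψ : ∀ E : Rep, E) (l : M →ₗ[ℂ] ℂ) {N : List (Fin 3) → ℕ} {C : Matrix (Fin 2) (Fin 2) ℂ}
    (h : ∀ w, l (coampl ψ s w) • (w.map fun i => -pauli i).prod = (N w : ℂ) • C) (hC : C ≠ 0)
    (hN : N (word c γ') ≠ 0) : ∀ u ∈ Γ.values ⟨M, s⟩, u.arrows.bwd ≠ 0 := by
  have key : ∀ γ (Γ : T.TwoPath γ γ'), coampl ψ (Γ.pullFrom s) (word c γ) ≠ 0 := by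
    intro γ Γ h0
    have h1 := Γ.coampl_phase s ψ l h (word c γ)
    rw [h0, map_zero, zero_smul] at h1
    have h2 := (smul_eq_zero.1 h1.symm).resolve_right hC
    exact Γ.evolve_word hc hN (by exact_mod_cast h2)
  induction Γ with
  | nil γ => exact coampl_ne_zero s _ (key γ (.nil γ))
  | cons m Γ ih =>
    intro u hu
    rw [values_cons, List.mem_append] at hu
    rcases hu with hu | hu
    · exact coampl_ne_zero _ _ (key _ (.cons m Γ)) u hu
    · exact ih s h hN key u hu

open Classical in
/-- A coordinate of `V`, extended by zero to all the representations. -/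
def endCoord (j : Fin 3) (E : Rep) : E →ₗ[ℂ] ℂ :=
  if h : V = E then h ▸ coord j else 0

open Classical in
/-- A basis vector of `V`, extended by zero to all the representations. -/
def endVec (j : Fin 3) (E : Rep) : E :=
  if h : V = E then h ▸ e j else 0

/-- The type of a section does not record its end module, so `ampl` needs a functional on every
representation. Only the value at `V` matters, because all the sections concerned end with `V`. -/
theorem endCoord_V (j : Fin 3) : endCoord j V = coord j := by
  rw [endCoord, dif_pos rfl]

theorem endVec_V (j : Fin 3) : endVec j V = e j := by
  rw [endVec, dif_pos rfl]

theorem ampl_base (h : T.graph.Adj a b) (j k : Fin 3) (w : List (Fin 3)) :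
    ampl (endCoord j) (baseSection h).2 w (e k) = baseAmpl (fun i j => -lev i j) j k w := by
  match w with
  | [] => rfl
  | _ :: _ :: _ => rfl
  | [i] =>
    change endCoord j V (slice i V (linF (e k))) = _
    rw [endCoord_V, linF_e_eq]
    have hs : ∀ i' j', slice i V (e i' ⊗ₜ[ℂ] e j') = coord i (e i') • e j' := fun _ _ => rfl
    simp only [map_sum, map_smul, hs, coord_e]
    rw [Finset.sum_eq_single i (fun i' _ hi => by simp [hi.symm]) (by simp),
      Finset.sum_eq_single j (fun j' _ hj => by simp [hj.symm]) (by simp)]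
    simp [baseAmpl]

theorem coampl_base (h : T.graph.Adj a b) (j k : Fin 3) (w : List (Fin 3)) :
    coord k (coampl (endVec j) (baseSection h).2 w) = baseAmpl lev j k w := by
  match w with
  | [] => exact map_zero (coord k)
  | _ :: _ :: _ =>
    change coord k (F' (e _ ⊗ₜ[ℂ] (0 : SlTwo))) = 0
    rw [TensorProduct.tmul_zero, map_zero]
    exact map_zero _
  | [i] =>
    change coord k (F' (e i ⊗ₜ[ℂ] endVec j V)) = _
    rw [endVec_V]
    change coord k ⁅e i, e j⁆ = _
    rw [lie_e_e, map_smul, coord_e]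
    simp only [baseAmpl, smul_eq_mul, mul_ite, mul_one, mul_zero, eq_comm (a := k)]

/-- The global section of a colourable triangulation vanishes on no edge. -/
theorem SweepingLoop.nonVanishing {c : X → Fin 4} (hc : ∀ x y, T.graph.Adj x y → c x ≠ c y)
    (Γ : T.SweepingLoop) : Γ.NonVanishing := by
  -- The end indices are chosen so that the only word counted at the base is the colour of the base
  -- edge.
  obtain ⟨j, k, hkj, hk', hk⟩ : ∃ j k, third k j ≠ j ∧ third (third k j) j = k ∧
      third k j = edgeColour (c Γ.a) (c Γ.b) := by
    generalize edgeColour _ _ = i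
    revert i
    decide
  have hN : baseAmpl distinct j k (word c Γ.adj.toWalk) ≠ 0 := by
    have : word c Γ.adj.toWalk = [third k j] := by rw [hk]; rfl
    rw [this, baseAmpl, if_pos hk', distinct, if_neg hkj]
    exact one_ne_zero
  have hlev : lev (third k j) j ≠ 0 := fun h0 => by
    have := lev_mul_self hkj
    simp [h0] at this
  intro u hu
  constructor
  · refine Γ.loop.fwd_ne_zero hc (baseSection Γ.adj).2 (endCoord j) (e k) (fun w => ?_)
      (smul_ne_zero (neg_ne_zero.2 hlev) (phase_fwd.ne_zero (third k j))) hN u hu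
    rw [← phase_fwd.baseAmpl, ← ampl_base Γ.adj]
  · refine Γ.loop.bwd_ne_zero hc (baseSection Γ.adj).2 (endVec j) (coord k) (fun w => ?_)
      (smul_ne_zero hlev (phase_bwd.ne_zero (third k j))) hN u hu
    rw [← phase_bwd.baseAmpl, ← coampl_base Γ.adj]
    rfl

end SphericalTriangulation

namespace SphericalTriangulation

variable {X : Type} [Fintype X] [DecidableEq X] {T : SphericalTriangulation X} {a b : X}

/-! ### Edge colourings from the amplitudes -/

/-- The edges of the triangle `t` have distinct colours. -/
def IsProper (χ : Sym2 X → Fin 3) (t : Finset X) : Prop :=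
  ∀ x ∈ t, ∀ y ∈ t, ∀ z ∈ t, x ≠ y → y ≠ z → x ≠ z → χ s(x, y) ≠ χ s(y, z)

theorem isProper_triple {χ : Sym2 X → Fin 3} {x y z : X} (h1 : χ s(x, y) ≠ χ s(y, z))
    (h2 : χ s(y, z) ≠ χ s(x, z)) (h3 : χ s(x, y) ≠ χ s(x, z)) : IsProper χ {x, y, z} := by
  intro u hu v hv w hw huv hvw huw
  simp only [Finset.mem_insert, Finset.mem_singleton] at hu hv hw
  have hs : ∀ p q, χ s(p, q) = χ s(q, p) := fun p q => congrArg χ Sym2.eq_swap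
  have e1 := hs x y
  have e2 := hs y z
  have e3 := hs x z
  clear hs
  grind

theorem pair_subset {x y : X} {t : Finset X} (hx : x ∈ t) (hy : y ∈ t) : s(x, y).toFinset ⊆ t := by
  rw [Sym2.toFinset_mk_eq]
  simp [Finset.insert_subset_iff, hx, hy]

theorem third_spec : ∀ i j : Fin 3, i ≠ j → third i j ≠ i ∧ third i j ≠ j := by decide

theorem exists_of_evolve_insert {N : List (Fin 3) → ℕ} {k : Fin 3} {w : List (Fin 3)}
    (h : ∑ i, ∑ j, (if third i j = k then distinct i j else 0) • N (i :: j :: w) ≠ 0) :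
    ∃ i j, i ≠ j ∧ third i j = k ∧ N (i :: j :: w) ≠ 0 := by
  obtain ⟨i, _, hi⟩ := Finset.exists_ne_zero_of_sum_ne_zero h
  obtain ⟨j, _, hj⟩ := Finset.exists_ne_zero_of_sum_ne_zero hi
  have h1 := left_ne_zero_of_smul hj
  have h2 := right_ne_zero_of_smul hj
  by_cases hk : third i j = k
  · refine ⟨i, j, fun e => h1 ?_, hk, h2⟩
    rw [if_pos hk, distinct, if_pos e]
  · rw [if_neg hk] at h1
    exact (h1 rfl).elim

theorem of_evolve_delete {N : List (Fin 3) → ℕ} {i j : Fin 3} {w : List (Fin 3)}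
    (h : distinct i j • N (third i j :: w) ≠ 0) : i ≠ j ∧ N (third i j :: w) ≠ 0 := by
  refine ⟨fun e => left_ne_zero_of_smul h ?_, right_ne_zero_of_smul h⟩
  rw [distinct, if_pos e]

theorem map_update_of_notMem {A B : Type} [DecidableEq A] (χ : A → B) (e : A) (k : B) (l : List A)
    (h : e ∉ l) : l.map (Function.update χ e k) = l.map χ :=
  List.map_congr_left fun _ hx => Function.update_of_ne (by rintro rfl; exact h hx) _ _

/-- An edge colouring extends across a triangle of which the preceding path uses edges once. -/
theorem TwoEdge.exists_colouring {x z : X} {γ γ' : T.graph.Walk x z} (m : T.TwoEdge γ γ')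
    {N : List (Fin 3) → ℕ} {w : List (Fin 3)} (h : m.evolve distinct distinct N w ≠ 0)
    (hc : ∀ e ∈ γ.edges, e.toFinset ⊆ m.triangle → γ.edges.count e ≤ 1) :
    ∃ w', N w' ≠ 0 ∧ ∀ χ' : Sym2 X → Fin 3, γ'.edges.map χ' = w' →
      ∃ χ, γ.edges.map χ = w ∧ IsProper χ m.triangle ∧
        ∀ e, χ e ≠ χ' e → e ∈ γ.edges ∧ e.toFinset ⊆ m.triangle := by
  induction m generalizing N w with
  | @insert x y z v ht hxy hyz hxz γ =>
    cases w with
    | nil => exact (h rfl).elim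
    | cons k w =>
      obtain ⟨i, j, hij, rfl, hN⟩ := exists_of_evolve_insert h
      refine ⟨_, hN, fun χ' hχ' => ?_⟩
      simp only [SimpleGraph.Walk.edges_cons, List.map_cons, List.cons.injEq] at hχ' hc ⊢
      obtain ⟨h1, h2, h3⟩ := hχ'
      -- The edge to be recoloured does not recur later on the path, so the rest of the word is
      -- unaffected.
      have hnot : s(x, z) ∉ γ.edges := by
        intro hm
        have := hc s(x, z) (by simp) (pair_subset (by simp [triangle]) (by simp [triangle]))
        rw [List.count_cons_self] at this
        have := List.count_pos_iff.2 hm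
        omega
      have n1 : s(x, y) ≠ s(x, z) := by simp [hyz.1, hxz.1]
      have n2 : s(y, z) ≠ s(x, z) := by simp [hxy.1.symm, hyz.1]
      refine ⟨Function.update χ' s(x, z) (third i j), ⟨by simp, ?_⟩, ?_, ?_⟩
      · rw [map_update_of_notMem _ _ _ _ hnot, h3]
      · have := third_spec i j hij
        refine isProper_triple ?_ ?_ ?_
        · rw [Function.update_of_ne n1, Function.update_of_ne n2, h1, h2]
          exact hij
        · rw [Function.update_self, Function.update_of_ne n2, h2]
          exact this.2.symm
        · rw [Function.update_self, Function.update_of_ne n1, h1]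
          exact this.1.symm
      · intro e he
        have : e = s(x, z) := by
          by_contra hne
          exact he (Function.update_of_ne hne _ _)
        subst this
        exact ⟨by simp, pair_subset (by simp [triangle]) (by simp [triangle])⟩
  | @delete x y z v ht hxy hyz hxz γ =>
    match w with
    | [] => exact (h rfl).elim
    | [_] => exact (h rfl).elim
    | i :: j :: w =>
      obtain ⟨hij, hN⟩ := of_evolve_delete h
      refine ⟨_, hN, fun χ' hχ' => ?_⟩
      simp only [SimpleGraph.Walk.edges_cons, List.map_cons, List.cons.injEq] at hχ' hc ⊢
      obtain ⟨h1, h3⟩ := hχ'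
      have n1 : s(x, z) ≠ s(x, y) := by simp [hyz.1.symm, hxy.1]
      have n2 : s(x, z) ≠ s(y, z) := by simp [hxy.1, hxz.1]
      have n3 : s(x, y) ≠ s(y, z) := by simp [hxy.1, hxz.1]
      have hnot1 : s(x, y) ∉ γ.edges := by
        intro hm
        have := hc s(x, y) (by simp) (pair_subset (by simp [triangle]) (by simp [triangle]))
        rw [List.count_cons_self, List.count_cons_of_ne n3.symm] at this
        have := List.count_pos_iff.2 hm
        omega
      have hnot2 : s(y, z) ∉ γ.edges := by
        intro hm
        have := hc s(y, z) (by simp) (pair_subset (by simp [triangle]) (by simp [triangle]))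
        rw [List.count_cons_of_ne n3, List.count_cons_self] at this
        have := List.count_pos_iff.2 hm
        omega
      refine ⟨Function.update (Function.update χ' s(x, y) i) s(y, z) j, ⟨?_, by simp, ?_⟩, ?_, ?_⟩
      · rw [Function.update_of_ne n3, Function.update_self]
      · rw [map_update_of_notMem _ _ _ _ hnot2, map_update_of_notMem _ _ _ _ hnot1, h3]
      · have := third_spec i j hij
        refine isProper_triple ?_ ?_ ?_
        · rw [Function.update_self, Function.update_of_ne n3, Function.update_self]
          exact hij
        · rw [Function.update_self, Function.update_of_ne n2, Function.update_of_ne n1, h1]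
          exact this.2.symm
        · rw [Function.update_of_ne n3, Function.update_self, Function.update_of_ne n2,
            Function.update_of_ne n1, h1]
          exact this.1.symm
      · intro e he
        have : e = s(x, y) ∨ e = s(y, z) := by
          by_contra hne
          rw [not_or] at hne
          exact he (by rw [Function.update_of_ne hne.2, Function.update_of_ne hne.1])
        rcases this with rfl | rfl
        · exact ⟨by simp, pair_subset (by simp [triangle]) (by simp [triangle])⟩
        · exact ⟨by simp, pair_subset (by simp [triangle]) (by simp [triangle])⟩
  | @cons x y v hxy γ γ' m ih =>
    cases w with
    | nil => exact (h rfl).elim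
    | cons i w =>
      simp only [SimpleGraph.Walk.edges_cons] at hc
      obtain ⟨w', hw', hχ⟩ := ih (N := fun w => N (i :: w)) h (fun e he hs =>
        le_trans (by rw [List.count_cons]; omega) (hc e (List.mem_cons_of_mem _ he) hs))
      refine ⟨_, hw', fun χ' hχ' => ?_⟩
      simp only [SimpleGraph.Walk.edges_cons, List.map_cons, List.cons.injEq] at hχ' ⊢
      obtain ⟨χ, h1, h2, h3⟩ := hχ χ' hχ'.2
      refine ⟨χ, ⟨?_, h1⟩, h2, fun e he => ⟨List.mem_cons_of_mem _ (h3 e he).1, (h3 e he).2⟩⟩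
      rw [← hχ'.1]
      by_contra hne
      obtain ⟨h4, h5⟩ := h3 _ hne
      have := hc _ List.mem_cons_self h5
      rw [List.count_cons_self] at this
      have := List.count_pos_iff.2 h4
      omega

/-- A path acquires an edge only by sweeping a triangle which contains it. Hence the occurrences of
`e` on the path plus the triangles at `e` still to be swept never increase in number. -/
theorem TwoEdge.count_le {x z : X} {γ γ' : T.graph.Walk x z} (m : T.TwoEdge γ γ') (e : Sym2 X) :
    γ'.edges.count e ≤ γ.edges.count e + if e.toFinset ⊆ m.triangle then 1 else 0 := by
  induction m with
  | @insert x y z v ht hxy hyz hxz γ =>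
    have n3 : s(x, y) ≠ s(y, z) := by simp [hxy.1, hxz.1]
    simp only [SimpleGraph.Walk.edges_cons]
    by_cases h1 : e = s(x, y)
    · subst h1
      rw [List.count_cons_self, List.count_cons_of_ne n3.symm, List.count_cons,
        if_pos (pair_subset (by simp [triangle]) (by simp [triangle]))]
      omega
    · by_cases h2 : e = s(y, z)
      · subst h2
        rw [List.count_cons_of_ne n3, List.count_cons_self, List.count_cons,
          if_pos (pair_subset (by simp [triangle]) (by simp [triangle]))]
        omega
      · rw [List.count_cons_of_ne (Ne.symm h1), List.count_cons_of_ne (Ne.symm h2), List.count_cons]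
        omega
  | @delete x y z v ht hxy hyz hxz γ =>
    simp only [SimpleGraph.Walk.edges_cons]
    by_cases h1 : e = s(x, z)
    · subst h1
      have hs : s(x, z).toFinset ⊆ (TwoEdge.delete ht hxy hyz hxz γ).triangle :=
        pair_subset (by simp [triangle]) (by simp [triangle])
      rw [List.count_cons_self, List.count_cons, List.count_cons, if_pos hs]
      omega
    · rw [List.count_cons_of_ne (Ne.symm h1), List.count_cons, List.count_cons]
      omega
  | cons h m ih =>
    simp only [SimpleGraph.Walk.edges_cons, List.count_cons]
    rw [show (TwoEdge.cons h m).triangle = m.triangle from rfl]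
    omega

/-- A path with one edge can only be changed by an insertion, which removes that edge from the path.
-/
theorem TwoEdge.of_length_one {x z : X} {γ γ' : T.graph.Walk x z} (m : T.TwoEdge γ γ')
    (h : γ.length = 1) {e : Sym2 X} (he : e ∈ γ.edges) :
    γ'.edges.count e = 0 ∧ e.toFinset ⊆ m.triangle := by
  cases m with
  | @insert x y z v ht hxy hyz hxz γ =>
    cases γ with
    | nil =>
      simp only [SimpleGraph.Walk.edges_cons, SimpleGraph.Walk.edges_nil, List.mem_singleton] at he
      subst he
      refine ⟨List.count_eq_zero.2 ?_, pair_subset (by simp [triangle]) (by simp [triangle])⟩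
      simp [hyz.1.symm, hxy.1, hxz.1]
    | cons => simp at h
  | delete => simp at h
  | cons hxy m =>
    cases m <;> simp at h

theorem TwoEdge.triangle_mem {x z : X} {γ γ' : T.graph.Walk x z} (m : T.TwoEdge γ γ') :
    m.triangle ∈ T.triangles := by
  induction m with
  | insert ht => exact ht
  | delete ht => exact ht
  | cons _ _ ih => exact ih

theorem TwoPath.mem_of_mem_swept {γ γ' : T.graph.Walk a b} (Γ : T.TwoPath γ γ') {t : Finset X}
    (h : t ∈ Γ.swept) : t ∈ T.triangles := by
  induction Γ with
  | nil => simp [swept] at h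
  | cons m Γ ih =>
    rcases List.mem_cons.1 h with rfl | h
    · exact m.triangle_mem
    · exact ih h

/-- The number of triangles containing the edge `e` which are swept by a 2-path. -/
def TwoPath.sweptAt {γ γ' : T.graph.Walk a b} (Γ : T.TwoPath γ γ') (e : Sym2 X) : ℕ :=
  Γ.swept.countP (e.toFinset ⊆ ·)

theorem TwoPath.sweptAt_cons {γ γ' γ'' : T.graph.Walk a b} (m : T.TwoEdge γ γ')
    (Γ : T.TwoPath γ' γ'') (e : Sym2 X) :
    (cons m Γ).sweptAt e = Γ.sweptAt e + if e.toFinset ⊆ m.triangle then 1 else 0 := by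
  change (m.triangle :: Γ.swept).countP _ = _
  rw [List.countP_cons]
  simp [sweptAt]

theorem SweepingLoop.sweptAt_eq (Γ : T.SweepingLoop) {e : Sym2 X} (he : e ∈ T.graph.edgeSet) :
    Γ.loop.sweptAt e = 2 := by
  have hperm : Γ.loop.swept.Perm T.triangles.toList := by
    rw [List.perm_iff_count]
    intro t
    by_cases ht : t ∈ T.triangles
    · rw [Γ.once t ht, List.count_eq_one_of_mem (Finset.nodup_toList _) (Finset.mem_toList.2 ht)]
    · rw [List.count_eq_zero_of_not_mem (fun h => ht (Γ.loop.mem_of_mem_swept h)),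
        List.count_eq_zero_of_not_mem (fun h => ht (Finset.mem_toList.1 h))]
  rw [TwoPath.sweptAt, hperm.countP_eq]
  induction e with
  | _ x y =>
    rw [← T.closed {x, y} (T.mem_edgesOf he), Finset.card_def, Finset.filter_val,
      ← Multiset.countP_eq_card_filter, ← Finset.coe_toList, Multiset.coe_countP,
      Sym2.toFinset_mk_eq]

/-- The colouring is built from the end of the path backwards. When a triangle with an edge `e` of
`γ` is swept, the bound 2 leaves no later triangle at `e`, so recolouring `e` spoils nothing already
done. The stricter bound 1 at the base edge keeps its final colour `i` untouched. -/
theorem TwoPath.exists_colouring {γ γ' : T.graph.Walk a b} (Γ : T.TwoPath γ γ')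
    (hγ' : γ'.edges = [s(a, b)]) {N : List (Fin 3) → ℕ} {i : Fin 3} (hN : ∀ w, N w ≠ 0 → w = [i])
    (hc : ∀ e ∈ T.graph.edgeSet, e ≠ s(a, b) → γ.edges.count e + Γ.sweptAt e ≤ 2)
    (hab : γ.edges.count s(a, b) + Γ.sweptAt s(a, b) ≤ 1) {w : List (Fin 3)}
    (hw : Γ.evolve N w ≠ 0) :
    ∃ χ : Sym2 X → Fin 3, γ.edges.map χ = w ∧ χ s(a, b) = i ∧ ∀ t ∈ Γ.swept, IsProper χ t := by
  induction Γ generalizing w with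
  | nil =>
    refine ⟨fun _ => i, ?_, rfl, by simp [swept]⟩
    rw [hγ', hN w hw]
    rfl
  | @cons γ γ' γ'' m Γ ih =>
    have hfresh : ∀ e ∈ γ.edges, e.toFinset ⊆ m.triangle →
        γ.edges.count e ≤ 1 ∧ e ≠ s(a, b) ∧ Γ.sweptAt e = 0 := by
      intro e he hs
      have h1 := List.count_pos_iff.2 he
      have h2 : e ≠ s(a, b) := by
        rintro rfl
        rw [sweptAt_cons, if_pos hs] at hab
        omega
      have h3 := hc e (SimpleGraph.Walk.edges_subset_edgeSet _ he) h2
      rw [sweptAt_cons, if_pos hs] at h3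
      exact ⟨by omega, h2, by omega⟩
    obtain ⟨w', hw', hχ⟩ := m.exists_colouring hw fun e he hs => (hfresh e he hs).1
    obtain ⟨χ', h1, h2, h3⟩ := ih hγ' (fun e he hne => by
        have h1 := hc e he hne
        have h2 := m.count_le e
        rw [sweptAt_cons] at h1
        omega) (by
        have h2 := m.count_le s(a, b)
        rw [sweptAt_cons] at hab
        omega) hw'
    obtain ⟨χ, h4, h5, h6⟩ := hχ χ' h1
    refine ⟨χ, h4, ?_, ?_⟩
    · rw [← h2]
      by_contra hne
      obtain ⟨h7, h8⟩ := h6 _ hne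
      exact (hfresh _ h7 h8).2.1 rfl
    · intro t ht
      rcases List.mem_cons.1 ht with rfl | ht
      · exact h5
      · have hsame : ∀ x ∈ t, ∀ y ∈ t, χ s(x, y) = χ' s(x, y) := by
          intro x hx y hy
          by_contra hne
          obtain ⟨h7, h8⟩ := h6 _ hne
          have h9 := (hfresh _ h7 h8).2.2
          rw [sweptAt, List.countP_eq_zero] at h9
          refine h9 t ht ?_
          rw [Sym2.toFinset_mk_eq]
          simp [Finset.insert_subset_iff, hx, hy]
        intro x hx y hy z hz hxy hyz hxz
        rw [hsame x hx y hy, hsame y hy z hz]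
        exact h3 t ht x hx y hy z hz hxy hyz hxz

/-- The identification of the three colours with the non-zero elements of `(ℤ/2)²`. -/
def bits : Fin 3 → ZMod 2 × ZMod 2 := ![(1, 0), (0, 1), (1, 1)]

theorem bits_add : ∀ i j : Fin 3, i ≠ j → bits i + bits j = bits (third i j) := by decide

theorem bits_injective : Function.Injective bits := by decide

theorem bits_ne_zero : ∀ i, bits i ≠ 0 := by decide

theorem bits_add_add : ∀ i j k : Fin 3, i ≠ j → j ≠ k → i ≠ k → bits i + bits j + bits k = 0 := by
  decide

/-- The sum of the colours of a word in `(ℤ/2)²` is conserved, because distinct colours add up to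
the third one. This forces the two values on the base edge to have the same colour. -/
theorem TwoEdge.evolve_bits {x z : X} {γ γ' : T.graph.Walk x z} (m : T.TwoEdge γ γ')
    {N : List (Fin 3) → ℕ} {κ : ZMod 2 × ZMod 2} (hN : ∀ w, N w ≠ 0 → (w.map bits).sum = κ)
    {w : List (Fin 3)} (h : m.evolve distinct distinct N w ≠ 0) : (w.map bits).sum = κ := by
  induction m generalizing N κ w with
  | insert =>
    cases w with
    | nil => exact (h rfl).elim
    | cons k w =>
      obtain ⟨i, j, hij, rfl, h'⟩ := exists_of_evolve_insert h
      rw [← hN _ h']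
      simp [← bits_add i j hij, add_assoc]
  | delete =>
    match w with
    | [] => exact (h rfl).elim
    | [_] => exact (h rfl).elim
    | i :: j :: w =>
      obtain ⟨hij, h'⟩ := of_evolve_delete h
      rw [← hN _ h']
      simp [← bits_add i j hij, add_assoc]
  | cons hxy m ih =>
    cases w with
    | nil => exact (h rfl).elim
    | cons i w =>
      have := ih (N := fun w => N (i :: w)) (κ := κ - bits i) (fun w hw => by
        rw [← hN _ hw]; simp) h
      simp [this]

theorem TwoPath.evolve_bits {γ γ' : T.graph.Walk a b} (Γ : T.TwoPath γ γ')
    {N : List (Fin 3) → ℕ} {κ : ZMod 2 × ZMod 2} (hN : ∀ w, N w ≠ 0 → (w.map bits).sum = κ)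
    {w : List (Fin 3)} (h : Γ.evolve N w ≠ 0) : (w.map bits).sum = κ := by
  induction Γ generalizing w with
  | nil => exact hN w h
  | cons m Γ ih => exact m.evolve_bits (fun w hw => ih hw) h

/-- The base edge occurs both on the first and on the last path, so the first move is treated apart.
After it the base edge is off the path and only one triangle at it remains, as
`TwoPath.exists_colouring` requires. -/
theorem SweepingLoop.exists_edgeColouring (Γ : T.SweepingLoop) {N : List (Fin 3) → ℕ} {i j : Fin 3}
    (hN : ∀ w, N w ≠ 0 → w = [i]) (h : Γ.loop.evolve N [j] ≠ 0) :
    ∃ χ : Sym2 X → Fin 3, ∀ t ∈ T.triangles, IsProper χ t := by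
  have hij : j = i := by
    have := Γ.loop.evolve_bits (κ := bits i) (fun w hw => by rw [hN w hw]; simp) h
    exact bits_injective (by simpa using this)
  subst hij
  have hswept := fun e he => Γ.sweptAt_eq (e := e) he
  have hmem : ∀ t ∈ T.triangles, t ∈ Γ.loop.swept := fun t ht =>
    List.count_pos_iff.1 (by rw [Γ.once t ht]; exact one_pos)
  obtain ⟨a, b, adj, loop, once⟩ := Γ
  dsimp only at h hswept hmem
  have hE : adj.toWalk.edges = [s(a, b)] := rfl
  have hL : adj.toWalk.length = 1 := rfl
  suffices H : ∀ (γ γ' : T.graph.Walk a b) (loop : T.TwoPath γ γ'), γ.edges = [s(a, b)] →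
      γ'.edges = [s(a, b)] → γ.length = 1 → loop.evolve N [j] ≠ 0 →
      (∀ e ∈ T.graph.edgeSet, loop.sweptAt e = 2) → ∃ χ, ∀ t ∈ loop.swept, IsProper χ t by
    obtain ⟨χ, hχ⟩ := H _ _ loop hE hE hL h hswept
    exact ⟨χ, fun t ht => hχ t (hmem t ht)⟩
  clear h hswept hmem once hE hL loop
  intro γ γ' loop hE hE' hL h hswept
  have habE : s(a, b) ∈ T.graph.edgeSet := adj
  cases loop with
  | nil =>
    have := hswept _ habE
    simp [TwoPath.sweptAt, TwoPath.swept] at this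
  | @cons _ γ₁ _ m Γ =>
    obtain ⟨h1, h2⟩ := m.of_length_one hL (e := s(a, b)) (by simp [hE])
    obtain ⟨w', hw', hχ⟩ := m.exists_colouring h (fun e he _ => by
      rw [hE] at he ⊢
      rw [List.mem_singleton.1 he]
      simp)
    obtain ⟨χ', h3, h4, h5⟩ := Γ.exists_colouring hE' hN (fun e he hne => by
        have h6 := hswept e he
        have h7 := m.count_le e
        rw [TwoPath.sweptAt_cons] at h6
        rw [hE, List.count_cons_of_ne hne.symm, List.count_nil] at h7
        omega) (by
        have h6 := hswept _ habE
        rw [TwoPath.sweptAt_cons, if_pos h2] at h6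
        omega) hw'
    obtain ⟨χ, h6, h7, h8⟩ := hχ χ' h3
    -- The first move could recolour only the base edge, and conservation of the sum gives it the
    -- colour it already has.
    have : χ = χ' := by
      funext e
      by_contra hne
      have h9 := (h8 e hne).1
      rw [hE, List.mem_singleton] at h9
      subst h9
      rw [hE] at h6
      simp only [List.map_cons, List.map_nil, List.cons.injEq, and_true] at h6
      exact hne (h6.trans h4.symm)
    subst this
    refine ⟨χ, fun t ht => ?_⟩
    rcases List.mem_cons.1 ht with rfl | ht
    · exact h7
    · exact h5 t ht

/-- A proper colouring of the edges with three colours yields one of the vertices with four. -/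
theorem exists_vertexColouring {χ : Sym2 X → Fin 3} (hχ : ∀ t ∈ T.triangles, IsProper χ t) :
    ∃ c : X → Fin 4, ∀ x y, T.graph.Adj x y → c x ≠ c y := by
  have hsum : ∀ x y z, x ≠ y → z ∈ T.apex {x, y} →
      bits (χ s(x, y)) + bits (χ s(y, z)) + bits (χ s(z, x)) = 0 := by
    intro x y z hxy hz
    obtain ⟨h1, h2, h3⟩ := T.adj_of_apex hxy hz
    have ht := hχ _ (T.mem_apex.1 hz).2
    have hx : x ∈ insert z ({x, y} : Finset X) := by simp
    have hy : y ∈ insert z ({x, y} : Finset X) := by simp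
    have hz : z ∈ insert z ({x, y} : Finset X) := by simp
    refine bits_add_add _ _ _ (ht x hx y hy z hz hxy h2.1 h3.1.symm)
      (ht y hy z hz x hx h2.1 h3.1 hxy.symm) ?_
    exact (ht z hz x hx y hy h3.1 hxy h2.1.symm).symm
  -- The three distinct colours of a triangle sum to zero in `(ℤ/2)²`, so each bit is a cocycle. The
  -- pair of potentials is a vertex colouring whose difference along an edge is a non-zero element.
  obtain ⟨p, hp⟩ := T.exists_potential_of_cocycle (fun e => (bits (χ e)).1)
    fun x y z hxy hz => congrArg Prod.fst (hsum x y z hxy hz)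
  obtain ⟨q, hq⟩ := T.exists_potential_of_cocycle (fun e => (bits (χ e)).2)
    fun x y z hxy hz => congrArg Prod.snd (hsum x y z hxy hz)
  have hcard : Fintype.card (ZMod 2 × ZMod 2) = 4 := by decide
  let E := Fintype.equivFinOfCardEq hcard
  refine ⟨fun x => E (p x, q x), fun x y h e => bits_ne_zero (χ s(x, y)) ?_⟩
  have e' := E.injective e
  rw [Prod.mk.injEq] at e'
  have h2 : ∀ a : ZMod 2, a + a = 0 := by decide
  refine Prod.ext ?_ ?_
  · rw [← hp x y h, e'.1, h2]; rfl
  · rw [← hq x y h, e'.2, h2]; rfl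

end SphericalTriangulation

/-! ### From non-vanishing sections to colourings -/

variable {X : Type}

/-- The module of a section at the end of the path. -/
def SectionFrom.endMod {G : SimpleGraph X} : {x y : X} → {γ : G.Walk x y} → {M : Rep} →
    SectionFrom γ M → Rep
  | _, _, _, _, .nil M => M
  | _, _, _, _, .cons _ _ s => s.endMod

theorem eq_sum_slice (N : Rep) (t : (V ⊠ N : Rep)) : t = ∑ i, e i ⊗ₜ[ℂ] slice i N t := by
  induction t using TensorProduct.induction_on with
  | zero => simp
  | add t₁ t₂ h₁ h₂ =>
    simp only [map_add, TensorProduct.tmul_add, Finset.sum_add_distrib]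
    rw [← h₁, ← h₂]
  | tmul v n =>
    have h : ∀ i, e i ⊗ₜ[ℂ] slice i N (v ⊗ₜ[ℂ] n) = (coord i v • e i) ⊗ₜ[ℂ] n := fun i => by
      rw [slice_tmul, TensorProduct.tmul_smul]
      rfl
    rw [Finset.sum_congr rfl fun i _ => h i, ← TensorProduct.sum_tmul, sum_coord_smul_e]

namespace SphericalTriangulation

variable [Fintype X] [DecidableEq X] {T : SphericalTriangulation X} {a b : X}

theorem TwoEdge.endMod_pullFrom {x z : X} {γ γ' : T.graph.Walk x z} (m : T.TwoEdge γ γ') {M : Rep}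
    (s : SectionFrom γ' M) : (m.pullFrom s).endMod = s.endMod := by
  induction m generalizing M with
  | insert =>
    cases s with
    | cons h A s =>
      cases s with
      | cons h B s => rfl
  | delete =>
    cases s with
    | cons h A s => rfl
  | cons h m ih =>
    cases s with
    | cons h A s => exact ih s

theorem TwoPath.endMod_pullFrom {γ γ' : T.graph.Walk a b} (Γ : T.TwoPath γ γ') {M : Rep}
    (s : SectionFrom γ' M) : (Γ.pullFrom s).endMod = s.endMod := by
  induction Γ with
  | nil => rfl
  | cons m Γ ih => exact (m.endMod_pullFrom _).trans (ih s)

theorem TwoPath.values_subset {γ γ' : T.graph.Walk a b} (Γ : T.TwoPath γ γ') {M : Rep}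
    (s : SectionFrom γ' M) : ∀ v ∈ (Γ.pullFrom s).values, v ∈ Γ.values ⟨M, s⟩ := by
  cases Γ with
  | nil => exact fun v hv => hv
  | cons m Γ =>
    intro v hv
    rw [values_cons]
    exact List.mem_append_left _ hv

theorem exists_ampl_ne_zero {G : SimpleGraph X} (h : G.Adj a b) (s : SectionFrom h.toWalk V)
    (hs : s.endMod = V) (hv : ∀ v ∈ s.values, v.arrows.fwd ≠ 0) :
    ∃ i j k, ampl (endCoord j) s [i] (e k) ≠ 0 := by
  cases s with
  | cons h' A s =>
    cases s with
    | nil =>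
      have hA : A.fwd ≠ 0 := hv _ List.mem_cons_self
      simp only [SectionFrom.endMod] at hs
      subst hs
      by_contra hc
      push Not at hc
      refine hA (LieModuleHom.ext fun v => ?_)
      have hk : ∀ k, A.fwd (e k) = 0 := by
        intro k
        rw [eq_sum_slice V (A.fwd (e k))]
        refine Finset.sum_eq_zero fun i _ => ?_
        have : slice i V (A.fwd (e k)) = (0 : SlTwo) := by
          refine (sum_coord_smul_e _).symm.trans (Finset.sum_eq_zero fun j _ => ?_)
          have h0 := hc i j k
          change endCoord j V (slice i V (A.fwd (e k))) = 0 at h0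
          rw [endCoord_V] at h0
          rw [h0, zero_smul]
        rw [this, TensorProduct.tmul_zero]
      rw [← sum_coord_smul_e v]
      change A.fwd.toLinearMap (∑ i, coord i v • e i) = 0
      rw [map_sum]
      refine Finset.sum_eq_zero fun i _ => ?_
      rw [map_smul]
      exact (congrArg _ (hk i)).trans (smul_zero _)

/-- A triangulation with a non-vanishing global section is colourable. -/
theorem SweepingLoop.exists_vertexColouring (Γ : T.SweepingLoop) (h : Γ.NonVanishing) :
    ∃ c : X → Fin 4, ∀ x y, T.graph.Adj x y → c x ≠ c y := by
  -- Only the forward arrow of `ζ^0` on the base edge is needed.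
  obtain ⟨i, j, k, hne⟩ := exists_ampl_ne_zero Γ.adj (Γ.loop.pullFrom (baseSection Γ.adj).2)
    (Γ.loop.endMod_pullFrom _) fun v hv => (h v (Γ.loop.values_subset _ v hv)).1
  have h1 := Γ.loop.ampl_phase (baseSection Γ.adj).2 (endCoord j) (e k)
    (N := baseAmpl distinct j k) (fun w => by rw [← phase_fwd.baseAmpl, ← ampl_base Γ.adj]) [i]
  have h2 : Γ.loop.evolve (baseAmpl distinct j k) [i] ≠ 0 := by
    intro h0
    rw [h0, Nat.cast_zero, zero_smul] at h1
    refine smul_ne_zero hne ?_ h1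
    simpa using phase_fwd.ne_zero i
  obtain ⟨χ, hχ⟩ := Γ.exists_edgeColouring (i := third k j) (fun w hw => by
    match w with
    | [] => exact (hw rfl).elim
    | _ :: _ :: _ => exact (hw rfl).elim
    | [l] =>
      simp only [baseAmpl, ne_eq, ite_eq_right_iff, Classical.not_imp] at hw
      obtain ⟨h3, _⟩ := hw
      have : l = third k j := by
        clear hne h1 h2
        revert l j k
        decide
      rw [this]) h2
  exact T.exists_vertexColouring hχ

end SphericalTriangulation


/-! ### Cycles of permutations -/

theorem eq_of_sameCycle {D A : Type} {f : Equiv.Perm D} (g : D → A) (h : ∀ d, g (f d) = g d)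
    {d d' : D} (hd : f.SameCycle d d') : g d = g d' := by
  obtain ⟨i, rfl⟩ := hd
  induction i with
  | zero => simp
  | succ n ih => rw [add_comm, zpow_add, zpow_one, Equiv.Perm.mul_apply, h, ← ih]
  | pred n ih => rw [ih, ← h ((f ^ (-(n : ℤ) - 1)) d), ← Equiv.Perm.mul_apply, ← zpow_one_add]; simp

theorem card_quotient_sameCycle {D A : Type} {f : Equiv.Perm D} (g : D → A) (S : Finset A)
    (h : ∀ d d', f.SameCycle d d' ↔ g d = g d') (hS : ∀ a, a ∈ S ↔ ∃ d, g d = a) :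
    Nat.card (Quotient (Equiv.Perm.SameCycle.setoid f)) = S.card := by
  let φ : Quotient (Equiv.Perm.SameCycle.setoid f) → S :=
    Quotient.lift (fun d => ⟨g d, (hS _).2 ⟨d, rfl⟩⟩) fun d d' hd => Subtype.ext ((h d d').1 hd)
  have hφ : Function.Bijective φ := by
    constructor
    · intro q q' e
      induction q using Quotient.inductionOn with
      | _ d =>
      induction q' using Quotient.inductionOn with
      | _ d' => exact Quotient.sound ((h d d').2 (congrArg Subtype.val e))
    · rintro ⟨a, ha⟩
      obtain ⟨d, rfl⟩ := (hS a).1 ha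
      exact ⟨Quotient.mk _ d, rfl⟩
  rw [Nat.card_congr (Equiv.ofBijective φ hφ)]
  simp

namespace SphericalTriangulation

/-! ### The dual polyhedron of a triangulation -/

variable {X : Type} [Fintype X] [DecidableEq X] {T : SphericalTriangulation X}

variable (T) in
/-- The oriented edges of `T`. -/
abbrev OrientedEdge : Type := {d : X × X // T.graph.Adj d.1 d.2}

instance : Fintype T.OrientedEdge := by
  classical exact inferInstance

variable (T) in
/-- Reversal of oriented edges. -/
def reverse : Equiv.Perm T.OrientedEdge where
  toFun d := ⟨(d.1.2, d.1.1), d.2.symm⟩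
  invFun d := ⟨(d.1.2, d.1.1), d.2.symm⟩
  left_inv _ := rfl
  right_inv _ := rfl

namespace Orientation

variable (o : T.Orientation)

/-- Rotation of the oriented edges around their origin. -/
def turn : Equiv.Perm T.OrientedEdge where
  toFun d := ⟨(d.1.1, o.r d.1.2 d.1.1), o.adj_right d.2.symm⟩
  invFun d := ⟨(d.1.1, o.r d.1.1 d.1.2), (o.adj_left d.2).symm⟩
  left_inv d := Subtype.ext (Prod.ext rfl (o.rotate d.2.symm))
  right_inv d := Subtype.ext (Prod.ext rfl (o.rotate_left d.2))

/-- The oriented edges issuing from `x` correspond to the vertices of its link, which is a single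
cycle. These cycles are the faces of the dual. -/
theorem sameCycle_turn_iff (d d' : T.OrientedEdge) : o.turn.SameCycle d d' ↔ d.1.1 = d'.1.1 := by
  constructor
  · exact eq_of_sameCycle (fun d : T.OrientedEdge => d.1.1) fun _ => rfl
  · obtain ⟨⟨x, y⟩, h⟩ := d
    obtain ⟨⟨x', z⟩, h'⟩ := d'
    rintro rfl
    have := o.link_induction (x := x) (y := y) (z := z)
      (Q := fun z => ∀ h' : T.graph.Adj x z, o.turn.SameCycle ⟨(x, y), h⟩ ⟨(x, z), h'⟩)
      (fun u hu => ?_) h h' (fun _ => Equiv.Perm.SameCycle.refl _ _)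
    · exact this h'
    · have ha := (o.adj_left hu).symm
      have e : o.turn ⟨(x, o.r x u), ha⟩ = ⟨(x, u), hu⟩ :=
        Subtype.ext (Prod.ext rfl (o.rotate_left hu))
      constructor
      · intro hq _
        rw [← Equiv.Perm.sameCycle_apply_right, e]
        exact hq hu
      · intro hq _
        rw [← e, Equiv.Perm.sameCycle_apply_right]
        exact hq ha

theorem sameCycle_reverse_iff (d d' : T.OrientedEdge) :
    T.reverse.SameCycle d d' ↔ ({d.1.1, d.1.2} : Finset X) = {d'.1.1, d'.1.2} := by
  constructor
  · exact eq_of_sameCycle (fun d : T.OrientedEdge => ({d.1.1, d.1.2} : Finset X)) fun _ => Finset.pair_comm _ _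
  · obtain ⟨⟨x, y⟩, h⟩ := d
    obtain ⟨⟨u, v⟩, h'⟩ := d'
    intro e
    have hu : u ∈ ({x, y} : Finset X) := e ▸ by simp
    have hv : v ∈ ({x, y} : Finset X) := e ▸ by simp
    have hne := h'.1
    simp only [Finset.mem_insert, Finset.mem_singleton] at hu hv hne
    rcases hu with rfl | rfl <;> rcases hv with rfl | rfl
    · exact (hne rfl).elim
    · exact Equiv.Perm.SameCycle.refl _ _
    · exact ⟨1, rfl⟩
    · exact (hne rfl).elim

/-- The product sends `(x, y)` to `(y, o.r x y)`, the next edge of the positive boundary of the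
triangle. These cycles are the vertices of the dual, all of degree three. -/
theorem sameCycle_turn_mul_reverse_iff (d d' : T.OrientedEdge) :
    (o.turn * T.reverse).SameCycle d d' ↔ o.tri d.1.1 d.1.2 = o.tri d'.1.1 d'.1.2 := by
  constructor
  · exact eq_of_sameCycle (fun d : T.OrientedEdge => o.tri d.1.1 d.1.2) fun d => o.tri_rotate d.2
  · intro e
    rcases (o.tri_eq_iff d.2 d'.2).1 e.symm with ⟨h1, h2⟩ | ⟨h1, h2⟩ | ⟨h1, h2⟩
    · rw [show d' = d from Subtype.ext (Prod.ext h1 h2)]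
    · exact ⟨1, Subtype.ext (Prod.ext h1.symm h2.symm)⟩
    · refine ⟨2, Subtype.ext (Prod.ext h1.symm ?_)⟩
      exact (o.rotate d.2).trans h2.symm

theorem exists_closure_of_sameCycle {d d' : T.OrientedEdge} (h : o.turn.SameCycle d d') :
    ∃ g ∈ Subgroup.closure {T.reverse, o.turn}, g d = d' := by
  obtain ⟨i, hi⟩ := h
  exact ⟨o.turn ^ i, Subgroup.zpow_mem _ (Subgroup.subset_closure (by simp)) i, hi⟩

theorem dual_connected (d d' : T.OrientedEdge) :
    ∃ g ∈ Subgroup.closure {T.reverse, o.turn}, g d = d' := by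
  obtain ⟨w⟩ := T.connected.preconnected d.1.1 d'.1.1
  generalize hx : d.1.1 = x at w
  generalize hy : d'.1.1 = y at w
  induction w generalizing d with
  | nil => exact o.exists_closure_of_sameCycle ((o.sameCycle_turn_iff _ _).2 (hx.trans hy.symm))
  | @cons x v y h w ih =>
    obtain ⟨g₁, h₁, e₁⟩ := o.exists_closure_of_sameCycle
      ((o.sameCycle_turn_iff d ⟨(x, v), h⟩).2 hx)
    obtain ⟨g₂, h₂, e₂⟩ := ih ⟨(v, x), h.symm⟩ rfl hy
    refine ⟨g₂ * (T.reverse * g₁), Subgroup.mul_mem _ h₂ (Subgroup.mul_mem _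
      (Subgroup.subset_closure (by simp)) h₁), ?_⟩
    rw [Equiv.Perm.mul_apply, Equiv.Perm.mul_apply, e₁]
    exact e₂

/-- The dual polyhedron of `T`, whose faces are the vertices of `T`. -/
def dual : SphericalPolyhedron T.OrientedEdge where
  opp := T.reverse
  next := o.turn
  opp_opp _ := rfl
  opp_ne d h := d.2.1 (congrArg (fun d => d.1.2) h)
  connected := o.dual_connected
  euler := by
    rw [card_quotient_sameCycle _ T.triangles o.sameCycle_turn_mul_reverse_iff,
      card_quotient_sameCycle _ Finset.univ o.sameCycle_turn_iff,
      card_quotient_sameCycle _ (edgesOf T.triangles) sameCycle_reverse_iff, Finset.card_univ,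
      add_comm]
    · exact T.euler
    · intro e
      rw [T.mem_edgesOf_iff]
      constructor
      · rintro ⟨x, y, h, rfl⟩
        exact ⟨⟨(x, y), h⟩, rfl⟩
      · rintro ⟨d, rfl⟩
        exact ⟨_, _, d.2, rfl⟩
    · intro x
      obtain ⟨y, h⟩ := T.exists_adj x
      exact ⟨fun _ => ⟨⟨(x, y), h⟩, rfl⟩, fun _ => Finset.mem_univ _⟩
    · intro t
      constructor
      · intro ht
        obtain ⟨x, y, z, hxy, -, -, rfl⟩ := Finset.card_eq_three.1 (T.card_triangle t ht)
        have h := T.adj_of_mem ht (x := x) (y := y) (by simp) (by simp) hxy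
        rcases o.eq_tri_or ht hxy (by simp) (by simp) with e | e
        · exact ⟨⟨(x, y), h⟩, e.symm⟩
        · exact ⟨⟨(y, x), h.symm⟩, e.symm⟩
      · rintro ⟨d, rfl⟩
        exact o.tri_mem d.2
  degree d h := (o.adj_left d.2).1 (congrArg (fun d => d.1.1) h)
  simple_face d d' h h' := by
    rw [sameCycle_turn_iff] at h
    rw [sameCycle_turn_mul_reverse_iff] at h'
    rcases (o.tri_eq_iff d.2 d'.2).1 h'.symm with ⟨h1, h2⟩ | ⟨h1, h2⟩ | ⟨h1, h2⟩
    · exact (Subtype.ext (Prod.ext h1 h2)).symm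
    · exact (d.2.1 (h.trans h1)).elim
    · exact ((o.adj_left d.2).1 (h.trans h1).symm).elim
  simple_adj d d' h h' := by
    rw [sameCycle_turn_iff] at h h'
    exact Subtype.ext (Prod.ext h h')

end Orientation

/-- The four-colour theorem yields a colouring of the vertices of a triangulation. -/
theorem exists_vertexColouring_of_fourColourTheorem (h : FourColourTheorem) :
    ∃ c : X → Fin 4, ∀ x y, T.graph.Adj x y → c x ≠ c y := by
  obtain ⟨o⟩ := T.exists_orientation
  obtain ⟨c, hc⟩ := h _ o.dual
  choose f hf using T.exists_adj
  let d : X → T.OrientedEdge := fun x => ⟨(x, f x), hf x⟩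
  have key : ∀ x y (h : T.graph.Adj x y), o.dual.face (d x) = o.dual.face ⟨(x, y), h⟩ :=
    fun x y h => Quotient.sound ((o.sameCycle_turn_iff (d x) ⟨(x, y), h⟩).2 rfl)
  refine ⟨fun x => c (o.dual.face (d x)), fun x y h => ?_⟩
  change c (o.dual.face (d x)) ≠ c (o.dual.face (d y))
  rw [key x y h, key y x h.symm]
  exact hc ⟨(x, y), h⟩

end SphericalTriangulation


/-! ### The stellar triangulation of a polyhedron -/

theorem card_inter_eq_two {A : Type} [DecidableEq A] {s t : Finset A} (hs : s.card = 3)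
    (ht : t.card = 3) (hst : s ≠ t) {p q : A} (hpq : p ≠ q) (hp : p ∈ s ∩ t) (hq : q ∈ s ∩ t) :
    (s ∩ t).card = 2 := by
  have h1 : 1 < (s ∩ t).card := Finset.one_lt_card.2 ⟨p, hp, q, hq, hpq⟩
  have h2 : (s ∩ t).card ≤ 3 := hs ▸ Finset.card_le_card Finset.inter_subset_left
  have h3 : (s ∩ t).card ≠ 3 := fun h => hst <|
    (Finset.eq_of_subset_of_card_le Finset.inter_subset_left (by omega)).symm.trans
      (Finset.eq_of_subset_of_card_le Finset.inter_subset_right (by omega))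
  omega

namespace SphericalPolyhedron

variable {D : Type} [Fintype D] (P : SphericalPolyhedron D)

/-- The vertices of `P`. -/
def Vertex : Type := Quotient (Equiv.Perm.SameCycle.setoid (P.next * P.opp))

/-- The origin of a dart. -/
def origin (d : D) : P.Vertex := Quotient.mk (Equiv.Perm.SameCycle.setoid (P.next * P.opp)) d

instance : Finite P.Face := inferInstanceAs (Finite (Quotient _))

instance : Finite P.Vertex := inferInstanceAs (Finite (Quotient _))

instance : Fintype P.Face := Fintype.ofFinite _

instance : Fintype P.Vertex := Fintype.ofFinite _

instance : DecidableEq P.Face := Classical.decEq _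

instance : DecidableEq P.Vertex := Classical.decEq _

theorem face_eq_iff {d d' : D} : P.face d = P.face d' ↔ P.next.SameCycle d d' :=
  Quotient.eq (r := Equiv.Perm.SameCycle.setoid P.next)

theorem origin_eq_iff {d d' : D} :
    P.origin d = P.origin d' ↔ (P.next * P.opp).SameCycle d d' :=
  Quotient.eq (r := Equiv.Perm.SameCycle.setoid (P.next * P.opp))

theorem exists_face_eq (x : P.Face) : ∃ d, P.face d = x := Quotient.exists_rep x

theorem exists_origin_eq (x : P.Vertex) : ∃ d, P.origin d = x := Quotient.exists_rep x

theorem face_next (d : D) : P.face (P.next d) = P.face d :=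
  P.face_eq_iff.2 (Equiv.Perm.sameCycle_apply_left.2 (Equiv.Perm.SameCycle.refl _ _))

theorem origin_next (d : D) : P.origin (P.next d) = P.origin (P.opp d) := by
  rw [origin_eq_iff]
  have h : (P.next * P.opp) (P.opp d) = P.next d := by
    rw [Equiv.Perm.mul_apply, P.opp_opp]
  rw [← h]
  exact Equiv.Perm.sameCycle_apply_left.2 (Equiv.Perm.SameCycle.refl _ _)

theorem eq_of_face_origin {d d' : D} (h : P.face d = P.face d') (h' : P.origin d = P.origin d') :
    d = d' := P.simple_face d d' (P.face_eq_iff.1 h) (P.origin_eq_iff.1 h')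

theorem eq_of_face_face {d d' : D} (h : P.face d = P.face d')
    (h' : P.face (P.opp d) = P.face (P.opp d')) : d = d' :=
  P.simple_adj d d' (P.face_eq_iff.1 h) (P.face_eq_iff.1 h')

theorem face_ne (d : D) : P.face d ≠ P.face (P.opp d) := fun h =>
  P.opp_ne d (P.eq_of_face_face h (by rw [P.opp_opp, h])).symm

/-- A loop would, by `simple_face`, bound a one-sided polygon on both sides, and then two rotations
would return to the dart, against the bound on the degree. -/
theorem origin_ne (d : D) : P.origin d ≠ P.origin (P.opp d) := by
  intro h
  have h1 : P.next d = d := P.eq_of_face_origin (P.face_next d) ((P.origin_next d).trans h.symm)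
  have h2 : P.next (P.opp d) = P.opp d :=
    P.eq_of_face_origin (P.face_next _) ((P.origin_next _).trans (by rw [P.opp_opp, h]))
  refine P.degree d ?_
  simp only [Equiv.Perm.mul_apply]
  rw [h2, P.opp_opp, h1]

/-- The triangle formed by an edge of the dual polyhedron and by the centre of a face. -/
def star (d : D) : Finset (P.Face ⊕ P.Vertex) :=
  {.inl (P.face d), .inl (P.face (P.opp d)), .inr (P.origin d)}

theorem inl_mem_star {d : D} {x : P.Face} :
    .inl x ∈ P.star d ↔ x = P.face d ∨ x = P.face (P.opp d) := by simp [star]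

theorem inr_mem_star {d : D} {x : P.Vertex} : .inr x ∈ P.star d ↔ x = P.origin d := by simp [star]

theorem card_star (d : D) : (P.star d).card = 3 :=
  Finset.card_eq_three.2 ⟨_, _, _, by simpa using P.face_ne d, by simp, by simp, rfl⟩

/-- A face and a vertex on it determine the dart. If the two faces are interchanged, the dart is
reversed, but then its origin differs. -/
theorem star_injective : Function.Injective P.star := by
  intro d d' h
  have h1 : .inr (P.origin d) ∈ P.star d' := h ▸ P.inr_mem_star.2 rfl
  have h2 : .inl (P.face d) ∈ P.star d' := h ▸ P.inl_mem_star.2 (Or.inl rfl)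
  have h3 : .inl (P.face (P.opp d)) ∈ P.star d' := h ▸ P.inl_mem_star.2 (Or.inr rfl)
  rw [inr_mem_star] at h1
  rw [inl_mem_star] at h2 h3
  rcases h2 with h2 | h2
  · exact P.eq_of_face_origin h2 h1
  · rcases h3 with h3 | h3
    · have : d = P.opp d' := P.eq_of_face_face h2 (by rw [P.opp_opp]; exact h3)
      subst this
      exact (P.origin_ne d' h1.symm).elim
    · exact (P.face_ne d (h2.trans h3.symm)).elim

/-- A spoke lies in exactly two stars. Writing its dart as `P.next d` names the second one, `P.opp
d`, without inverting `next`. -/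
theorem eq_of_face_origin_mem {d d' : D} (h : .inl (P.face (P.next d)) ∈ P.star d')
    (h' : .inr (P.origin (P.next d)) ∈ P.star d') : d' = P.next d ∨ d' = P.opp d := by
  rw [inl_mem_star] at h
  rw [inr_mem_star] at h'
  rcases h with h | h
  · exact Or.inl (P.eq_of_face_origin h h').symm
  · right
    have : P.next d = P.next (P.opp d') := by
      refine P.eq_of_face_origin (h.trans (P.face_next _).symm) (h'.trans ?_)
      rw [origin_next, P.opp_opp]
    rw [P.next.injective this, P.opp_opp]

theorem next_ne_opp (d : D) : P.next d ≠ P.opp d := fun h =>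
  P.face_ne d (by rw [← h, face_next])

theorem eq_of_face_face_mem {d d' : D} (h : .inl (P.face d) ∈ P.star d')
    (h' : .inl (P.face (P.opp d)) ∈ P.star d') : d' = d ∨ d' = P.opp d := by
  rw [inl_mem_star] at h h'
  rcases h with h | h <;> rcases h' with h' | h'
  · exact (P.face_ne d (h.trans h'.symm)).elim
  · exact Or.inl (P.eq_of_face_face h h').symm
  · right
    rw [P.eq_of_face_face (d := d) (d' := P.opp d') h (by rw [P.opp_opp]; exact h'), P.opp_opp]
  · exact (P.face_ne d (h.trans h'.symm)).elim

/-- The triangles of the stellar triangulation. -/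
def stars : Finset (Finset (P.Face ⊕ P.Vertex)) := Finset.univ.image P.star

theorem mem_stars {t : Finset (P.Face ⊕ P.Vertex)} : t ∈ P.stars ↔ ∃ d, P.star d = t := by
  simp [stars]

theorem star_mem (d : D) : P.star d ∈ P.stars := P.mem_stars.2 ⟨d, rfl⟩

/-- The edge of the dual polyhedron which crosses the edge of `P` containing a dart. -/
def crossing (d : D) : Finset (P.Face ⊕ P.Vertex) := {.inl (P.face d), .inl (P.face (P.opp d))}

/-- The edge joining the centre of a face of the dual polyhedron to one of its vertices. -/
def spoke (d : D) : Finset (P.Face ⊕ P.Vertex) := {.inl (P.face d), .inr (P.origin d)}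

theorem edgesOf_stars [DecidableEq D] :
    edgesOf P.stars = Finset.univ.image P.crossing ∪ Finset.univ.image P.spoke := by
  ext e
  simp only [edgesOf, Finset.mem_biUnion, Finset.mem_powersetCard, mem_stars, Finset.mem_union,
    Finset.mem_image, Finset.mem_univ, true_and]
  constructor
  · rintro ⟨_, ⟨d, rfl⟩, hs, hc⟩
    obtain ⟨p, q, hpq, rfl⟩ := Finset.card_eq_two.1 hc
    have hp := hs (show p ∈ _ by simp)
    have hq := hs (show q ∈ _ by simp)
    have hsp : P.spoke (P.next (P.opp d)) =
        {.inl (P.face (P.opp d)), .inr (P.origin d)} := by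
      rw [spoke, face_next, origin_next, P.opp_opp]
    simp only [star, Finset.mem_insert, Finset.mem_singleton] at hp hq
    rcases hp with rfl | rfl | rfl <;> rcases hq with rfl | rfl | rfl
    · exact (hpq rfl).elim
    · exact Or.inl ⟨d, rfl⟩
    · exact Or.inr ⟨d, rfl⟩
    · exact Or.inl ⟨d, Finset.pair_comm _ _⟩
    · exact (hpq rfl).elim
    · exact Or.inr ⟨_, hsp⟩
    · exact Or.inr ⟨d, Finset.pair_comm _ _⟩
    · exact Or.inr ⟨_, hsp.trans (Finset.pair_comm _ _)⟩
    · exact (hpq rfl).elim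
  · rintro (⟨d, rfl⟩ | ⟨d, rfl⟩)
    · refine ⟨_, ⟨d, rfl⟩, by simp [crossing, star, Finset.insert_subset_iff], ?_⟩
      exact Finset.card_pair (by simpa using P.face_ne d)
    · exact ⟨_, ⟨d, rfl⟩, by simp [spoke, star, Finset.insert_subset_iff],
        Finset.card_pair (by simp)⟩

theorem crossing_eq_iff (d d' : D) : P.opp.SameCycle d d' ↔ P.crossing d = P.crossing d' := by
  constructor
  · refine eq_of_sameCycle P.crossing fun d => ?_
    rw [crossing, crossing, P.opp_opp, Finset.pair_comm]
  · intro h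
    have h1 : .inl (P.face d) ∈ P.crossing d' := h ▸ by simp [crossing]
    have h2 : .inl (P.face (P.opp d)) ∈ P.crossing d' := h ▸ by simp [crossing]
    have : d' = d ∨ d' = P.opp d := by
      refine P.eq_of_face_face_mem ?_ ?_
      · rw [inl_mem_star]
        simpa [crossing] using h1
      · rw [inl_mem_star]
        simpa [crossing] using h2
    rcases this with rfl | rfl
    · exact Equiv.Perm.SameCycle.refl _ _
    · exact ⟨1, rfl⟩

theorem spoke_injective : Function.Injective P.spoke := by
  intro d d' h
  have h1 : .inl (P.face d) ∈ P.spoke d' := h ▸ by simp [spoke]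
  have h2 : .inr (P.origin d) ∈ P.spoke d' := h ▸ by simp [spoke]
  simp only [spoke, Finset.mem_insert, Finset.mem_singleton, Sum.inl.injEq, reduceCtorEq, or_false,
    false_or, Sum.inr.injEq] at h1 h2
  exact P.eq_of_face_origin h1 h2

/-- One crossing per edge of `P` and one spoke per dart. As there is one triangle per dart, the
number of darts cancels in Euler's formula, which becomes that of `P`. -/
theorem card_edgesOf_stars :
    (edgesOf P.stars).card =
      Nat.card (Quotient (Equiv.Perm.SameCycle.setoid P.opp)) + Fintype.card D := by
  classical
  rw [edgesOf_stars, Finset.card_union_of_disjoint,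
    Finset.card_image_of_injective _ P.spoke_injective, Finset.card_univ,
    card_quotient_sameCycle P.crossing (Finset.univ.image P.crossing) P.crossing_eq_iff]
  · simp
  · rw [Finset.disjoint_left]
    intro e h h'
    obtain ⟨d, -, rfl⟩ := Finset.mem_image.1 h
    obtain ⟨d', -, h'⟩ := Finset.mem_image.1 h'
    have : .inr (P.origin d') ∈ P.crossing d := h' ▸ by simp [spoke]
    simp [crossing] at this

theorem card_filter_stars {e : Finset (P.Face ⊕ P.Vertex)} {d₁ d₂ : D} (hne : d₁ ≠ d₂)
    (h₁ : e ⊆ P.star d₁) (h₂ : e ⊆ P.star d₂) (h : ∀ d, e ⊆ P.star d → d = d₁ ∨ d = d₂) :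
    (P.stars.filter (e ⊆ ·)).card = 2 := by
  have : P.stars.filter (e ⊆ ·) = {P.star d₁, P.star d₂} := by
    ext t
    simp only [Finset.mem_filter, mem_stars, Finset.mem_insert, Finset.mem_singleton]
    constructor
    · rintro ⟨⟨d, rfl⟩, hs⟩
      exact (h d hs).imp (congrArg _) (congrArg _)
    · rintro (rfl | rfl)
      · exact ⟨⟨_, rfl⟩, h₁⟩
      · exact ⟨⟨_, rfl⟩, h₂⟩
  rw [this, Finset.card_pair fun e => hne (P.star_injective e)]

theorem closed_stars (e : Finset (P.Face ⊕ P.Vertex)) (he : e ∈ edgesOf P.stars) :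
    (P.stars.filter (e ⊆ ·)).card = 2 := by
  classical
  rw [edgesOf_stars] at he
  simp only [Finset.mem_union, Finset.mem_image, Finset.mem_univ, true_and] at he
  rcases he with ⟨d, rfl⟩ | ⟨d, rfl⟩
  · refine P.card_filter_stars (P.opp_ne d).symm ?_ ?_ fun d' h => ?_
    · simp [crossing, star, Finset.insert_subset_iff]
    · simp [crossing, star, Finset.insert_subset_iff, P.opp_opp]
    · exact P.eq_of_face_face_mem (h (by simp [crossing])) (h (by simp [crossing]))
  · obtain ⟨d, rfl⟩ := P.next.surjective d
    refine P.card_filter_stars (P.next_ne_opp d) ?_ ?_ fun d' h => ?_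
    · simp [spoke, star, Finset.insert_subset_iff]
    · simp [spoke, star, P.opp_opp, face_next, origin_next]
    · exact P.eq_of_face_origin_mem (h (by simp [spoke])) (h (by simp [spoke]))

/-- Two triangles with a common edge at `x`. -/
def Linked (x : P.Face ⊕ P.Vertex) (s t : Finset (P.Face ⊕ P.Vertex)) : Prop :=
  s ∈ P.stars ∧ t ∈ P.stars ∧ x ∈ s ∩ t ∧ (s ∩ t).card = 2

theorem Linked.symm {P : SphericalPolyhedron D} {x : P.Face ⊕ P.Vertex}
    {s t : Finset (P.Face ⊕ P.Vertex)} (h : P.Linked x s t) : P.Linked x t s := by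
  obtain ⟨h1, h2, h3, h4⟩ := h
  rw [Finset.inter_comm] at h3 h4
  exact ⟨h2, h1, h3, h4⟩

theorem linked_of_mem {x y : P.Face ⊕ P.Vertex} {d d' : D} (hd : d ≠ d') (hxy : x ≠ y)
    (h1 : x ∈ P.star d) (h2 : x ∈ P.star d') (h3 : y ∈ P.star d) (h4 : y ∈ P.star d') :
    P.Linked x (P.star d) (P.star d') :=
  ⟨P.star_mem d, P.star_mem d', Finset.mem_inter.2 ⟨h1, h2⟩,
    card_inter_eq_two (P.card_star d) (P.card_star d') (fun e => hd (P.star_injective e)) hxy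
      (Finset.mem_inter.2 ⟨h1, h2⟩) (Finset.mem_inter.2 ⟨h3, h4⟩)⟩

theorem linked_opp (d : D) : P.Linked (.inl (P.face d)) (P.star d) (P.star (P.opp d)) :=
  P.linked_of_mem (y := .inl (P.face (P.opp d))) (P.opp_ne d).symm
    (by simpa using P.face_ne d) (by simp [inl_mem_star]) (by simp [inl_mem_star, P.opp_opp])
    (by simp [inl_mem_star]) (by simp [inl_mem_star])

theorem linked_next (d : D) :
    P.Linked (.inl (P.face d)) (P.star (P.opp d)) (P.star (P.next d)) :=
  P.linked_of_mem (y := .inr (P.origin (P.opp d))) (P.next_ne_opp d).symm (by simp)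
    (by simp [inl_mem_star, P.opp_opp]) (by simp [inl_mem_star, face_next])
    (by simp [inr_mem_star]) (by simp [inr_mem_star, origin_next])

theorem linked_rotation (d : D) :
    P.Linked (.inr (P.origin d)) (P.star d) (P.star ((P.next * P.opp) d)) := by
  rw [Equiv.Perm.mul_apply]
  exact P.linked_of_mem (y := .inl (P.face (P.opp d)))
    (fun h => P.next_ne_opp (P.opp d) (by rw [P.opp_opp, ← h])) (by simp)
    (by simp [inr_mem_star]) (by simp [inr_mem_star, origin_next, P.opp_opp])
    (by simp [inl_mem_star]) (by simp [inl_mem_star, face_next])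

/-- As `D` is finite, a cycle is traversed by non-negative powers alone, so a one-directional
relation suffices. -/
theorem reflTransGen_of_sameCycle {f : Equiv.Perm D} {A : Type} {R : A → A → Prop} (g : D → A)
    (d : D) (h : ∀ d', f.SameCycle d d' → Relation.ReflTransGen R (g d') (g (f d'))) {d' : D}
    (hd : f.SameCycle d d') : Relation.ReflTransGen R (g d) (g d') := by
  obtain ⟨n, -, hn⟩ := hd.exists_pow_eq'
  rw [← hn]
  clear hn
  induction n with
  | zero => exact .refl
  | succ n ih =>
    rw [pow_succ', Equiv.Perm.mul_apply]
    exact ih.trans (h _ ⟨n, by simp⟩)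

/-- Around the centre of a face one meets `star d`, `star (opp d)`, `star (next d)` and so on,
sharing alternately a crossing and a spoke. Around a vertex of `P` the triangles follow the
rotation. -/
theorem link_connected_stars (x : P.Face ⊕ P.Vertex) (s) (hs : s ∈ P.stars) (t) (ht : t ∈ P.stars)
    (hxs : x ∈ s) (hxt : x ∈ t) : Relation.ReflTransGen (P.Linked x) s t := by
  obtain ⟨d, rfl⟩ := P.mem_stars.1 hs
  obtain ⟨d', rfl⟩ := P.mem_stars.1 ht
  cases x with
  | inl x =>
    have key : ∀ d d', x = P.face d → x = P.face d' →
        Relation.ReflTransGen (P.Linked (.inl x)) (P.star d) (P.star d') := by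
      rintro d d' rfl h
      refine reflTransGen_of_sameCycle P.star d (fun d' h => ?_) (P.face_eq_iff.1 h)
      rw [P.face_eq_iff.2 h]
      exact (Relation.ReflTransGen.single (P.linked_opp d')).tail (P.linked_next d')
    have hopp : ∀ d, x = P.face (P.opp d) → P.Linked (.inl x) (P.star d) (P.star (P.opp d)) := by
      rintro d rfl
      have := P.linked_opp (P.opp d)
      rw [P.opp_opp] at this
      exact this.symm
    rw [inl_mem_star] at hxs hxt
    rcases hxs with h | h <;> rcases hxt with h' | h'
    · exact key _ _ h h'
    · exact (key _ _ h h').tail (hopp _ h').symm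
    · exact (key _ _ h h').head (hopp _ h)
    · exact ((key _ _ h h').tail (hopp _ h').symm).head (hopp _ h)
  | inr x =>
    rw [inr_mem_star] at hxs hxt
    subst hxs
    refine reflTransGen_of_sameCycle P.star d (fun d' h => ?_) (P.origin_eq_iff.1 hxt)
    rw [P.origin_eq_iff.2 h]
    exact Relation.ReflTransGen.single (P.linked_rotation d')

theorem nonempty_dart (P : SphericalPolyhedron D) : Nonempty D := by
  by_contra h
  rw [not_nonempty_iff] at h
  have := P.euler
  simp at this

theorem skeleton_adj {x y : P.Face ⊕ P.Vertex} (d : D) (hxy : x ≠ y) (hx : x ∈ P.star d)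
    (hy : y ∈ P.star d) : (skeletonOf P.stars).Adj x y := ⟨hxy, _, P.star_mem d, hx, hy⟩

theorem reachable_face (g : Equiv.Perm D) (hg : g ∈ Subgroup.closure {P.opp, P.next}) :
    ∀ d, (skeletonOf P.stars).Reachable (.inl (P.face d)) (.inl (P.face (g d))) := by
  induction hg using Subgroup.closure_induction with
  | mem g hg =>
    intro d
    rcases hg with rfl | hg
    · exact (P.skeleton_adj d (by simpa using P.face_ne d) (by simp [inl_mem_star])
        (by simp [inl_mem_star])).reachable
    · rw [Set.mem_singleton_iff.1 hg, face_next]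
  | one => exact fun d => SimpleGraph.Reachable.refl _
  | mul g g' _ _ h h' => exact fun d => (h' d).trans (h (g' d))
  | inv g _ h =>
    intro d
    have := (h (g⁻¹ d)).symm
    rwa [← Equiv.Perm.mul_apply, mul_inv_cancel, Equiv.Perm.one_apply] at this

theorem connected_stars : (skeletonOf P.stars).Connected := by
  obtain ⟨d₀⟩ := P.nonempty_dart
  have key : ∀ d, (skeletonOf P.stars).Reachable (.inl (P.face d₀)) (.inl (P.face d)) := by
    intro d
    obtain ⟨g, hg, rfl⟩ := P.connected d₀ d
    exact P.reachable_face g hg d₀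
  rw [SimpleGraph.connected_iff_exists_forall_reachable]
  refine ⟨.inl (P.face d₀), fun x => ?_⟩
  cases x with
  | inl x =>
    obtain ⟨d, rfl⟩ := P.exists_face_eq x
    exact key d
  | inr x =>
    obtain ⟨d, rfl⟩ := P.exists_origin_eq x
    exact (key d).trans (P.skeleton_adj d (by simp) (by simp [inl_mem_star])
      (by simp [inr_mem_star])).reachable

/-- The triangulation obtained from the dual of `P` by the stellar subdivision of its faces. -/
def stellation : SphericalTriangulation (P.Face ⊕ P.Vertex) where
  triangles := P.stars
  card_triangle t ht := by
    obtain ⟨d, rfl⟩ := P.mem_stars.1 ht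
    exact P.card_star d
  closed := P.closed_stars
  link_connected := P.link_connected_stars
  connected := P.connected_stars
  euler := by
    have h1 : Fintype.card P.Face = Nat.card (Quotient (Equiv.Perm.SameCycle.setoid P.next)) :=
      Nat.card_eq_fintype_card.symm
    have h2 : Fintype.card P.Vertex =
        Nat.card (Quotient (Equiv.Perm.SameCycle.setoid (P.next * P.opp))) :=
      Nat.card_eq_fintype_card.symm
    rw [card_edgesOf_stars, stars, Finset.card_image_of_injective _ P.star_injective,
      Finset.card_univ, Fintype.card_sum, h1, h2]
    have := P.euler
    omega

theorem exists_isGoodColouring {c : P.Face ⊕ P.Vertex → Fin 4}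
    (hc : ∀ x y, P.stellation.graph.Adj x y → c x ≠ c y) : ∃ c, P.IsGoodColouring c :=
  ⟨fun x => c (.inl x), fun d => hc _ _ (P.skeleton_adj d (by simpa using P.face_ne d)
    (by simp [inl_mem_star]) (by simp [inl_mem_star]))⟩

end SphericalPolyhedron

/-- The four-colour theorem holds if every spherical triangulation has a sweeping loop with a
non-vanishing global section. -/
theorem fourColourTheorem_of_nonVanishing
    (h : ∀ (X : Type) [Fintype X] [DecidableEq X] (T : SphericalTriangulation X),
      ∃ Γ : T.SweepingLoop, Γ.NonVanishing) : FourColourTheorem := by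
  intro D _ P
  obtain ⟨Γ, hΓ⟩ := h _ P.stellation
  obtain ⟨c, hc⟩ := Γ.exists_vertexColouring hΓ
  exact P.exists_isGoodColouring hc

theorem nonVanishing_of_fourColourTheorem (h : FourColourTheorem) {X : Type} [Fintype X]
    [DecidableEq X] {T : SphericalTriangulation X} (Γ : T.SweepingLoop) : Γ.NonVanishing := by
  obtain ⟨c, hc⟩ := T.exists_vertexColouring_of_fourColourTheorem h
  exact Γ.nonVanishing hc

end FourColour

end

theorem theorem4 :
    (FourColour.FourColourTheorem ↔
      ∀ (X : Type) [Fintype X] [DecidableEq X] (T : FourColour.SphericalTriangulation X)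
        (Γ : T.SweepingLoop), Γ.NonVanishing) ∧
    (FourColour.FourColourTheorem ↔
      ∀ (X : Type) [Fintype X] [DecidableEq X] (T : FourColour.SphericalTriangulation X),
        ∃ Γ : T.SweepingLoop, Γ.NonVanishing) := by
  refine ⟨⟨fun h X _ _ T Γ => FourColour.nonVanishing_of_fourColourTheorem h Γ, fun h => ?_⟩,
    ⟨fun h X _ _ T => ?_, FourColour.fourColourTheorem_of_nonVanishing⟩⟩
  · refine FourColour.fourColourTheorem_of_nonVanishing fun X _ _ T => ?_
    -- Without a sweeping loop the universal condition would be vacuous for `T`.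
    obtain ⟨Γ⟩ := T.exists_sweepingLoop
    exact ⟨Γ, h X T Γ⟩
  · obtain ⟨Γ⟩ := T.exists_sweepingLoop
    exact ⟨Γ, FourColour.nonVanishing_of_fourColourTheorem h Γ⟩
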